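/- **Model.** Classical algorithms are families $(C_n)$ of Boolean circuits (NOT, CNOT, Toffoli gates) whose size is polynomial in the security parameter $n$, with uniformly random coins as additional input; they may have gates for oracle queries and for queries to another party. Quantum algorithms are families of polynomial-size quantum circuits (the previous gates, Hadamard, phase, $\pi/8$); an oracle $f:\{0,1\}^a\to\{0,1\}^b$ is accessed through $|x,y\rangle\mapsto|x,y\oplus f(x)\rangle$, while a classical query to another party first measures the query register. All inputs and outputs are bit strings of lengths polynomial in $n$. A function $\epsilon(n)$ is negligible if $|\epsilon(n)|<n^{-c}$ for every $c$ and all large $n$. **Problem.** A problem $P$ (with threshold $0$) is a game in which a classical challenger with private coins sends an instance $x$ to an adversary, answers its classical queries, receives an output $y$, and decides whether the adversary has won. $P$ is hard for quantum computers if every polynomial-size quantum adversary wins with negligible probability only. **Signature scheme.** $\mathcal S=(G,S^O,V^O)$ consists of classical polynomial-size algorithms with access to a random oracle $O$ (except $G$), such that $V^O(\mathsf{pk},m,S^O(\mathsf{sk},m))=1$ for all $m$, $O$ and all generated $(\mathsf{sk},\mathsf{pk})$. It is existentially unforgeable in the quantum-accessible random oracle model if every polynomial-size quantum algorithm that is given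 $\mathsf{pk}$, quantum access to a uniformly random $O$ and classical access to $S^O(\mathsf{sk},\cdot)$ outputs with negligible probability only a pair $(m,\sigma)$ with $V^O(\mathsf{pk},m,\sigma)=1$ such that $m$ was not queried. **History-free reduction.** $\mathcal S$ has a history-free reduction from $P$ if for every polynomial $q$ there are classical polynomial-size algorithms $\mathrm{START}$, $\mathrm{RAND}^{O_c}$, $\mathrm{SIGN}^{O_c}$, $\mathrm{FINISH}^{O_c}$, $\mathrm{INSTANCE}$, where $O_c$ is a shared random oracle, $\mathrm{RAND}$ and $\mathrm{INSTANCE}$ are deterministic, and $\mathrm{START}$, $\mathrm{SIGN}$, $\mathrm{FINISH}$ may query the challenger of $P$, which are used as follows: given an instance $x$ of $P$, compute $(\mathsf{pk},z)\leftarrow\mathrm{START}(x)$ and send $\mathsf{pk}$ to a forger; answer random oracle queries by $O(r)=\mathrm{RAND}^{O_c}(r,z)$ and signature queries by $\mathrm{SIGN}^{O_c}(m,z)$, which may abort; when the forger outputs $(m,\sigma)$, send $\mathrm{FINISH}^{O_c}(m,\sigma,z)$ to the challenger of $P$. The following is required. 1. For every generated $\mathsf{pk}$, $\mathrm{START}$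 on the instance $\mathrm{INSTANCE}(\mathsf{pk})$ of $P$ always outputs $\mathsf{pk}$ as public key; and for $(\mathsf{sk},\mathsf{pk})\leftarrow G(1^n)$ the distribution of $\mathrm{INSTANCE}(\mathsf{pk})$ is within negligible variational distance of the distribution of $x$ in the game of $P$. 2. For all fixed $z=z_n$ that $\mathrm{START}$ can output in the game of $P$, the oracle $O=\mathrm{RAND}^{O_c}(\cdot,z)$ (with $O_c$ random) cannot be distinguished from a random oracle with non-negligible advantage by polynomial-size quantum algorithms with quantum access to the oracle. 3. There is a polynomial $p$ such that for every polynomial-size quantum algorithm $D$ that is given $\mathsf{pk}$, quantum access to $O=\mathrm{RAND}^{O_c}(\cdot,z)$ and classical access to a signer with at most $q(n)$ queries, $$\Pr[D=1\text{ with signer }S^{O}(\mathsf{sk},\cdot)]\le p(n)\cdot\Pr[\text{no query aborts and }D=1\text{ with signer }\mathrm{SIGN}^{O_c}(\cdot,z)]+\epsilon_D(n)$$ for a negligible $\epsilon_D$, where $(\mathsf{pk},z)$ comes from $\mathrm{START}$ in the game of $P$ and $\mathsf{sk}$ is drawn from $G$ conditioned on $\mathsf{pk}$ (if $G$ cannot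 generate $\mathsf{pk}$, such a run counts $0$ on the left). (Thus, with at least inverse polynomial probability, no signature query aborts and the signatures are like those of the correct signing algorithm.) 4. There are a polynomial $p$ and a negligible $\epsilon$ such that for every (computationally unbounded, deterministic) classical forger that sees $\mathsf{pk}$ and the whole table of $O=\mathrm{RAND}^{O_c}(\cdot,z)$ and makes at most $q(n)$ adaptive signature queries to $\mathrm{SIGN}^{O_c}(\cdot,z)$, $$\Pr[\text{no query aborts and the forger outputs a valid forgery relative to }\mathsf{pk},O]\le p(n)\cdot\Pr[\mathrm{FINISH}^{O_c}\text{ makes the challenger of }P\text{ output }1]+\epsilon(n),$$ where an aborted run counts $0$ on both sides. **Quantum-accessible PRF.** There are classical polynomial-size deterministic algorithms $F_n:\{0,1\}^n\times\{0,1\}^n\to\{0,1\}^n$ such that no polynomial-size quantum algorithm with quantum oracle access distinguishes $F_n(k,\cdot)$, for random $k$, from a random function with non-negligible advantage. **Theorem.** If $\mathcal S$ has a history-free reduction from $P$, $P$ is hard for quantum computers, and quantum-accessible PRFs exist, then $\mathcal S$ is existentially unforgeable in the quantum-accessible random oracle model. -/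

import Mathlib

open scoped BigOperators

namespace QROM

noncomputable section

/-! ## Asymptotics -/

/-- `f` decreases faster than the inverse of every polynomial. -/
def Negligible (f : ℕ → ℝ) : Prop :=
  Asymptotics.SuperpolynomialDecay Filter.atTop (fun n : ℕ => (n : ℝ)) f

/-- `f` is bounded by a polynomial. -/
def PolyBounded (f : ℕ → ℕ) : Prop :=
  ∃ p : Polynomial ℕ, ∀ n, f n ≤ p.eval n

/-- The indicator of a Boolean, as a real number. -/
def ind (b : Bool) : ℝ := if b then 1 else 0

/-! ## Circuits

Bit strings are functions `ι → Bool` on a finite index type `ι`; the index type `ι ⊕ κ` stands for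
the concatenation of two strings. A circuit acts on a finite set `W` of wires by elementary gates,
by queries to an oracle `f : {0,1}^A → {0,1}^B`, and by classical calls to another party (query in
`{0,1}^C`, answer in `{0,1}^D`). An index type `Empty` means that there is no such oracle or party.
-/

/-- The bit strings indexed by `ι`. -/
abbrev Bits (ι : Type) : Type := ι → Bool

/-- The strings of `n` bits. -/
abbrev BitStr (n : ℕ) : Type := Fin n → Bool

/-- The queries made so far to a party, with its answers, in chronological order. -/
abbrev Transcript (C D : Type) : Type := List (Bits C × Bits D)

/-- Classical reversible gates: NOT, CNOT and Toffoli (the target is the last wire). -/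
inductive RevGate (W : Type) : Type
  | x (i : W) : RevGate W
  | cx (i j : W) (h : i ≠ j) : RevGate W
  | ccx (i j k : W) (hik : i ≠ k) (hjk : j ≠ k) : RevGate W

/-- The action of a reversible gate on a bit string (an involution). -/
def RevGate.apply {W : Type} [DecidableEq W] : RevGate W → Bits W → Bits W
  | .x i, w => Function.update w i (!(w i))
  | .cx i j _, w => Function.update w j (xor (w j) (w i))
  | .ccx i j k _ _, w => Function.update w k (xor (w k) (w i && w j))

/-- Quantum gates: the reversible gates, Hadamard, phase, and the `π/8` gate. -/
inductive QGate (W : Type) : Type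
  | rev (g : RevGate W) : QGate W
  | had (i : W) : QGate W
  | phase (i : W) : QGate W
  | t (i : W) : QGate W

/-- The unitary action of a gate on the amplitudes of a state. A reversible gate is an involution,
so precomposition with it sends the basis state of `w` to that of `g.apply w`. -/
def QGate.act {W : Type} [DecidableEq W] : QGate W → (Bits W → ℂ) → (Bits W → ℂ)
  | .rev g, ψ => fun w => ψ (g.apply w)
  | .had i, ψ => fun w =>
      (ψ (Function.update w i false) + (if w i then -1 else 1) * ψ (Function.update w i true))
        / (Real.sqrt 2 : ℂ)
  | .phase i, ψ => fun w => (if w i then Complex.I else 1) * ψ w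
  | .t i, ψ => fun w => (if w i then Complex.exp (Complex.I * (Real.pi : ℂ) / 4) else 1) * ψ w

/-- One step of a circuit: a gate, an oracle query, or a classical call to the other party. -/
inductive Instr (Γ W A B C D : Type) : Type
  | gate (g : Γ) : Instr Γ W A B C D
  | query (i : A → W) (o : B ↪ W) (h : ∀ a b, i a ≠ o b) : Instr Γ W A B C D
  | call (i : C → W) (o : D ↪ W) (h : ∀ c d, i c ≠ o d) : Instr Γ W A B C D

/-- Whether a step is a call to the other party. -/
def Instr.isCall {Γ W A B C D : Type} : Instr Γ W A B C D → Bool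
  | .call _ _ _ => true
  | _ => false

/-- XOR the string `v` into the wires `o`. -/
def xorInto {W B : Type} (o : B ↪ W) (v : Bits B) (w : Bits W) : Bits W :=
  fun k => xor (w k) (Function.extend o v (fun _ => false) k)

/-- A circuit with input bits `I` and output bits `O`; all other wires start as `0`. -/
structure Circuit (Γ : Type → Type) (I O A B C D : Type) where
  W : Type
  [fintypeW : Fintype W]
  [decEqW : DecidableEq W]
  inp : I ↪ W
  out : O → W
  prog : List (Instr (Γ W) W A B C D)

attribute [instance] Circuit.fintypeW Circuit.decEqW

/-- Classical circuits. Randomized algorithms take their coins as part of the input. -/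
abbrev CAlg (I O A B C D : Type) := Circuit RevGate I O A B C D

/-- Quantum circuits. -/
abbrev QAlg (I O A B C D : Type) := Circuit QGate I O A B C D

namespace Circuit

variable {Γ : Type → Type} {I O A B C D : Type}

/-- The number of steps plus the number of wires. -/
def size (c : Circuit Γ I O A B C D) : ℕ := c.prog.length + Fintype.card c.W

/-- The number of calls to the other party. -/
def calls (c : Circuit Γ I O A B C D) : ℕ := c.prog.countP Instr.isCall

/-- The content of the wires at the start. -/
def start (c : Circuit Γ I O A B C D) (x : Bits I) : Bits c.W :=
  Function.extend c.inp x (fun _ => false)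

end Circuit

/-! ### Classical execution -/

/-- One classical step, with oracle `f` and a party that answers by `ans` (depending on the
transcript so far). The state is the content of the wires and the transcript. -/
def Instr.exec {W A B C D : Type} [DecidableEq W] (f : Bits A → Bits B)
    (ans : Transcript C D → Bits C → Bits D) :
    Bits W × Transcript C D → Instr (RevGate W) W A B C D → Bits W × Transcript C D
  | (w, h), .gate g => (g.apply w, h)
  | (w, h), .query i o _ => (xorInto o (f (w ∘ i)) w, h)
  | (w, h), .call i o _ => (xorInto o (ans h (w ∘ i)) w, h ++ [(w ∘ i, ans h (w ∘ i))])

/-- Output of a classical circuit on input `x`, and the transcript after it, if the transcript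
before it is `h`. -/
def Circuit.run {I O A B C D : Type} (c : CAlg I O A B C D) (f : Bits A → Bits B)
    (ans : Transcript C D → Bits C → Bits D) (h : Transcript C D) (x : Bits I) :
    Bits O × Transcript C D :=
  let st := c.prog.foldl (Instr.exec f ans) (c.start x, h)
  (st.1 ∘ c.out, st.2)

/-- Output of a classical circuit that talks to no other party. -/
def Circuit.eval {I O A B : Type} (c : CAlg I O A B Empty Empty) (f : Bits A → Bits B)
    (x : Bits I) : Bits O :=
  (c.run f (fun _ _ => Empty.elim) [] x).1

/-! ### Quantum execution -/

/-- Expected value of `val` (a function of the final state of the party and of the measured wires)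
when the steps of a quantum circuit are carried out from the unnormalized state `ψ`. An oracle query
maps `|x, y⟩` to `|x, y ⊕ f x⟩`. A call measures the query register and sends the outcome `v` to the
party; the party, in state `st` and with fresh uniform coins `r`, either aborts (then the run ends
and contributes `0`) or gives an answer, which is XORed into the answer register, and changes its
state. -/
def qexpect {W A B C D R St : Type} [Fintype W] [DecidableEq W] [Fintype C] [DecidableEq C]
    [Fintype R] (f : Bits A → Bits B) (step : St → Bits C → R → Option (Bits D × St))
    (val : St → Bits W → ℝ) :
    List (Instr (QGate W) W A B C D) → St → (Bits W → ℂ) → ℝ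
  | [], st, ψ => ∑ w, ‖ψ w‖ ^ 2 * val st w
  | .gate g :: p, st, ψ => qexpect f step val p st (g.act ψ)
  | .query i o _ :: p, st, ψ => qexpect f step val p st (fun w => ψ (xorInto o (f (w ∘ i)) w))
  | .call i o _ :: p, st, ψ => ∑ v : Bits C, 𝔼 r : R,
      match step st v r with
      | none => 0
      | some (y, st') =>
        qexpect f step val p st' (fun w => if w ∘ i = v then ψ (xorInto o y w) else 0)

/-- Probability that the quantum circuit `c` on input `x` runs without an abort of the party, whose
initial state is `st`, and that the final state of the party and the measured output of `c` satisfy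
`acc`. -/
def Circuit.prob {I O A B C D R St : Type} [Fintype C] [DecidableEq C] [Fintype R]
    (c : QAlg I O A B C D) (f : Bits A → Bits B) (step : St → Bits C → R → Option (Bits D × St))
    (st : St) (acc : St → Bits O → Bool) (x : Bits I) : ℝ :=
  qexpect f step (fun st' w => ind (acc st' (w ∘ c.out))) c.prog st
    (fun w => if w = c.start x then 1 else 0)

/-- A quantum oracle distinguisher: no input, no other party, one output bit. -/
abbrev Distinguisher (a b : ℕ) := QAlg Empty Unit (Fin a) (Fin b) Empty Empty

/-- Probability that a distinguisher outputs `1` with oracle `f`. -/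
def acceptProb {a b : ℕ} (d : Distinguisher a b) (f : BitStr a → BitStr b) : ℝ :=
  d.prob f (fun _ _ (_ : Unit) => some (Empty.elim, ())) () (fun _ y => y ()) Empty.elim

/-! ## Quantum-accessible pseudorandom functions -/

/-- There is an efficient `F_n : {0,1}^n × {0,1}^n → {0,1}^n` such that `F_n(k, ·)`, for a random
key `k`, cannot be distinguished from a random function with quantum oracle access. -/
def QuantumPRFExists : Prop :=
  ∃ F : ∀ n, CAlg (Fin n ⊕ Fin n) (Fin n) Empty Empty Empty Empty,
    PolyBounded (fun n => (F n).size) ∧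
    ∀ d : ∀ n, Distinguisher n n, PolyBounded (fun n => (d n).size) →
      Negligible fun n =>
        |(𝔼 k : BitStr n, acceptProb (d n) (fun x => (F n).eval id (Sum.elim k x)))
          - 𝔼 f : BitStr n → BitStr n, acceptProb (d n) f|

/-! ## Problems -/

/-- A game between an adversary and a classical challenger with private coins `s`: the challenger
sends the instance `inst s`, answers classical queries, and finally decides whether the adversary,
who outputs a `y`, has won. The threshold of the problem is `0`: the advantage of an
adversary is its probability to win. -/
structure Problem where
  (coinLen xLen qLen aLen yLen : ℕ → ℕ)
  polyLen : PolyBounded xLen ∧ PolyBounded qLen ∧ PolyBounded aLen ∧ PolyBounded yLen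
  inst : ∀ n, BitStr (coinLen n) → BitStr (xLen n)
  ans : ∀ n, BitStr (coinLen n) → Transcript (Fin (qLen n)) (Fin (aLen n)) →
    BitStr (qLen n) → BitStr (aLen n)
  win : ∀ n, BitStr (coinLen n) → Transcript (Fin (qLen n)) (Fin (aLen n)) →
    BitStr (yLen n) → Bool

namespace Problem

variable (P : Problem)

/-- Quantum adversaries for `P`: instance in, solution out, classical queries to the challenger. -/
abbrev Adversary (n : ℕ) :=
  QAlg (Fin (P.xLen n)) (Fin (P.yLen n)) Empty Empty (Fin (P.qLen n)) (Fin (P.aLen n))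

/-- Probability that the adversary wins. -/
def winProb (n : ℕ) (A : P.Adversary n) : ℝ :=
  𝔼 s, A.prob id (fun h v (_ : Unit) => some (P.ans n s h v, h ++ [(v, P.ans n s h v)])) []
    (P.win n s) (P.inst n s)

/-- Every polynomial-size quantum adversary wins with negligible probability only. -/
def QuantumHard : Prop :=
  ∀ A : ∀ n, P.Adversary n, PolyBounded (fun n => (A n).size) →
    Negligible fun n => P.winProb n (A n)

end Problem

/-! ## Signature schemes -/

/-- A signature scheme in the random oracle model: `gen` maps coins to `(sk, pk)`, `sign` maps
`(sk, m)` and coins to a signature, `verify` maps `(pk, m, σ)` to a bit; the last two have access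
to a random oracle `{0,1}^inLen → {0,1}^outLen`. -/
structure SignatureScheme where
  (skLen pkLen msgLen sigLen inLen outLen genCoins signCoins : ℕ → ℕ)
  gen : ∀ n, CAlg (Fin (genCoins n)) (Fin (skLen n) ⊕ Fin (pkLen n)) Empty Empty Empty Empty
  sign : ∀ n, CAlg (Fin (skLen n) ⊕ Fin (msgLen n) ⊕ Fin (signCoins n)) (Fin (sigLen n))
    (Fin (inLen n)) (Fin (outLen n)) Empty Empty
  verify : ∀ n, CAlg (Fin (pkLen n) ⊕ Fin (msgLen n) ⊕ Fin (sigLen n)) Unit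
    (Fin (inLen n)) (Fin (outLen n)) Empty Empty
  polyLen : PolyBounded skLen ∧ PolyBounded pkLen ∧ PolyBounded msgLen ∧ PolyBounded sigLen ∧
    PolyBounded inLen ∧ PolyBounded outLen
  efficient : PolyBounded (fun n => (gen n).size) ∧ PolyBounded (fun n => (sign n).size) ∧
    PolyBounded (fun n => (verify n).size)
  correct : ∀ (n : ℕ) (f : BitStr (inLen n) → BitStr (outLen n)) (g : BitStr (genCoins n))
    (m : BitStr (msgLen n)) (r : BitStr (signCoins n)),
    (verify n).eval f (Sum.elim ((gen n).eval id g ∘ Sum.inr) (Sum.elim m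
      ((sign n).eval f (Sum.elim ((gen n).eval id g ∘ Sum.inl) (Sum.elim m r))))) () = true

namespace SignatureScheme

variable (S : SignatureScheme) (n : ℕ)

abbrev SK := BitStr (S.skLen n)
abbrev PK := BitStr (S.pkLen n)
abbrev Msg := BitStr (S.msgLen n)
abbrev Sig := BitStr (S.sigLen n)
abbrev Oracle := BitStr (S.inLen n) → BitStr (S.outLen n)
/-- Signature queries made so far, with their answers. -/
abbrev History := List (S.Msg n × S.Sig n)

def sk (g : BitStr (S.genCoins n)) : S.SK n := (S.gen n).eval id g ∘ Sum.inl
def pk (g : BitStr (S.genCoins n)) : S.PK n := (S.gen n).eval id g ∘ Sum.inr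

/-- The signing algorithm with coins `r`. -/
def signWith (f : S.Oracle n) (sk : S.SK n) (m : S.Msg n) (r : BitStr (S.signCoins n)) :
    S.Sig n :=
  (S.sign n).eval f (Sum.elim sk (Sum.elim m r))

/-- The verification algorithm. -/
def verifies (f : S.Oracle n) (pk : S.PK n) (m : S.Msg n) (σ : S.Sig n) : Bool :=
  (S.verify n).eval f (Sum.elim pk (Sum.elim m σ)) ()

/-- `(m, σ)` is a valid forgery: a valid signature on a message that is not among the queried
messages `ms`. -/
def validForgery (f : S.Oracle n) (pk : S.PK n) (ms : List (S.Msg n)) (m : S.Msg n)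
    (σ : S.Sig n) : Bool :=
  S.verifies n f pk m σ && decide (m ∉ ms)

/-- Quantum forgers: public key in, message and signature out, quantum access to the random
oracle, classical signature queries. -/
abbrev QForger :=
  QAlg (Fin (S.pkLen n)) (Fin (S.msgLen n) ⊕ Fin (S.sigLen n)) (Fin (S.inLen n))
    (Fin (S.outLen n)) (Fin (S.msgLen n)) (Fin (S.sigLen n))

/-- Probability that `A` outputs a valid forgery in the chosen message attack game with a
quantum-accessible random oracle. -/
def forgeProb (A : S.QForger n) : ℝ :=
  𝔼 f : S.Oracle n, 𝔼 g : BitStr (S.genCoins n),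
    A.prob f (fun ms m r => some (S.signWith n f (S.sk n g) m r, ms ++ [m])) []
      (fun ms y => S.validForgery n f (S.pk n g) ms (y ∘ Sum.inl) (y ∘ Sum.inr)) (S.pk n g)

/-- Quantum distinguishers for pairs of a random oracle and a signer: public key in, one bit out,
quantum access to the random oracle, classical signature queries. -/
abbrev SignDistinguisher :=
  QAlg (Fin (S.pkLen n)) Unit (Fin (S.inLen n)) (Fin (S.outLen n)) (Fin (S.msgLen n))
    (Fin (S.sigLen n))

/-- Existential unforgeability under chosen message attacks in the quantum-accessible random
oracle model, against polynomial-size quantum adversaries. -/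
def QuantumUnforgeable : Prop :=
  ∀ A : ∀ n, S.QForger n, PolyBounded (fun n => (A n).size) →
    Negligible fun n => S.forgeProb n (A n)

end SignatureScheme

/-! ## History-free reductions -/

/-- The five algorithms of a reduction from `P` to forging signatures of `S`, with the lengths of
its private state `z` and of the input and output of its own random oracle. `startAlg`, `signAlg`
and `finishAlg` may query the challenger of `P`; `randAlg`, `signAlg` and `finishAlg` may query the
reduction's random oracle. The output bit `none` of `signAlg` is the abort flag. -/
structure Reduction (S : SignatureScheme) (P : Problem) where
  (zLen cInLen cOutLen startCoins signCoins finishCoins : ℕ → ℕ)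
  startAlg : ∀ n, CAlg (Fin (P.xLen n) ⊕ Fin (startCoins n)) (Fin (S.pkLen n) ⊕ Fin (zLen n))
    Empty Empty (Fin (P.qLen n)) (Fin (P.aLen n))
  randAlg : ∀ n, CAlg (Fin (S.inLen n) ⊕ Fin (zLen n)) (Fin (S.outLen n))
    (Fin (cInLen n)) (Fin (cOutLen n)) Empty Empty
  signAlg : ∀ n, CAlg (Fin (S.msgLen n) ⊕ Fin (zLen n) ⊕ Fin (signCoins n))
    (Option (Fin (S.sigLen n)))
    (Fin (cInLen n)) (Fin (cOutLen n)) (Fin (P.qLen n)) (Fin (P.aLen n))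
  finishAlg : ∀ n, CAlg
    (Fin (S.msgLen n) ⊕ Fin (S.sigLen n) ⊕ Fin (zLen n) ⊕ Fin (finishCoins n)) (Fin (P.yLen n))
    (Fin (cInLen n)) (Fin (cOutLen n)) (Fin (P.qLen n)) (Fin (P.aLen n))
  instAlg : ∀ n, CAlg (Fin (S.pkLen n)) (Fin (P.xLen n)) Empty Empty Empty Empty
  polyLen : PolyBounded zLen ∧ PolyBounded cInLen ∧ PolyBounded cOutLen
  efficient : PolyBounded (fun n => (startAlg n).size) ∧ PolyBounded (fun n => (randAlg n).size) ∧
    PolyBounded (fun n => (signAlg n).size) ∧ PolyBounded (fun n => (finishAlg n).size) ∧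
    PolyBounded (fun n => (instAlg n).size)

/-- Expected value of `val` after a forger, who chooses its next signature query by `next` (or
stops), has interacted with a signer for at most the given number of queries. The signer has an
internal state, uses fresh coins `r` for each query, and aborts by answering `none`; a run in which
it aborts contributes `0`. -/
def play {M Sg St R : Type} [Fintype R] (next : List (M × Sg) → Option M)
    (step : St → M → R → Option (Sg × St)) (val : List (M × Sg) → St → ℝ) :
    ℕ → List (M × Sg) → St → ℝ
  | 0, t, st => val t st
  | k + 1, t, st =>
    match next t with
    | none => val t st
    | some m => 𝔼 r : R,
        match step st m r with
        | none => 0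
        | some (σ, st') => play next step val k (t ++ [(m, σ)]) st'

namespace Reduction

variable {S : SignatureScheme} {P : Problem} (R : Reduction S P) (n : ℕ)

abbrev Z := BitStr (R.zLen n)
/-- The reduction's own random oracle. -/
abbrev COracle := BitStr (R.cInLen n) → BitStr (R.cOutLen n)

/-- Run of START on the instance of the challenger with coins `s`. -/
def startRun (s : BitStr (P.coinLen n)) (r : BitStr (R.startCoins n)) :
    Bits (Fin (S.pkLen n) ⊕ Fin (R.zLen n)) × Transcript (Fin (P.qLen n)) (Fin (P.aLen n)) :=
  (R.startAlg n).run id (P.ans n s) [] (Sum.elim (P.inst n s) r)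

def startPK (s : BitStr (P.coinLen n)) (r : BitStr (R.startCoins n)) : S.PK n :=
  (R.startRun n s r).1 ∘ Sum.inl

def startZ (s : BitStr (P.coinLen n)) (r : BitStr (R.startCoins n)) : R.Z n :=
  (R.startRun n s r).1 ∘ Sum.inr

/-- The simulated random oracle `RAND^Oc(·, z)`. -/
def simOracle (Oc : R.COracle n) (z : R.Z n) : S.Oracle n :=
  fun x => (R.randAlg n).eval Oc (Sum.elim x z)

/-- One signature query answered by `SIGN^Oc(m, z)`, the challenger of `P` having coins `s`. -/
def signStep (s : BitStr (P.coinLen n)) (Oc : R.COracle n) (z : R.Z n)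
    (h : Transcript (Fin (P.qLen n)) (Fin (P.aLen n))) (m : S.Msg n)
    (r : BitStr (R.signCoins n)) :
    Option (S.Sig n × Transcript (Fin (P.qLen n)) (Fin (P.aLen n))) :=
  let y := (R.signAlg n).run Oc (P.ans n s) h (Sum.elim m (Sum.elim z r))
  if y.1 none then none else some (y.1 ∘ some, y.2)

/-- The output of `FINISH^Oc(m, σ, z)` makes the challenger with coins `s` output `1`. -/
def finishWins (s : BitStr (P.coinLen n)) (Oc : R.COracle n) (z : R.Z n)
    (h : Transcript (Fin (P.qLen n)) (Fin (P.aLen n))) (m : S.Msg n) (σ : S.Sig n)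
    (r : BitStr (R.finishCoins n)) : Bool :=
  let y := (R.finishAlg n).run Oc (P.ans n s) h (Sum.elim m (Sum.elim σ (Sum.elim z r)))
  P.win n s y.2 y.1

/-- The reduction plays against the challenger of `P` and simulates the signature game for a
computationally unbounded forger that sees the public key, the whole simulated oracle and at most
`q` signatures. This is the expected value of `val`, where runs with an aborted signature query
contribute `0`. -/
def simGame (q : ℕ) (next : S.PK n → S.Oracle n → S.History n → Option (S.Msg n))
    (val : BitStr (P.coinLen n) → R.COracle n → S.PK n → R.Z n → S.History n →
      Transcript (Fin (P.qLen n)) (Fin (P.aLen n)) → ℝ) : ℝ :=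
  𝔼 s : BitStr (P.coinLen n), 𝔼 r : BitStr (R.startCoins n), 𝔼 Oc : R.COracle n,
    play (next (R.startPK n s r) (R.simOracle n Oc (R.startZ n s r)))
      (R.signStep n s Oc (R.startZ n s r))
      (val s Oc (R.startPK n s r) (R.startZ n s r)) q [] (R.startRun n s r).2

/-- The reduction plays against the challenger of `P`, with quantum access to its simulated random
oracle: probability that no signature query aborts and that `d` outputs `1`. -/
def simProb (d : S.SignDistinguisher n) : ℝ :=
  𝔼 s : BitStr (P.coinLen n), 𝔼 r : BitStr (R.startCoins n), 𝔼 Oc : R.COracle n,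
    d.prob (R.simOracle n Oc (R.startZ n s r)) (R.signStep n s Oc (R.startZ n s r))
      (R.startRun n s r).2 (fun _ y => y ()) (R.startPK n s r)

/-- As `simProb`, with the same simulated oracle, but signature queries are answered by the signing
algorithm of the scheme, with a secret key drawn from the key generation algorithm conditioned on
the given public key. -/
def honestProb (d : S.SignDistinguisher n) : ℝ :=
  𝔼 s : BitStr (P.coinLen n), 𝔼 r : BitStr (R.startCoins n),
    𝔼 g : BitStr (S.genCoins n) with S.pk n g = R.startPK n s r, 𝔼 Oc : R.COracle n,
      d.prob (R.simOracle n Oc (R.startZ n s r))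
        (fun (_ : Unit) m ρ =>
          some (S.signWith n (R.simOracle n Oc (R.startZ n s r)) (S.sk n g) m ρ, ()))
        () (fun _ y => y ()) (R.startPK n s r)

/-- `INSTANCE(pk)` is an instance on which START yields `pk`, and for generated keys it is
distributed as the instances of `P`, up to a negligible variational distance. -/
def InstanceOK : Prop :=
  (∀ n g s r, P.inst n s = (R.instAlg n).eval id (S.pk n g) → R.startPK n s r = S.pk n g) ∧
  Negligible fun n => ∑ x : BitStr (P.xLen n),
    |(𝔼 s, ind (decide (P.inst n s = x)))
      - 𝔼 g, ind (decide ((R.instAlg n).eval id (S.pk n g) = x))|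

/-- For fixed `z`, the oracle `RAND^Oc(·, z)` cannot be distinguished from a random oracle by
polynomial-size quantum algorithms. -/
def RandOK : Prop :=
  ∀ (s : ∀ n, BitStr (P.coinLen n)) (r : ∀ n, BitStr (R.startCoins n))
    (d : ∀ n, Distinguisher (S.inLen n) (S.outLen n)), PolyBounded (fun n => (d n).size) →
    Negligible fun n =>
      |(𝔼 Oc : R.COracle n, acceptProb (d n) (R.simOracle n Oc (R.startZ n (s n) (r n))))
        - 𝔼 f : S.Oracle n, acceptProb (d n) f|

/-- Up to a negligible error, it happens with at least inverse polynomial probability that no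
signature query aborts and that the answers of SIGN are like those of the correct signing algorithm
relative to the simulated oracle. Precisely, for a polynomial `p`, every polynomial-size quantum
distinguisher `d` with at most `q` signature queries satisfies
`Pr[d = 1 with correct signatures] ≤ p · Pr[no abort and d = 1 with SIGN] + negl`. If `d` always
outputs `1`, then this bounds below the probability that no query aborts. If SIGN never aborts and
`p = 1`, then it says that SIGN is indistinguishable from the correct signing algorithm, which holds
in particular if the distributions are statistically close. -/
def SignOK (q : ℕ → ℕ) : Prop :=
  ∃ p : Polynomial ℕ, ∀ d : ∀ n, S.SignDistinguisher n,
    PolyBounded (fun n => (d n).size) → (∀ n, (d n).calls ≤ q n) →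
    ∃ ε : ℕ → ℝ, Negligible ε ∧
      ∀ n, R.honestProb n (d n) ≤ ((p.eval n : ℕ) : ℝ) * R.simProb n (d n) + ε n

/-- If the forger outputs a valid forgery, relative to the public key and the simulated oracle, then
FINISH wins the game of `P` with at least inverse polynomial probability, up to a negligible
error. -/
def FinishOK (q : ℕ → ℕ) : Prop :=
  ∃ (p : Polynomial ℕ) (ε : ℕ → ℝ), Negligible ε ∧
    ∀ (n : ℕ) (next : S.PK n → S.Oracle n → S.History n → Option (S.Msg n))
      (out : S.PK n → S.Oracle n → S.History n → S.Msg n × S.Sig n),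
      R.simGame n (q n) next (fun _ Oc pk z t _ =>
          let f := R.simOracle n Oc z
          ind (S.validForgery n f pk (t.map Prod.fst) (out pk f t).1 (out pk f t).2)) ≤
        ((p.eval n : ℕ) : ℝ) * R.simGame n (q n) next (fun s Oc pk z t h =>
          let f := R.simOracle n Oc z
          𝔼 r, ind (R.finishWins n s Oc z h (out pk f t).1 (out pk f t).2 r)) + ε n

/-- The reduction is history-free, for forgers that make at most `q n` signature queries. -/
def HistoryFree (q : ℕ → ℕ) : Prop :=
  R.InstanceOK ∧ R.RandOK ∧ R.SignOK q ∧ R.FinishOK q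

end Reduction

/-- `S` has a history-free reduction from `P`; it may depend on a polynomial bound for the number of
signature queries of the forger. -/
def HasHistoryFreeReduction (S : SignatureScheme) (P : Problem) : Prop :=
  ∀ q : Polynomial ℕ, ∃ R : Reduction S P, R.HistoryFree fun n => q.eval n

end

end QROM

/-!
The forger `Q` is compared in three games. In the game of the scheme it faces a random oracle and
the correct signer. In the second game the key comes from START, the oracle is RAND, and the
signer still signs with a secret key that fits the public key. In the third game the signer is
SIGN.

* From the first to the second game: the keys have almost the same distribution because INSTANCE
  maps generated keys almost to the instances of `P`, and START recovers the key from such an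
  instance (`expect_le_add_dist`). The oracles differ negligibly because a distinguisher can
  contain the secret key, and therefore run the signer by itself (`exists_rand_distinguisher`).
* From the second to the third game: the forger followed by the verification of its forgery is a
  distinguisher for signers (`exists_signDistinguisher`), so at most a polynomial factor and a
  negligible summand are lost.
* In the third game FINISH wins the game of `P`. This is assumed only for classical,
  deterministic, unbounded forgers. A quantum forger with quantum access to a known function `f`
  and classical access to a signer obtains information about the signer only from the measured
  queries and their answers. For given `(pk, f)`, the difference between the probability of a
  forgery and a multiple of the probability that FINISH wins is an average over the outcomes of
  the measurements, so that it is bounded by its value for a deterministic choice of the outcomes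
  (`exists_strategy`).

The reduction together with the forger is then a quantum adversary for `P`, except that it still
queries a private random oracle with superpositions. The probability that an algorithm with `k`
quantum queries accepts is a polynomial of degree `2 k` in the values of the oracle
(`LowDeg.qexpect`). It does not change if the random oracle is replaced by a random polynomial of
degree less than `2 k` over a field with `2 ^ m` elements, whose values at any `2 k` points are
independent and uniform (`exists_independent_family`). Such an information-theoretic argument is
needed: the challenger of `P` may be inefficient, so that the game of `P` does not yield an
efficient distinguisher for a pseudorandom function.

Adversaries are nonuniform, which makes all coins removable: a circuit contains the best values of
keys and coins. Since coins of a party are drawn afresh at each query, the best value of the coins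
is chosen separately for each position of a query in the circuit (`exists_coins`).

All these algorithms are instances of one construction, `Assembly`: a quantum circuit `Q` inside a
larger one, with its oracle and its party replaced by classical circuits. Oracle queries are
computed reversibly and uncomputed. Calls are classical, so the query is copied to a fresh
register that is not changed any more; by the principle of deferred measurement (`qexpect_split`)
this has the same effect as measuring it, and leftover garbage does no harm.
`Assembly.prob_circuit` says what the assembled circuit computes, `Assembly.size_circuit_le`
bounds its size. The explicit constants in the bounds on sizes only matter in that they are
constants.
-/

open scoped BigOperators

namespace QROM

noncomputable section

set_option linter.unusedSectionVars false

/-! ### Reversible steps as involutions of the basis states -/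

section

variable {Γ Γ' V W A B C D R St : Type}

theorem xorInto_emb (o : B ↪ W) (v : Bits B) (w : Bits W) (b : B) :
    xorInto o v w (o b) = xor (w (o b)) (v b) := by
  simp [xorInto, o.injective.extend_apply]

theorem xorInto_of_ne {o : B ↪ W} (v : Bits B) (w : Bits W) {k : W} (h : ∀ b, o b ≠ k) :
    xorInto o v w k = w k := by
  have : ¬ ∃ b, o b = k := by simpa using h
  simp [xorInto, Function.extend_apply' _ _ _ this]

theorem xorInto_comp_of_ne {X : Type} {o : B ↪ W} (v : Bits B) (w : Bits W) {i : X → W}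
    (h : ∀ a b, i a ≠ o b) : xorInto o v w ∘ i = w ∘ i :=
  funext fun a => xorInto_of_ne v w fun b => (h a b).symm

@[simp] theorem xorInto_xorInto (o : B ↪ W) (v : Bits B) (w : Bits W) :
    xorInto o v (xorInto o v w) = w := by
  funext k; simp [xorInto]

@[simp] theorem xorInto_empty (o : Empty ↪ W) (v : Bits Empty) (w : Bits W) :
    xorInto o v w = w :=
  funext fun _ => xorInto_of_ne v w (fun b => b.elim)

theorem extend_comp_emb (j : V ↪ W) (v : Bits V) (w : Bits W) : Function.extend j v w ∘ j = v :=
  Function.extend_comp j.injective _ _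

theorem extend_of_ne {j : V ↪ W} (v : Bits V) (w : Bits W) {k : W} (h : ∀ b, j b ≠ k) :
    Function.extend j v w k = w k :=
  Function.extend_apply' _ _ _ (by simpa using h)

theorem extend_comp_of_ne {X : Type} {j : V ↪ W} (v : Bits V) (w : Bits W) {i : X → W}
    (h : ∀ a b, i a ≠ j b) : Function.extend j v w ∘ i = w ∘ i :=
  funext fun a => extend_of_ne v w fun b => (h a b).symm

/-- Two states agree if they agree on the wires in the range of `j` and on all others. -/
theorem ext_emb (j : V ↪ W) {w w' : Bits W} (h1 : w ∘ j = w' ∘ j)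
    (h2 : ∀ k, (∀ b, j b ≠ k) → w k = w' k) : w = w' := by
  funext k
  by_cases h : ∃ b, j b = k
  · obtain ⟨b, rfl⟩ := h
    exact congrFun h1 b
  · exact h2 k (by simpa using h)

@[simp] theorem extend_extend (j : V ↪ W) (v v' : Bits V) (w : Bits W) :
    Function.extend j v' (Function.extend j v w) = Function.extend j v' w := by
  refine ext_emb j (by simp [extend_comp_emb]) fun k hk => ?_
  simp [extend_of_ne _ _ hk]

@[simp] theorem extend_self (j : V ↪ W) (w : Bits W) : Function.extend j (w ∘ j) w = w := by
  refine ext_emb j (by simp [extend_comp_emb]) fun k hk => ?_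
  simp [extend_of_ne _ _ hk]

theorem extend_eq_of (j : V ↪ W) {v : Bits V} {w w' : Bits W} (h1 : w' ∘ j = v)
    (h2 : ∀ k, (∀ b, j b ≠ k) → w' k = w k) : Function.extend j v w = w' := by
  refine ext_emb j (by simp [extend_comp_emb, h1]) fun k hk => ?_
  simp [extend_of_ne _ _ hk, h2 k hk]

theorem xorInto_trans (o : B ↪ V) (j : V ↪ W) (v : Bits B) (w : Bits W) :
    xorInto (o.trans j) v w = Function.extend j (xorInto o v (w ∘ j)) w := by
  symm
  refine extend_eq_of j ?_ fun k hk => ?_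
  · funext x
    by_cases h : ∃ b, o b = x
    · obtain ⟨b, rfl⟩ := h
      rw [Function.comp_apply, show j (o b) = (o.trans j) b from rfl, xorInto_emb, xorInto_emb]
      rfl
    · have h' : ∀ b, o b ≠ x := by simpa using h
      rw [xorInto_of_ne _ _ h', Function.comp_apply, xorInto_of_ne _ _ (fun b => ?_)]
      · rfl
      · simpa using h' b
  · exact xorInto_of_ne _ _ fun b => hk _

/-- The wire that a reversible gate may change. -/
def RevGate.target : RevGate W → W
  | .x i => i
  | .cx _ j _ => j
  | .ccx _ _ k _ _ => k

/-- A reversible gate, transported along an embedding of wires. -/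
def RevGate.map (j : V ↪ W) : RevGate V → RevGate W
  | .x i => .x (j i)
  | .cx i k h => .cx (j i) (j k) (by simpa using h)
  | .ccx i k l h h' => .ccx (j i) (j k) (j l) (by simpa using h) (by simpa using h')

@[simp] theorem RevGate.target_map (j : V ↪ W) (g : RevGate V) :
    (g.map j).target = j g.target := by
  cases g <;> rfl

@[simp] theorem RevGate.apply_apply [DecidableEq W] (g : RevGate W) (w : Bits W) :
    g.apply (g.apply w) = w := by
  cases g with
  | x i => simp [RevGate.apply]
  | cx i j h => simp [RevGate.apply, Function.update_of_ne h]
  | ccx i j k h h' =>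
    simp [RevGate.apply, Function.update_of_ne h, Function.update_of_ne h']

theorem RevGate.apply_of_ne [DecidableEq W] (g : RevGate W) (w : Bits W) {k : W}
    (h : g.target ≠ k) : g.apply w k = w k := by
  cases g <;> simp [RevGate.apply] <;>
    exact Function.update_of_ne (Ne.symm h) _ _

theorem RevGate.apply_map [DecidableEq V] [DecidableEq W] (j : V ↪ W) (g : RevGate V)
    (w : Bits W) : (g.map j).apply w = Function.extend j (g.apply (w ∘ j)) w := by
  symm
  refine extend_eq_of j ?_ fun k hk => RevGate.apply_of_ne _ _ (by simpa using hk _)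
  cases g <;> funext x <;>
    simp [RevGate.apply, RevGate.map, Function.update_apply, j.injective.eq_iff]

namespace Instr

/-- A step, transported along an embedding `j` of wires and a map of gates. -/
def map (gm : Γ → Γ') (j : V ↪ W) : Instr Γ V A B C D → Instr Γ' W A B C D
  | .gate g => .gate (gm g)
  | .query i o h => .query (j ∘ i) (o.trans j) (by simpa using h)
  | .call i o h => .call (j ∘ i) (o.trans j) (by simpa using h)

/-- A classical step, transported along an embedding of wires. -/
def embed (j : V ↪ W) : Instr (RevGate V) V A B C D → Instr (RevGate W) W A B C D :=
  Instr.map (RevGate.map j) j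

/-- A classical step as a step of a quantum circuit. -/
def toQ : Instr (RevGate W) W A B C D → Instr (QGate W) W A B C D
  | .gate g => .gate (.rev g)
  | .query i o h => .query i o h
  | .call i o h => .call i o h

/-- The permutation of the basis states by a classical step that is not a call; a call is skipped.
-/
def perm [DecidableEq W] (f : Bits A → Bits B) : Instr (RevGate W) W A B C D → Bits W → Bits W
  | .gate g, w => g.apply w
  | .query i o _, w => xorInto o (f (w ∘ i)) w
  | .call _ _ _, w => w

@[simp] theorem perm_perm [DecidableEq W] (f : Bits A → Bits B)
    (s : Instr (RevGate W) W A B C D) (w : Bits W) : s.perm f (s.perm f w) = w := by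
  cases s with
  | gate g => simp [perm]
  | query i o h => simp [perm, xorInto_comp_of_ne _ _ h]
  | call i o h => rfl

theorem perm_embed [DecidableEq V] [DecidableEq W] (f : Bits A → Bits B) (j : V ↪ W)
    (s : Instr (RevGate V) V A B C D) (w : Bits W) :
    (s.embed j).perm f w = Function.extend j (s.perm f (w ∘ j)) w := by
  cases s with
  | gate g => exact RevGate.apply_map j g w
  | query i o h => exact xorInto_trans o j _ w
  | call i o h => simp [embed, Instr.map, perm]

@[simp] theorem isCall_embed (j : V ↪ W) (s : Instr (RevGate V) V A B C D) :
    (s.embed j).isCall = s.isCall := by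
  cases s <;> rfl

@[simp] theorem isCall_toQ (s : Instr (RevGate W) W A B C D) : s.toQ.isCall = s.isCall := by
  cases s <;> rfl

end Instr

/-- Successive application of classical steps that are not calls. -/
def perms [DecidableEq W] (f : Bits A → Bits B) (p : List (Instr (RevGate W) W A B C D))
    (w : Bits W) : Bits W :=
  p.foldl (fun w s => s.perm f w) w

section perms
variable [DecidableEq V] [DecidableEq W] (f : Bits A → Bits B)

@[simp] theorem perms_nil (w : Bits W) :
    perms f ([] : List (Instr (RevGate W) W A B C D)) w = w := rfl

@[simp] theorem perms_cons (s : Instr (RevGate W) W A B C D) (p) (w : Bits W) :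
    perms f (s :: p) w = perms f p (s.perm f w) := rfl

theorem perms_append (p p' : List (Instr (RevGate W) W A B C D)) (w : Bits W) :
    perms f (p ++ p') w = perms f p' (perms f p w) := by
  simp [perms]

@[simp] theorem perms_reverse_perms (p : List (Instr (RevGate W) W A B C D)) (w : Bits W) :
    perms f p.reverse (perms f p w) = w := by
  induction p generalizing w with
  | nil => rfl
  | cons s p ih => simp [perms_append, ih]

@[simp] theorem perms_perms_reverse (p : List (Instr (RevGate W) W A B C D)) (w : Bits W) :
    perms f p (perms f p.reverse w) = w := by
  simpa using perms_reverse_perms f p.reverse w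

theorem perms_embed (j : V ↪ W) (p : List (Instr (RevGate V) V A B C D)) (w : Bits W) :
    perms f (p.map (Instr.embed j)) w = Function.extend j (perms f p (w ∘ j)) w := by
  induction p generalizing w with
  | nil => simp
  | cons s p ih => simp [ih, Instr.perm_embed, extend_comp_emb]

end perms

/-- The CNOT gates that XOR the wires `u` into the wires `o`. -/
def copy [Fintype V] (u : V → W) (o : V ↪ W) (h : ∀ a b, u a ≠ o b) :
    List (Instr (RevGate W) W A B C D) :=
  Finset.univ.toList.map fun v => .gate (.cx (u v) (o v) (h v v))

theorem perms_copy [Fintype V] [DecidableEq W] (f : Bits A → Bits B) (u : V → W) (o : V ↪ W)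
    (h : ∀ a b, u a ≠ o b) (w : Bits W) :
    perms f (copy u o h : List (Instr (RevGate W) W A B C D)) w = xorInto o (w ∘ u) w := by
  classical
  have key : ∀ (l : List V), l.Nodup → ∀ w : Bits W,
      perms f (l.map fun v => (.gate (.cx (u v) (o v) (h v v)) : Instr (RevGate W) W A B C D)) w
        = xorInto o (fun v => decide (v ∈ l) && w (u v)) w := by
    intro l
    induction l with
    | nil =>
      intro _ w
      funext k
      simp only [List.map_nil, perms_nil]
      by_cases hk : ∃ b, o b = k
      · obtain ⟨b, rfl⟩ := hk
        simp [xorInto_emb]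
      · rw [xorInto_of_ne _ _ (by simpa using hk)]
    | cons v l ih =>
      intro hl w
      have hv : v ∉ l := (List.nodup_cons.mp hl).1
      simp only [List.map_cons, perms_cons, ih (List.nodup_cons.mp hl).2, Instr.perm,
        RevGate.apply]
      funext k
      by_cases hk : ∃ b, o b = k
      · obtain ⟨b, rfl⟩ := hk
        have hne : ∀ x, u x ≠ o v := fun x => h x v
        simp only [xorInto_emb, Function.update_of_ne (hne _)]
        by_cases hb : b = v
        · subst hb; simp [hv]
        · simp [hb]
      · have hk' : ∀ b, o b ≠ k := by simpa using hk
        rw [xorInto_of_ne _ _ hk', xorInto_of_ne _ _ hk', Function.update_of_ne (hk' v).symm]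
  rw [copy, key _ (Finset.nodup_toList _)]
  simp only [Finset.mem_toList, Finset.mem_univ, decide_true, Bool.true_and]
  rfl

@[simp] theorem length_copy [Fintype V] (u : V → W) (o : V ↪ W) (h : ∀ a b, u a ≠ o b) :
    (copy u o h : List (Instr (RevGate W) W A B C D)).length = Fintype.card V := by
  simp [copy]

theorem isCall_of_mem_copy [Fintype V] {u : V → W} {o : V ↪ W} {h : ∀ a b, u a ≠ o b}
    {s : Instr (RevGate W) W A B C D} (hs : s ∈ copy u o h) : s.isCall = false := by
  obtain ⟨v, -, rfl⟩ := List.mem_map.mp hs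
  rfl

theorem countP_copy [Fintype V] (u : V → W) (o : V ↪ W) (h : ∀ a b, u a ≠ o b) :
    (copy u o h : List (Instr (RevGate W) W A B C D)).countP Instr.isCall = 0 :=
  List.countP_eq_zero.mpr fun s hs => by simp [isCall_of_mem_copy hs]

/-! ### Answers of a party, and classical runs in continuation-passing style -/

/-- Expected value of `κ` after a party in state `st` has been sent `v`: `κ` is applied to the
answer and to the new state, and an abort contributes `0`. -/
def respond [Fintype R] (step : St → Bits C → R → Option (Bits D × St)) (st : St) (v : Bits C)
    (κ : Bits D → St → ℝ) : ℝ :=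
  𝔼 r : R, match step st v r with
    | none => 0
    | some (y, st') => κ y st'

section respond
variable [Fintype R] (step : St → Bits C → R → Option (Bits D × St)) (st : St) (v : Bits C)

@[simp] theorem respond_zero : respond step st v (fun _ _ => 0) = 0 := by
  unfold respond
  refine (Finset.expect_congr rfl fun r _ => ?_).trans (Finset.expect_const_zero _)
  split <;> rfl

theorem respond_sum {ι : Type} (s : Finset ι) (κ : ι → Bits D → St → ℝ) :
    respond step st v (fun y st' => ∑ i ∈ s, κ i y st') = ∑ i ∈ s, respond step st v (κ i) := by
  unfold respond
  rw [← Finset.expect_sum_comm]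
  refine Finset.expect_congr rfl fun r _ => ?_
  rcases step st v r with - | ⟨y, st'⟩ <;> simp

theorem respond_mul (c : ℝ) (κ : Bits D → St → ℝ) :
    respond step st v (fun y st' => c * κ y st') = c * respond step st v κ := by
  unfold respond
  rw [Finset.mul_expect]
  refine Finset.expect_congr rfl fun r _ => ?_
  rcases step st v r with - | ⟨y, st'⟩ <;> simp

/-- A party without coins that never aborts. -/
theorem respond_some [Unique R] (g : Bits D × St) (κ : Bits D → St → ℝ)
    (h : ∀ r, step st v r = some g) : respond step st v κ = κ g.1 g.2 := by
  simp [respond, h]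

end respond

/-- Expected value of `κ` (a function of the final wires and of the final state of the party) when
a classical circuit is run with a probabilistic party, where an abort contributes `0`. -/
def cexp [DecidableEq W] [Fintype R] (f : Bits A → Bits B)
    (step : St → Bits C → R → Option (Bits D × St)) :
    List (Instr (RevGate W) W A B C D) → St → Bits W → (Bits W → St → ℝ) → ℝ
  | [], st, w, κ => κ w st
  | .gate g :: p, st, w, κ => cexp f step p st (g.apply w) κ
  | .query i o _ :: p, st, w, κ => cexp f step p st (xorInto o (f (w ∘ i)) w) κ
  | .call i o _ :: p, st, w, κ =>
      respond step st (w ∘ i) fun y st' => cexp f step p st' (xorInto o y w) κ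

section cexp
variable [DecidableEq V] [DecidableEq W] [Fintype R] (f : Bits A → Bits B)
  (step : St → Bits C → R → Option (Bits D × St))

theorem cexp_append (p p' : List (Instr (RevGate W) W A B C D)) (st : St) (w : Bits W)
    (κ : Bits W → St → ℝ) :
    cexp f step (p ++ p') st w κ = cexp f step p st w fun w' st' => cexp f step p' st' w' κ := by
  induction p generalizing st w with
  | nil => rfl
  | cons s p ih => cases s <;> simp [cexp, ih]

theorem cexp_of_noCall (p : List (Instr (RevGate W) W A B C D)) (hp : ∀ s ∈ p, s.isCall = false)
    (st : St) (w : Bits W) (κ : Bits W → St → ℝ) :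
    cexp f step p st w κ = κ (perms f p w) st := by
  induction p generalizing st w with
  | nil => rfl
  | cons s p ih =>
    have ih' := ih fun s' hs' => hp s' (List.mem_cons_of_mem _ hs')
    cases s with
    | gate g => simp [cexp, ih', Instr.perm]
    | query i o h => simp [cexp, ih', Instr.perm]
    | call i o h => simpa [Instr.isCall] using hp _ List.mem_cons_self

theorem cexp_embed (j : V ↪ W) (p : List (Instr (RevGate V) V A B C D)) (st : St) (w : Bits W)
    (κ : Bits W → St → ℝ) :
    cexp f step (p.map (Instr.embed j)) st w κ =
      cexp f step p st (w ∘ j) fun v st' => κ (Function.extend j v w) st' := by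
  induction p generalizing st w with
  | nil => simp [cexp]
  | cons s p ih =>
    cases s with
    | gate g =>
      simp only [List.map_cons, Instr.embed, Instr.map, cexp] at ih ⊢
      rw [ih, RevGate.apply_map, extend_comp_emb]
      simp
    | query i o h =>
      simp only [List.map_cons, Instr.embed, Instr.map, cexp] at ih ⊢
      rw [ih, xorInto_trans, extend_comp_emb]
      simp [Function.comp_assoc]
    | call i o h =>
      simp only [List.map_cons, Instr.embed, Instr.map, cexp] at ih ⊢
      simp only [ih, xorInto_trans, extend_comp_emb, extend_extend]
      rfl

end cexp

/-- Expected value of `κ`, applied to the output and to the final state of the party. -/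
def Circuit.cval {I O : Type} [Fintype R] (c : CAlg I O A B C D) (f : Bits A → Bits B)
    (step : St → Bits C → R → Option (Bits D × St)) (st : St) (x : Bits I)
    (κ : Bits O → St → ℝ) : ℝ :=
  cexp f step c.prog st (c.start x) fun w st' => κ (w ∘ c.out) st'

/-- With a deterministic party that sees the transcript, `cval` is `run`. -/
theorem Circuit.cval_eq_run {I O : Type} [Unique R] [Fintype R] (c : CAlg I O A B C D)
    (f : Bits A → Bits B) (ans : Transcript C D → Bits C → Bits D) (h : Transcript C D)
    (x : Bits I) (κ : Bits O → Transcript C D → ℝ) :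
    c.cval f (fun h v (_ : R) => some (ans h v, h ++ [(v, ans h v)])) h x κ =
      κ (c.run f ans h x).1 (c.run f ans h x).2 := by
  have key : ∀ (p : List (Instr (RevGate c.W) c.W A B C D)) (h : Transcript C D) (w : Bits c.W)
      (κ : Bits c.W → Transcript C D → ℝ),
      cexp f (fun h v (_ : R) => some (ans h v, h ++ [(v, ans h v)])) p h w κ =
        κ (p.foldl (Instr.exec f ans) (w, h)).1 (p.foldl (Instr.exec f ans) (w, h)).2 := by
    intro p
    induction p with
    | nil => intros; rfl
    | cons s p ih =>
      intro h w κ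
      cases s with
      | gate g => simp [cexp, ih, Instr.exec]
      | query i o h => simp [cexp, ih, Instr.exec]
      | call i o _ =>
        rw [cexp, respond_some _ _ _ (ans h (w ∘ i), h ++ [(w ∘ i, ans h (w ∘ i))]) _ fun _ => rfl,
          ih]
        rfl
  rw [Circuit.cval, key]
  rfl

theorem Circuit.eval_eq {I O : Type} (c : CAlg I O A B Empty Empty) (f : Bits A → Bits B)
    (x : Bits I) : c.eval f x = perms f c.prog (c.start x) ∘ c.out := by
  have key : ∀ (p : List (Instr (RevGate c.W) c.W A B Empty Empty)) (h) (w : Bits c.W),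
      (p.foldl (Instr.exec f fun _ _ => Empty.elim) (w, h)).1 = perms f p w := by
    intro p
    induction p with
    | nil => intros; rfl
    | cons s p ih =>
      intro h w
      cases s <;> simp [Instr.exec, ih, Instr.perm]
  rw [Circuit.eval, Circuit.run]
  simp [key]

end

/-! ### Quantum runs -/

section

variable {Γ Γ' V W U E X A B C D R St : Type}

/-- The squared norm of an unnormalized state. -/
def nsq [Fintype W] [DecidableEq W] (ψ : Bits W → ℂ) : ℝ := ∑ w, ‖ψ w‖ ^ 2

theorem sum_comp_involutive {ι M : Type*} [Fintype ι] [AddCommMonoid M] {g : ι → ι}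
    (hg : ∀ i, g (g i) = i) (F : ι → M) : ∑ i, F (g i) = ∑ i, F i :=
  Equiv.sum_comp (Function.Involutive.toPerm g hg) F

theorem nsq_nonneg [Fintype W] [DecidableEq W] (ψ : Bits W → ℂ) : 0 ≤ nsq ψ :=
  Finset.sum_nonneg fun _ _ => by positivity

/-- Gates are unitary. -/
theorem nsq_act [Fintype W] [DecidableEq W] (g : QGate W) (ψ : Bits W → ℂ) :
    nsq (g.act ψ) = nsq ψ := by
  cases g with
  | rev g => exact sum_comp_involutive (fun w => g.apply_apply w) fun w => ‖ψ w‖ ^ 2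
  | phase i =>
    refine Finset.sum_congr rfl fun w _ => ?_
    by_cases h : w i <;> simp [QGate.act, h]
  | t i =>
    refine Finset.sum_congr rfl fun w _ => ?_
    have : ‖Complex.exp (Complex.I * (Real.pi : ℂ) / 4)‖ = 1 := by
      rw [show Complex.I * (Real.pi : ℂ) / 4 = ((Real.pi / 4 : ℝ) : ℂ) * Complex.I by
        push_cast; ring]
      exact Complex.norm_exp_ofReal_mul_I _
    by_cases h : w i <;> simp [QGate.act, h, this]
  | had i =>
    -- The terms of `w` and of `w` with bit `i` flipped are added up by the parallelogram law.
    have hflip : ∀ w : Bits W, (RevGate.x i).apply ((RevGate.x i).apply w) = w :=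
      fun w => RevGate.apply_apply _ w
    have h1 := sum_comp_involutive hflip fun w => ‖(QGate.had i).act ψ w‖ ^ 2
    have h2 := sum_comp_involutive hflip fun w => ‖ψ w‖ ^ 2
    have h3 : ∀ w : Bits W, ‖(QGate.had i).act ψ ((RevGate.x i).apply w)‖ ^ 2
        + ‖(QGate.had i).act ψ w‖ ^ 2 = ‖ψ ((RevGate.x i).apply w)‖ ^ 2 + ‖ψ w‖ ^ 2 := by
      intro w
      have par : ∀ a b : ℂ, ‖(a + b) / (Real.sqrt 2 : ℂ)‖ ^ 2 + ‖(a - b) / (Real.sqrt 2 : ℂ)‖ ^ 2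
          = ‖a‖ ^ 2 + ‖b‖ ^ 2 := by
        intro a b
        have := parallelogram_law_with_norm ℝ a b
        rw [norm_div, norm_div, div_pow, div_pow, Complex.norm_real, Real.norm_eq_abs, sq_abs,
          Real.sq_sqrt (by norm_num)]
        linarith
      have hw : Function.update w i (w i) = w := Function.update_eq_self i w
      cases hwi : w i with
      | false =>
        rw [hwi] at hw
        have := par (ψ w) (ψ (Function.update w i true))
        simp only [QGate.act, RevGate.apply, hwi, Function.update_self, Function.update_idem,
          Bool.not_false, if_true, hw, neg_one_mul, ← sub_eq_add_neg]
        simp only [Bool.false_eq_true, if_false, one_mul]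
        linarith
      | true =>
        rw [hwi] at hw
        have := par (ψ (Function.update w i false)) (ψ w)
        simp only [QGate.act, RevGate.apply, hwi, Function.update_self, Function.update_idem,
          Bool.not_true, if_true, hw, neg_one_mul, ← sub_eq_add_neg]
        simp only [Bool.false_eq_true, if_false, one_mul]
        linarith
    have h4 := Finset.sum_congr rfl fun w (_ : w ∈ Finset.univ) => h3 w
    simp only [Finset.sum_add_distrib] at h4
    unfold nsq
    linarith

theorem nsq_query [Fintype W] [DecidableEq W] (f : Bits A → Bits B) (i : A → W) (o : B ↪ W)
    (h : ∀ a b, i a ≠ o b) (ψ : Bits W → ℂ) :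
    nsq (fun w => ψ (xorInto o (f (w ∘ i)) w)) = nsq ψ :=
  sum_comp_involutive (g := fun w => xorInto o (f (w ∘ i)) w)
    (fun w => by simp [xorInto_comp_of_ne _ _ h]) fun w => ‖ψ w‖ ^ 2

/-- The state after the outcome `v` of a measurement of the wires `u`. -/
def restrict [Fintype X] (u : X → W) (v : Bits X) (ψ : Bits W → ℂ) : Bits W → ℂ :=
  fun w => if w ∘ u = v then ψ w else 0

theorem nsq_call [Fintype W] [DecidableEq W] [Fintype C] [DecidableEq C] (i : C → W)
    (o : D ↪ W) (h : ∀ a b, i a ≠ o b) (v : Bits C) (y : Bits D) (ψ : Bits W → ℂ) :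
    nsq (fun w => if w ∘ i = v then ψ (xorInto o y w) else 0) = nsq (restrict i v ψ) := by
  have := sum_comp_involutive (xorInto_xorInto o y) fun w => ‖restrict i v ψ w‖ ^ 2
  simpa only [nsq, restrict, xorInto_comp_of_ne y _ h] using this

theorem sum_norm_restrict [Fintype W] [DecidableEq W] [Fintype X] [DecidableEq X] (u : X → W)
    (ψ : Bits W → ℂ) (w : Bits W) : ∑ v, ‖restrict u v ψ w‖ ^ 2 = ‖ψ w‖ ^ 2 := by
  rw [Finset.sum_eq_single (w ∘ u)] <;> simp +contextual [restrict, eq_comm]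

theorem sum_nsq_restrict [Fintype W] [DecidableEq W] [Fintype X] [DecidableEq X] (u : X → W)
    (ψ : Bits W → ℂ) : ∑ v, nsq (restrict u v ψ) = nsq ψ := by
  unfold nsq
  rw [Finset.sum_comm]
  exact Finset.sum_congr rfl fun w _ => sum_norm_restrict u ψ w

section qexpect
variable [Fintype W] [DecidableEq W] [Fintype C] [DecidableEq C] [Fintype R]
  (f : Bits A → Bits B) (step : St → Bits C → R → Option (Bits D × St)) (val : St → Bits W → ℝ)

theorem qexpect_call (i : C → W) (o : D ↪ W) (h) (p : List (Instr (QGate W) W A B C D)) (st : St)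
    (ψ : Bits W → ℂ) : qexpect f step val (.call i o h :: p) st ψ =
      ∑ v : Bits C, respond step st v fun y st' =>
        qexpect f step val p st' fun w => if w ∘ i = v then ψ (xorInto o y w) else 0 := rfl

theorem qexpect_zero (p : List (Instr (QGate W) W A B C D)) (st : St) :
    qexpect f step val p st (fun _ => 0) = 0 := by
  induction p generalizing st with
  | nil => simp [qexpect]
  | cons s p ih =>
    cases s with
    | gate g =>
      rw [qexpect, show g.act (fun _ => 0) = fun _ => 0 by cases g <;> simp [QGate.act], ih]
    | query i o h => rw [qexpect, ih]
    | call i o h => simp [qexpect_call, ih]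

theorem qexpect_perms (p : List (Instr (RevGate W) W A B C D)) (hp : ∀ s ∈ p, s.isCall = false)
    (rest : List (Instr (QGate W) W A B C D)) (st : St) (ψ : Bits W → ℂ) :
    qexpect f step val (p.map Instr.toQ ++ rest) st ψ =
      qexpect f step val rest st fun w => ψ (perms f p.reverse w) := by
  induction p generalizing ψ with
  | nil => rfl
  | cons s p ih =>
    have ih' := ih fun s' hs' => hp s' (List.mem_cons_of_mem _ hs')
    cases s with
    | gate g =>
      simp only [List.reverse_cons, perms_append, perms_cons, perms_nil, Instr.perm]
      rw [← ih' fun w => ψ (g.apply w)]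
      rfl
    | query i o h =>
      simp only [List.reverse_cons, perms_append, perms_cons, perms_nil, Instr.perm]
      rw [← ih' fun w => ψ (xorInto o (f (w ∘ i)) w)]
      rfl
    | call i o h => simpa [Instr.isCall] using hp _ List.mem_cons_self

/-- A classical circuit acts on the basis states separately: coherence does not matter. -/
theorem qexpect_classical (p : List (Instr (RevGate W) W A B C D)) (st : St) (ψ : Bits W → ℂ) :
    qexpect f step val (p.map Instr.toQ) st ψ =
      ∑ w, ‖ψ w‖ ^ 2 * cexp f step p st w fun w' st' => val st' w' := by
  induction p generalizing ψ st with
  | nil => rfl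
  | cons s p ih =>
    cases s with
    | gate g =>
      simp only [List.map_cons, Instr.toQ, qexpect, cexp] at ih ⊢
      rw [ih, ← sum_comp_involutive (g := g.apply) (by simp)]
      simp [QGate.act]
    | query i o h =>
      simp only [List.map_cons, Instr.toQ, qexpect, cexp] at ih ⊢
      rw [ih, ← sum_comp_involutive (g := fun w => xorInto o (f (w ∘ i)) w)
        (fun w => by simp [xorInto_comp_of_ne _ _ h])]
      refine Finset.sum_congr rfl fun w _ => ?_
      have : xorInto o (f (w ∘ i)) w ∘ i = w ∘ i := xorInto_comp_of_ne _ _ h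
      simp only [this, xorInto_xorInto]
    | call i o h =>
      simp only [List.map_cons, Instr.toQ, qexpect_call, cexp] at ih ⊢
      simp only [ih]
      calc
        _ = ∑ v : Bits C, ∑ w : Bits W, respond step st v fun y st' =>
              (if w ∘ i = v then ‖ψ w‖ ^ 2 else 0) *
                cexp f step p st' (xorInto o y w) fun w' st' => val st' w' := by
          refine Finset.sum_congr rfl fun v _ => ?_
          rw [← respond_sum]
          congr 1
          funext y st'
          rw [← sum_comp_involutive (xorInto_xorInto o y)]
          refine Finset.sum_congr rfl fun w _ => ?_
          simp only [xorInto_comp_of_ne y w h, xorInto_xorInto]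
          split_ifs <;> simp
        _ = _ := by
          rw [Finset.sum_comm]
          refine Finset.sum_congr rfl fun w _ => ?_
          simp only [respond_mul]
          rw [Finset.sum_eq_single (w ∘ i)] <;> simp +contextual [eq_comm]

end qexpect

/-! ### Deferred measurement -/

/-- The step does not change the wires in `K` (it may use them as controls). -/
def Instr.Fixes (K : Set W) : Instr (QGate W) W A B C D → Prop
  | .gate (.rev g) => g.target ∉ K
  | .gate (.had i) => i ∉ K
  | .gate (.phase _) => True
  | .gate (.t _) => True
  | .query _ o _ => ∀ b, o b ∉ K
  | .call _ o _ => ∀ b, o b ∉ K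

/-- If the wires `u` are not changed any more, they may as well be measured now. -/
theorem qexpect_split [Fintype W] [DecidableEq W] [Fintype C] [DecidableEq C] [Fintype R]
    [Fintype X] [DecidableEq X] (f : Bits A → Bits B)
    (step : St → Bits C → R → Option (Bits D × St)) (val : St → Bits W → ℝ) (u : X → W)
    (p : List (Instr (QGate W) W A B C D)) (hp : ∀ s ∈ p, s.Fixes (Set.range u)) (st : St)
    (ψ : Bits W → ℂ) :
    qexpect f step val p st ψ = ∑ v, qexpect f step val p st (restrict u v ψ) := by
  induction p generalizing st ψ with
  | nil =>
    simp only [qexpect]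
    rw [Finset.sum_comm]
    refine Finset.sum_congr rfl fun w _ => ?_
    rw [← Finset.sum_mul, sum_norm_restrict]
  | cons s p ih =>
    have ih' := ih fun s' hs' => hp s' (List.mem_cons_of_mem _ hs')
    have hs := hp s List.mem_cons_self
    cases s with
    | gate g =>
      simp only [qexpect]
      rw [ih']
      refine Finset.sum_congr rfl fun v _ => ?_
      congr 1
      funext w
      cases g with
      | rev g =>
        have : g.apply w ∘ u = w ∘ u := funext fun x => RevGate.apply_of_ne g w fun hx =>
          hs ⟨x, hx.symm⟩
        simp [restrict, QGate.act, this]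
      | had i =>
        have : ∀ b, Function.update w i b ∘ u = w ∘ u := fun b => funext fun x =>
          Function.update_of_ne (fun hx => hs ⟨x, hx⟩) _ _
        simp only [restrict, QGate.act, this]
        split_ifs <;> simp
      | phase i => simp [restrict, QGate.act]
      | t i => simp [restrict, QGate.act]
    | query i o h =>
      simp only [qexpect]
      rw [ih']
      refine Finset.sum_congr rfl fun v _ => ?_
      congr 1
      funext w
      have : ∀ y, xorInto o y w ∘ u = w ∘ u := fun y =>
        xorInto_comp_of_ne _ _ fun a b hab => hs b ⟨a, hab⟩
      simp [restrict, this]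
    | call i o h =>
      simp only [qexpect_call]
      rw [Finset.sum_comm]
      refine Finset.sum_congr rfl fun v _ => ?_
      rw [← respond_sum]
      congr 1
      funext y st'
      rw [ih']
      refine Finset.sum_congr rfl fun v' _ => ?_
      congr 1
      funext w
      have : ∀ y, xorInto o y w ∘ u = w ∘ u := fun y =>
        xorInto_comp_of_ne _ _ fun a b hab => hs b ⟨a, hab⟩
      simp only [restrict, this]
      split_ifs <;> rfl

/-! ### Product states -/

/-- The state `ψ` on the wires `U`, and the basis state of `e` on the wires `E`. -/
def tens (ψ : Bits U → ℂ) (e : Bits E) : Bits (U ⊕ E) → ℂ := by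
  classical exact fun w => if w ∘ Sum.inr = e then ψ (w ∘ Sum.inl) else 0

theorem tens_of_eq {ψ : Bits U → ℂ} {e : Bits E} {w : Bits (U ⊕ E)} (h : w ∘ Sum.inr = e) :
    tens ψ e w = ψ (w ∘ Sum.inl) := if_pos h

theorem tens_of_ne {ψ : Bits U → ℂ} {e : Bits E} {w : Bits (U ⊕ E)} (h : w ∘ Sum.inr ≠ e) :
    tens ψ e w = 0 := if_neg h

/-- A permutation of the basis states that acts as an involution `τ` on the wires `U` if the others
contain `e`. -/
theorem tens_perm {F G : Bits (U ⊕ E) → Bits (U ⊕ E)} (hFG : ∀ w, F (G w) = w)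
    (hGF : ∀ w, G (F w) = w) {e : Bits E} {τ : Bits U → Bits U} (hτ : ∀ a, τ (τ a) = a)
    (hF : ∀ a, F (Sum.elim a e) = Sum.elim (τ a) e) (ψ : Bits U → ℂ) :
    (fun w => tens ψ e (G w)) = tens (fun a => ψ (τ a)) e := by
  funext w
  unfold tens
  by_cases h : w ∘ Sum.inr = e
  · have hw : w = Sum.elim (w ∘ Sum.inl) e := by rw [← h, Sum.elim_comp_inl_inr]
    have : G w = Sum.elim (τ (w ∘ Sum.inl)) e := by
      rw [← hGF (Sum.elim (τ (w ∘ Sum.inl)) e), hF, hτ, ← hw]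
    simp [this, h]
  · have : ¬ G w ∘ Sum.inr = e := by
      intro h'
      apply h
      rw [← hFG w, ← Sum.elim_comp_inl_inr (G w), h', hF]
      simp
    simp [this, h]

theorem tens_extend_inr (ψ : Bits U → ℂ) {τ : Bits E → Bits E} (hτ : ∀ e, τ (τ e) = e)
    (e : Bits E) :
    (fun w => tens ψ e (Function.extend (Function.Embedding.inr : E ↪ U ⊕ E)
      (τ (w ∘ Sum.inr)) w)) = tens ψ (τ e) := by
  funext w
  unfold tens
  have h1 : Function.extend (Function.Embedding.inr : E ↪ U ⊕ E) (τ (w ∘ Sum.inr)) w ∘ Sum.inr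
      = τ (w ∘ Sum.inr) := extend_comp_emb _ _ _
  have h2 : Function.extend (Function.Embedding.inr : E ↪ U ⊕ E) (τ (w ∘ Sum.inr)) w ∘ Sum.inl
      = w ∘ Sum.inl := extend_comp_of_ne _ _ (by simp)
  have h3 : τ (w ∘ Sum.inr) = e ↔ w ∘ Sum.inr = τ e :=
    ⟨fun h => by rw [← h, hτ], fun h => by rw [h, hτ]⟩
  by_cases h : w ∘ Sum.inr = τ e
  · rw [if_pos h, if_pos (h1.trans (h3.mpr h)), h2]
  · rw [if_neg h, if_neg (by rwa [h1, h3])]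

/-- A classical circuit on the wires `E` of a product state. -/
theorem qexpect_embed_inr [Fintype U] [DecidableEq U] [Fintype E] [DecidableEq E] [Fintype C]
    [DecidableEq C] [Fintype R] (f : Bits A → Bits B)
    (step : St → Bits C → R → Option (Bits D × St)) (val : St → Bits (U ⊕ E) → ℝ)
    (p : List (Instr (RevGate E) E A B C D)) (rest) (st : St) (ψ : Bits U → ℂ) (e : Bits E) :
    qexpect f step val ((p.map (Instr.embed Function.Embedding.inr)).map Instr.toQ ++ rest) st
        (tens ψ e) =
      cexp f step p st e fun e' st' => qexpect f step val rest st' (tens ψ e') := by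
  induction p generalizing st e with
  | nil => rfl
  | cons s p ih =>
    cases s with
    | gate g =>
      rw [cexp, ← ih, ← tens_extend_inr (U := U) ψ (τ := g.apply) (by simp)]
      simp only [List.map_cons, List.cons_append, Instr.embed, Instr.map, Instr.toQ, qexpect]
      congr 1
      funext w
      simp only [QGate.act, RevGate.apply_map]
      rfl
    | query i o h =>
      rw [cexp, ← ih]
      have := tens_extend_inr (U := U) ψ (τ := fun e => xorInto o (f (e ∘ i)) e)
        (fun w => by simp [xorInto_comp_of_ne _ _ h]) e
      rw [← this]
      simp only [List.map_cons, List.cons_append, Instr.embed, Instr.map, Instr.toQ, qexpect]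
      congr 1
      funext w
      simp only [xorInto_trans]
      rfl
    | call i o h =>
      simp only [List.map_cons, List.cons_append, Instr.embed, Instr.map, Instr.toQ,
        qexpect_call, cexp]
      have hst : ∀ v y, (fun w : Bits (U ⊕ E) => if w ∘
          (Function.Embedding.inr : E ↪ U ⊕ E) ∘ i = v then tens ψ e
          (xorInto (o.trans Function.Embedding.inr) y w) else 0) =
          if v = e ∘ i then tens ψ (xorInto o y e) else fun _ => 0 := by
        intro v y
        funext w
        rw [xorInto_trans]
        have := congrFun (tens_extend_inr (U := U) ψ (xorInto_xorInto o y) e) w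
        have h1 : w ∘ (Function.Embedding.inr : E ↪ U ⊕ E) ∘ i
          = (w ∘ Sum.inr) ∘ i := rfl
        rw [h1]
        rw [show w ∘ (Function.Embedding.inr : E ↪ U ⊕ E) = w ∘ Sum.inr from rfl, this]
        by_cases hw : w ∘ Sum.inr = xorInto o y e
        · have : (w ∘ Sum.inr) ∘ i = e ∘ i := by rw [hw, xorInto_comp_of_ne _ _ h]
          rw [this]
          by_cases hv : v = e ∘ i
          · simp [hv]
          · simp [hv, Ne.symm hv]
        · have : tens ψ (xorInto o y e) w = 0 := by simp [tens, hw]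
          split_ifs <;> simp [this]
      simp only [hst]
      rw [Finset.sum_eq_single (e ∘ i)]
      · simp only [if_true, ← ih]; rfl
      · intro v _ hv
        simp [hv, qexpect_zero]
      · simp

end

/-! ### Assembling a quantum circuit from parts -/

section

variable {Γ V W U E X A B C D R St : Type}

/-- The state `ψ ⊗ e` after a permutation that copies the wires `i` of `ψ` to zero wires `r` of `e`,
restricted to an outcome of the measurement of the copy. -/
theorem restrict_tens_copy [Fintype X] {F G : Bits (U ⊕ E) → Bits (U ⊕ E)}
    (hFG : ∀ w, F (G w) = w) (hGF : ∀ w, G (F w) = w) {e : Bits E} {i : X → U} {r : X → E}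
    {e' : Bits X → Bits E} (he' : ∀ v, e' v ∘ r = v)
    (hF : ∀ a, F (Sum.elim a e) = Sum.elim a (e' (a ∘ i))) (v : Bits X) (ψ : Bits U → ℂ) :
    restrict (fun x => Sum.inr (r x)) v (fun w => tens ψ e (G w)) =
      tens (restrict i v ψ) (e' v) := by
  funext w
  by_cases h : G w ∘ Sum.inr = e
  · obtain ⟨a, ha⟩ : ∃ a, G w = Sum.elim a e :=
      ⟨G w ∘ Sum.inl, by rw [← h, Sum.elim_comp_inl_inr]⟩
    have hw : w = Sum.elim a (e' (a ∘ i)) := by rw [← hFG w, ha, hF]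
    have h1 : w ∘ (fun x => Sum.inr (r x)) = a ∘ i := by
      rw [hw]; exact he' _
    have h2 : w ∘ Sum.inl = a := by rw [hw]; simp
    have h3 : w ∘ Sum.inr = e' (a ∘ i) := by rw [hw]; simp
    have h4 : tens ψ e (G w) = ψ a := by rw [tens_of_eq h, ha, Sum.elim_comp_inl]
    have h5 : restrict i v ψ a = if a ∘ i = v then ψ a else 0 := rfl
    rw [restrict, h4]
    by_cases hv : a ∘ i = v
    · rw [tens_of_eq (by rw [h3, hv]), h2, h5, if_pos hv, if_pos (h1.trans hv)]
    · rw [if_neg (by rwa [h1])]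
      by_cases hv' : w ∘ Sum.inr = e' v
      · rw [tens_of_eq hv', h2, h5, if_neg hv]
      · rw [tens_of_ne hv']
  · rw [restrict, tens_of_ne h, ite_self]
    by_cases h2 : w ∘ Sum.inr = e' v
    · rw [tens_of_eq h2, restrict, if_neg]
      intro h3
      apply h
      have : w = F (Sum.elim (w ∘ Sum.inl) e) := by
        rw [hF, h3, ← h2, Sum.elim_comp_inl_inr]
      rw [this, hGF]
      simp
    · rw [tens_of_ne h2]

theorem ne_trans_emb {I : Type} {u : X → W} {inp : I ↪ V} {r : V ↪ W} (h : ∀ a b, u a ≠ r b)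
    (a : X) (b : I) : u a ≠ (inp.trans r) b := h a _

theorem comp_ne_of_ne {out : B → V} {o : B ↪ W} {r : V ↪ W} (h : ∀ a b, o a ≠ r b)
    (a b : B) : (r ∘ out) a ≠ o b := (h b _).symm

theorem inr_ne_trans_inl (u : X → E) (o : B ↪ U) (a : X) (b : B) :
    (Sum.inr (u a) : U ⊕ E) ≠ (o.trans .inl) b := Sum.inr_ne_inl

/-- The reversible computation of a classical circuit `p` on zero ancillas `r`: copy the input,
compute, XOR the result into `o`, and uncompute. -/
def computeInto {I : Type} [Fintype I] [Fintype B] {A' B' : Type} (r : V ↪ W) (inp : I ↪ V)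
    (out : B → V) (p : List (Instr (RevGate V) V A' B' C D)) (u : I → W) (o : B ↪ W)
    (hur : ∀ a b, u a ≠ r b) (hor : ∀ a b, o a ≠ r b) : List (Instr (RevGate W) W A' B' C D) :=
  copy u (inp.trans r) (ne_trans_emb hur) ++ p.map (Instr.embed r) ++
    copy (r ∘ out) o (comp_ne_of_ne hor) ++
    (p.map (Instr.embed r)).reverse ++ copy u (inp.trans r) (ne_trans_emb hur)

theorem perms_computeInto {I : Type} [Fintype I] [Fintype B] [DecidableEq V] [DecidableEq W]
    {A' B' : Type} (f : Bits A' → Bits B') (r : V ↪ W) (inp : I ↪ V) (out : B → V)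
    (p : List (Instr (RevGate V) V A' B' C D)) (u : I → W) (o : B ↪ W)
    (hur : ∀ a b, u a ≠ r b) (hor : ∀ a b, o a ≠ r b) (huo : ∀ a b, u a ≠ o b) (w : Bits W)
    (hw : w ∘ r = fun _ => false) :
    perms f (computeInto r inp out p u o hur hor) w =
      xorInto o (perms f p (Function.extend inp (w ∘ u) fun _ => false) ∘ out) w := by
  have hin : xorInto inp (w ∘ u) (w ∘ r) = Function.extend inp (w ∘ u) fun _ => false := by
    rw [hw]; funext k; simp [xorInto]
  have h1 : perms f (p.map (Instr.embed r) : List (Instr (RevGate W) W A' B' C D))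
      (xorInto (inp.trans r) (w ∘ u) w) =
      Function.extend r (perms f p (Function.extend inp (w ∘ u) fun _ => false)) w := by
    rw [perms_embed, xorInto_trans, extend_comp_emb, extend_extend, hin]
  simp only [computeInto, perms_append, perms_copy]
  rw [h1]
  set w2 := Function.extend r (perms f p (Function.extend inp (w ∘ u) fun _ => false)) w with hw2
  have h2 : w2 ∘ r ∘ out = perms f p (Function.extend inp (w ∘ u) fun _ => false) ∘ out := by
    rw [hw2, ← Function.comp_assoc, extend_comp_emb]
  have hror : ∀ a b, r a ≠ o b := fun a b => (hor b a).symm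
  rw [h2, ← List.map_reverse, perms_embed, xorInto_comp_of_ne _ _ hror, hw2, extend_comp_emb,
    perms_reverse_perms]
  set y := perms f p (Function.extend inp (w ∘ u) fun _ => false) ∘ out
  have h3 : Function.extend r (Function.extend inp (w ∘ u) fun _ => false) (xorInto o y
      (Function.extend r (perms f p (Function.extend inp (w ∘ u) fun _ => false)) w)) ∘ u
      = w ∘ u := by
    rw [extend_comp_of_ne _ _ hur, xorInto_comp_of_ne _ _ huo, extend_comp_of_ne _ _ hur]
  rw [h3, xorInto_trans, extend_comp_emb, extend_extend, ← hin, xorInto_xorInto]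
  refine extend_eq_of r (xorInto_comp_of_ne _ _ hror) fun k hk => ?_
  by_cases hko : ∃ b, o b = k
  · obtain ⟨b, rfl⟩ := hko
    rw [xorInto_emb, xorInto_emb, extend_of_ne _ _ hk]
  · have hko' : ∀ b, o b ≠ k := by simpa using hko
    rw [xorInto_of_ne _ _ hko', xorInto_of_ne _ _ hko', extend_of_ne _ _ hk]

/-- Forget the calls to a party that does not exist. -/
def Instr.dropCalls : List (Instr Γ W A B Empty Empty) → List (Instr Γ W A B C D)
  | [] => []
  | .gate g :: p => .gate g :: dropCalls p
  | .query i o h :: p => .query i o h :: dropCalls p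
  | .call _ _ _ :: p => dropCalls p

theorem Instr.isCall_of_mem_dropCalls (p : List (Instr Γ W A B Empty Empty)) :
    ∀ s ∈ (Instr.dropCalls p : List (Instr Γ W A B C D)), s.isCall = false := by
  induction p with
  | nil => simp [Instr.dropCalls]
  | cons s p ih => cases s <;> simpa [Instr.dropCalls, Instr.isCall] using ih

theorem Instr.length_dropCalls_le (p : List (Instr Γ W A B Empty Empty)) :
    (Instr.dropCalls p : List (Instr Γ W A B C D)).length ≤ p.length := by
  induction p with
  | nil => simp [Instr.dropCalls]
  | cons s p ih => cases s <;> simp [Instr.dropCalls] <;> omega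

theorem perms_dropCalls [DecidableEq W] (f : Bits A → Bits B)
    (p : List (Instr (RevGate W) W A B Empty Empty)) (w : Bits W) :
    perms f (Instr.dropCalls p : List (Instr (RevGate W) W A B C D)) w = perms f p w := by
  induction p generalizing w with
  | nil => rfl
  | cons s p ih => cases s <;> simp [Instr.dropCalls, ih, Instr.perm]

/-- A quantum gate, transported along an embedding of wires. -/
def QGate.map (j : V ↪ W) : QGate V → QGate W
  | .rev g => .rev (g.map j)
  | .had i => .had (j i)
  | .phase i => .phase (j i)
  | .t i => .t (j i)

theorem tens_act_inl [DecidableEq U] [DecidableEq E] (g : QGate U) (ψ : Bits U → ℂ)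
    (e : Bits E) :
    (g.map (Function.Embedding.inl : U ↪ U ⊕ E)).act (tens ψ e) = tens (g.act ψ) e := by
  have upd : ∀ (w : Bits (U ⊕ E)) i b, Function.update w (Sum.inl i) b ∘ Sum.inl =
      Function.update (w ∘ Sum.inl) i b := fun w i b =>
    Function.update_comp_eq_of_injective _ Sum.inl_injective _ _
  have upd' : ∀ (w : Bits (U ⊕ E)) i b, Function.update w (Sum.inl i) b ∘ Sum.inr =
      w ∘ Sum.inr := fun w i b => Function.update_comp_eq_of_forall_ne _ _ (by simp)
  funext w
  cases g with
  | rev g =>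
    simp only [QGate.map, QGate.act, RevGate.apply_map]
    have h1 : Function.extend (Function.Embedding.inl : U ↪ U ⊕ E)
        (g.apply (w ∘ Function.Embedding.inl)) w ∘ Sum.inl = g.apply (w ∘ Sum.inl) :=
      extend_comp_emb _ _ _
    have h2 : Function.extend (Function.Embedding.inl : U ↪ U ⊕ E)
        (g.apply (w ∘ Function.Embedding.inl)) w ∘ Sum.inr = w ∘ Sum.inr :=
      extend_comp_of_ne _ _ (by simp)
    unfold tens
    rw [h1, h2]
  | had i =>
    simp only [QGate.map, QGate.act, tens, Function.Embedding.inl_apply, upd, upd']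
    by_cases h : w ∘ Sum.inr = e <;> simp [h]
  | phase i =>
    simp only [QGate.map, QGate.act, tens, Function.Embedding.inl_apply]
    by_cases h : w ∘ Sum.inr = e <;> simp [h]
  | t i =>
    simp only [QGate.map, QGate.act, tens, Function.Embedding.inl_apply]
    by_cases h : w ∘ Sum.inr = e <;> simp [h]

/-- The expected value as in `qexpect`, for a party given by a general expectation operator `K`,
which may depend on the number of remaining steps: `K k st v κ` is the expected value of `κ`,
applied to the answer and to the new state, if the party in state `st` is sent `v` and `k` steps
follow. -/
def qval [Fintype W] [DecidableEq W] [Fintype C] [DecidableEq C] (f : Bits A → Bits B)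
    (K : ℕ → St → Bits C → (Bits D → St → ℝ) → ℝ) (val : St → Bits W → ℝ) :
    List (Instr (QGate W) W A B C D) → St → (Bits W → ℂ) → ℝ
  | [], st, ψ => ∑ w, ‖ψ w‖ ^ 2 * val st w
  | .gate g :: p, st, ψ => qval f K val p st (g.act ψ)
  | .query i o _ :: p, st, ψ => qval f K val p st (fun w => ψ (xorInto o (f (w ∘ i)) w))
  | .call i o _ :: p, st, ψ => ∑ v : Bits C, K p.length st v fun y st' =>
      qval f K val p st' (fun w => if w ∘ i = v then ψ (xorInto o y w) else 0)

theorem qval_respond [Fintype W] [DecidableEq W] [Fintype C] [DecidableEq C] [Fintype R]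
    (f : Bits A → Bits B) (step : St → Bits C → R → Option (Bits D × St))
    (val : St → Bits W → ℝ) (p : List (Instr (QGate W) W A B C D)) (st : St) (ψ : Bits W → ℂ) :
    qval f (fun _ => respond step) val p st ψ = qexpect f step val p st ψ := by
  induction p generalizing st ψ with
  | nil => rfl
  | cons s p ih =>
    cases s <;> simp only [qval, qexpect, ih]
    rfl

/-- A quantum algorithm `Q` that is run as part of a quantum algorithm with another oracle and
another party. The classical circuit `start` computes the input of `Q` and a string `z : Bits Z`;
oracle queries of `Q` are answered by `rand`, and the calls of `Q` by `sgn k`, where `k` is the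
position of the call, counted from the end. In the end, `fin` computes the output from the recorded
calls of `Q` (a position `k` is marked as used by the bit `none`), the output of `Q` and `z`. -/
structure Assembly (I J O O' Z A B C D A' B' C' D' : Type) where
  Q : QAlg J O A B C D
  start : CAlg I (J ⊕ Z) A' B' C' D'
  rand : CAlg (A ⊕ Z) B A' B' Empty Empty
  sgn : Fin (Q.prog.length + 1) → CAlg (C ⊕ Z) D A' B' C' D'
  fin : CAlg ((Fin (Q.prog.length + 1) × Option C) ⊕ (O ⊕ Z)) O' A' B' C' D'

/-- The record of a call. -/
def callCode (v : Bits C) : Bits (Option C) := fun c => c.elim true v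

namespace Assembly

variable {I J O O' Z A B C D A' B' C' D' : Type} (T : Assembly I J O O' Z A B C D A' B' C' D')

/-- The positions of the steps of `Q`, counted from the end. -/
abbrev Pos := Fin (T.Q.prog.length + 1)

/-- The register for a call that is followed by `k` steps. -/
def pos (k : ℕ) : T.Pos := Fin.ofNat _ k

theorem pos_ne {j k : ℕ} (hjk : j < k) (hk : k ≤ T.Q.prog.length) : T.pos j ≠ T.pos k := by
  intro h
  have := congrArg Fin.val h
  simp only [pos, Fin.ofNat] at this
  rw [Nat.mod_eq_of_lt (by omega), Nat.mod_eq_of_lt (by omega)] at this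
  omega

/-- The wires in addition to those of `Q`: those of the classical circuits, and the records of the
calls. There is a copy of `sgn` for each position, since its work space is not cleaned up. -/
abbrev Anc := T.start.W ⊕ (T.rand.W ⊕ ((Σ k : T.Pos, (T.sgn k).W) ⊕ ((T.Pos × Option C) ⊕ T.fin.W)))

/-- The wires of the assembled circuit. -/
abbrev AllWires := T.Q.W ⊕ T.Anc

/-- The work space of `start`. -/
def startEmb : T.start.W ↪ T.Anc := ⟨fun x => .inl x, fun _ _ h => by simpa using h⟩
/-- The work space of `rand`, which is zero between the queries. -/
def randEmb : T.rand.W ↪ T.Anc := ⟨fun x => .inr (.inl x), fun _ _ h => by simpa using h⟩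
/-- The work space of `sgn` for the call at position `k`. -/
def sgnEmb (k : T.Pos) : (T.sgn k).W ↪ T.Anc :=
  ⟨fun x => .inr (.inr (.inl ⟨k, x⟩)), fun _ _ h => by simpa using h⟩
/-- The record of the call at position `k`. -/
def recEmb (k : T.Pos) : Option C ↪ T.Anc :=
  ⟨fun x => .inr (.inr (.inr (.inl (k, x)))), fun _ _ h => by simpa using h⟩
/-- The work space of `fin`. -/
def finEmb : T.fin.W ↪ T.Anc :=
  ⟨fun x => .inr (.inr (.inr (.inr x))), fun _ _ h => by simpa using h⟩
/-- The wires that carry `z`. -/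
def zWire (z : Z) : T.Anc := T.startEmb (T.start.out (.inr z))

@[simp] theorem startEmb_apply (x) : T.startEmb x = .inl x := rfl
@[simp] theorem randEmb_apply (x) : T.randEmb x = .inr (.inl x) := rfl
@[simp] theorem sgnEmb_apply (k x) : T.sgnEmb k x = .inr (.inr (.inl ⟨k, x⟩)) := rfl
@[simp] theorem recEmb_apply (k x) : T.recEmb k x = .inr (.inr (.inr (.inl (k, x)))) := rfl
@[simp] theorem finEmb_apply (x) : T.finEmb x = .inr (.inr (.inr (.inr x))) := rfl

theorem zWire_ne_randEmb (z b) : T.zWire z ≠ T.randEmb b := by simp [zWire]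
theorem zWire_ne_sgnEmb (z k b) : T.zWire z ≠ T.sgnEmb k b := by simp [zWire]
theorem zWire_ne_recEmb (z k b) : T.zWire z ≠ T.recEmb k b := by simp [zWire]
theorem zWire_ne_finEmb (z b) : T.zWire z ≠ T.finEmb b := by simp [zWire]
theorem recEmb_ne_sgnEmb (c k k' b) : T.recEmb k c ≠ T.sgnEmb k' b := by simp
theorem recEmb_ne_randEmb (c k b) : T.recEmb k c ≠ T.randEmb b := by simp
theorem recEmb_ne_finEmb (c k b) : T.recEmb k c ≠ T.finEmb b := by simp
theorem randEmb_ne_sgnEmb (c k b) : T.randEmb c ≠ T.sgnEmb k b := by simp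
theorem finEmb_ne_sgnEmb (c k b) : T.finEmb c ≠ T.sgnEmb k b := by simp

theorem sgnEmb_ne {k k' : T.Pos} (h : k ≠ k') (b c) : T.sgnEmb k b ≠ T.sgnEmb k' c := by
  simp [h]
theorem recEmb_ne {k k' : T.Pos} (h : k ≠ k') (b c) : T.recEmb k b ≠ T.recEmb k' c := by
  simp [h]

instance : DecidableEq T.Anc := Classical.decEq _

theorem query_ne (i : A → T.Q.W) (x : A ⊕ Z) (b : T.rand.W) :
    (Sum.elim (fun a => Sum.inl (i a)) (fun z => Sum.inr (T.zWire z)) x : T.AllWires) ≠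
      (T.randEmb.trans .inr) b := by
  rcases x with a | z
  · simp
  · simpa using T.zWire_ne_randEmb z b

theorem sgn_ne (k : T.Pos) (x : C ⊕ Z) (b : (T.sgn k).W) :
    Sum.elim (fun c => T.recEmb k (some c)) T.zWire x ≠ T.sgnEmb k b := by
  rcases x with c | z
  · simp
  · exact T.zWire_ne_sgnEmb z k b

theorem fin_ne (x : (T.Pos × Option C) ⊕ (O ⊕ Z)) (b : T.fin.W) :
    (Sum.elim (fun x => Sum.inr (T.recEmb x.1 x.2)) (Sum.elim (fun x => Sum.inl (T.Q.out x))
      fun z => Sum.inr (T.zWire z)) x : T.AllWires) ≠ (T.finEmb.trans .inr) b := by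
  rcases x with c | o | z
  · simp
  · simp
  · simpa using T.zWire_ne_finEmb z b

/-- The ancillas `e` before the last `n` steps of `Q`, where `h` is the record of the calls so far.
-/
structure Inv (z : Bits Z) (n : ℕ) (h : T.Pos → Bits (Option C)) (e : Bits T.Anc) : Prop where
  rand : e ∘ T.randEmb = fun _ => false
  sgn : ∀ k < n, e ∘ T.sgnEmb (T.pos k) = fun _ => false
  recs : ∀ k, e ∘ T.recEmb k = h k
  unused : ∀ k < n, h (T.pos k) = fun _ => false
  fin : e ∘ T.finEmb = fun _ => false
  z : e ∘ T.zWire = z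

theorem Inv.mono {T : Assembly I J O O' Z A B C D A' B' C' D'} {z : Bits Z} {m n : ℕ} {h e}
    (hI : T.Inv z n h e) (hmn : m ≤ n) : T.Inv z m h e :=
  ⟨hI.rand, fun k hk => hI.sgn k (hk.trans_le hmn), hI.recs,
    fun k hk => hI.unused k (hk.trans_le hmn), hI.fin, hI.z⟩

theorem Inv.call {T : Assembly I J O O' Z A B C D A' B' C' D'} {z : Bits Z} {n : ℕ} {h e}
    (hI : T.Inv z (n + 1) h e) (hn : n ≤ T.Q.prog.length) (v : Bits C)
    (w : Bits (T.sgn (T.pos n)).W) :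
    T.Inv z n (Function.update h (T.pos n) (callCode v))
      (Function.extend (T.sgnEmb (T.pos n)) w
        (Function.extend (T.recEmb (T.pos n)) (callCode v) e)) where
  rand := by
    rw [extend_comp_of_ne _ _ (fun a b => T.randEmb_ne_sgnEmb a _ b),
      extend_comp_of_ne _ _ (fun a b => (T.recEmb_ne_randEmb b _ a).symm), hI.rand]
  sgn k hk := by
    rw [extend_comp_of_ne _ _ (fun a b => T.sgnEmb_ne (T.pos_ne hk hn) a b),
      extend_comp_of_ne _ _ (fun a b => (T.recEmb_ne_sgnEmb b _ _ a).symm), hI.sgn k (by omega)]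
  recs k := by
    rw [extend_comp_of_ne _ _ (fun a b => T.recEmb_ne_sgnEmb a _ _ b)]
    by_cases hk : k = T.pos n
    · subst hk
      rw [extend_comp_emb, Function.update_self]
    · rw [extend_comp_of_ne _ _ (fun a b => T.recEmb_ne hk a b), Function.update_of_ne hk, hI.recs]
  unused k hk := by rw [Function.update_of_ne (T.pos_ne hk hn), hI.unused k (by omega)]
  fin := by
    rw [extend_comp_of_ne _ _ (fun a b => T.finEmb_ne_sgnEmb a _ b),
      extend_comp_of_ne _ _ (fun a b => (T.recEmb_ne_finEmb b _ a).symm), hI.fin]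
  z := by
    rw [extend_comp_of_ne _ _ (fun a b => T.zWire_ne_sgnEmb a _ b),
      extend_comp_of_ne _ _ (fun a b => T.zWire_ne_recEmb a _ b), hI.z]

variable [Fintype J] [Fintype O] [Fintype Z] [Fintype A] [Fintype B] [Fintype C] [DecidableEq C]
  [Fintype D]

/-- The answer to an oracle query of `Q`. -/
def queryPart (i : A → T.Q.W) (o : B ↪ T.Q.W) :
    List (Instr (RevGate T.AllWires) T.AllWires A' B' C' D') :=
  computeInto (T.randEmb.trans .inr) T.rand.inp T.rand.out (Instr.dropCalls T.rand.prog)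
    (Sum.elim (fun a => Sum.inl (i a)) (fun z => Sum.inr (T.zWire z))) (o.trans .inl)
    (T.query_ne i) (by simp)

/-- The query of a call is recorded. -/
def recordPart (k : T.Pos) (i : C → T.Q.W) :
    List (Instr (RevGate T.AllWires) T.AllWires A' B' C' D') :=
  .gate (.x (Sum.inr (T.recEmb k none))) ::
    copy (fun c => Sum.inl (i c)) ((Function.Embedding.some.trans (T.recEmb k)).trans .inr)
      (by simp)

/-- The answer to a call is computed. -/
def signPart (k : T.Pos) : List (Instr (RevGate T.Anc) T.Anc A' B' C' D') :=
  copy (Sum.elim (fun c => T.recEmb k (some c)) T.zWire) ((T.sgn k).inp.trans (T.sgnEmb k))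
      (ne_trans_emb (T.sgn_ne k)) ++
    (T.sgn k).prog.map (Instr.embed (T.sgnEmb k))

/-- The answer to a call is XORed into the wires of `Q`. -/
def answerPart (k : T.Pos) (o : D ↪ T.Q.W) :
    List (Instr (RevGate T.AllWires) T.AllWires A' B' C' D') :=
  copy (fun d => Sum.inr (T.sgnEmb k ((T.sgn k).out d))) (o.trans .inl) (inr_ne_trans_inl _ o)

/-- The steps that replace those of `Q`. -/
def body : List (Instr (QGate T.Q.W) T.Q.W A B C D) →
    List (Instr (QGate T.AllWires) T.AllWires A' B' C' D')
  | [] => []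
  | .gate g :: p => .gate (g.map .inl) :: body p
  | .query i o _ :: p => (T.queryPart i o).map Instr.toQ ++ body p
  | .call i o _ :: p => (T.recordPart (T.pos p.length) i).map Instr.toQ ++
      (((T.signPart (T.pos p.length)).map (Instr.embed .inr)).map Instr.toQ ++
      ((T.answerPart (T.pos p.length) o).map Instr.toQ ++ body p))

/-- The circuit `start` is run, and its output is copied to the input wires of `Q`. -/
def startPart : List (Instr (QGate T.AllWires) T.AllWires A' B' C' D') :=
  ((T.start.prog.map (Instr.embed T.startEmb)).map (Instr.embed .inr)).map Instr.toQ ++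
    (copy (fun j => Sum.inr (T.startEmb (T.start.out (.inl j)))) (T.Q.inp.trans .inl)
      (inr_ne_trans_inl _ _) :
        List (Instr (RevGate T.AllWires) T.AllWires A' B' C' D')).map Instr.toQ

/-- The circuit `fin` is run on a copy of the records, of the output of `Q` and of `z`. -/
def finPart : List (Instr (RevGate T.AllWires) T.AllWires A' B' C' D') :=
  copy (Sum.elim (fun x => Sum.inr (T.recEmb x.1 x.2)) (Sum.elim (fun x => Sum.inl (T.Q.out x))
      fun z => Sum.inr (T.zWire z))) (T.fin.inp.trans (T.finEmb.trans .inr))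
      (ne_trans_emb T.fin_ne) ++
    T.fin.prog.map (Instr.embed (T.finEmb.trans .inr))

/-- The assembled circuit. -/
def circuit : QAlg I O' A' B' C' D' where
  W := T.AllWires
  inp := T.start.inp.trans (T.startEmb.trans .inr)
  out x := Sum.inr (T.finEmb (T.fin.out x))
  prog := T.startPart ++ (T.body T.Q.prog ++ T.finPart.map Instr.toQ)

end Assembly

theorem Instr.fixes_toQ_copy [Fintype V] {u : V → W} {o : V ↪ W} {h} {K : Set W}
    (ho : ∀ v, o v ∉ K) :
    ∀ s ∈ (copy u o h : List (Instr (RevGate W) W A B C D)).map Instr.toQ, s.Fixes K := by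
  intro s hs
  simp only [copy, List.map_map, List.mem_map] at hs
  obtain ⟨v, -, rfl⟩ := hs
  exact ho v

theorem Instr.fixes_toQ_map_embed (j : V ↪ W) {K : Set W}
    {p : List (Instr (RevGate V) V A B C D)} (hp : ∀ s ∈ p.map Instr.toQ, s.Fixes (j ⁻¹' K)) :
    ∀ s ∈ (p.map (Instr.embed j)).map Instr.toQ, s.Fixes K := by
  intro s hs
  simp only [List.map_map, List.mem_map] at hs
  obtain ⟨s, hs, rfl⟩ := hs
  have h := hp _ (List.mem_map_of_mem hs)
  cases s with
  | gate g => simpa [Instr.embed, Instr.map, Instr.toQ, Instr.Fixes] using h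
  | query i o _ => exact h
  | call i o _ => exact h

theorem Instr.fixes_toQ_embed (j : V ↪ W) {K : Set W} (hj : ∀ v, j v ∉ K)
    (p : List (Instr (RevGate V) V A B C D)) :
    ∀ s ∈ (p.map (Instr.embed j)).map Instr.toQ, s.Fixes K := by
  refine Instr.fixes_toQ_map_embed j fun s hs => ?_
  obtain ⟨s, -, rfl⟩ := List.mem_map.mp hs
  cases s with
  | gate g => exact hj _
  | query i o _ => exact fun b => hj _
  | call i o _ => exact fun b => hj _

end

/-! ### What the assembled circuit computes -/

section

variable {Γ V W U E X A B C D R St : Type}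

theorem xorInto_inl (o : B ↪ U) (y : Bits B) (a : Bits U) (e : Bits E) :
    xorInto (o.trans (.inl : U ↪ U ⊕ E)) y (Sum.elim a e) = Sum.elim (xorInto o y a) e := by
  rw [xorInto_trans]
  refine extend_eq_of _ (by funext x; rfl) ?_
  rintro (x | x) hk
  · exact absurd rfl (hk x)
  · rfl

theorem extend_inr (j : V ↪ E) (v : Bits V) (a : Bits U) (e : Bits E) :
    Function.extend (j.trans (.inr : E ↪ U ⊕ E)) v (Sum.elim a e) =
      Sum.elim a (Function.extend j v e) := by
  refine extend_eq_of _ ?_ ?_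
  · exact extend_comp_emb j v e
  · rintro (x | x) hk
    · rfl
    · exact extend_of_ne v e fun b hb => hk b (by simp [hb])

/-- In the state `ψ ⊗ e`, only a measurement of the wires of `ψ` has a random outcome. -/
theorem sum_tens [Fintype U] [DecidableEq U] [Fintype E] [DecidableEq E] (ψ : Bits U → ℂ)
    (e : Bits E) (F : Bits (U ⊕ E) → ℝ) :
    ∑ w, ‖tens ψ e w‖ ^ 2 * F w = ∑ a, ‖ψ a‖ ^ 2 * F (Sum.elim a e) := by
  rw [← Equiv.sum_comp (Equiv.sumArrowEquivProdArrow U E Bool).symm, Fintype.sum_prod_type]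
  change ∑ a, ∑ e', ‖tens ψ e (Sum.elim a e')‖ ^ 2 * F (Sum.elim a e') = _
  refine Finset.sum_congr rfl fun a _ => ?_
  rw [Finset.sum_eq_single e]
  · rw [tens_of_eq (Sum.elim_comp_inr _ _), Sum.elim_comp_inl]
  · intro e' _ he'
    rw [tens_of_ne (by rwa [Sum.elim_comp_inr])]; simp
  · simp

namespace Assembly

variable {I J O O' Z A B C D A' B' C' D' : Type} (T : Assembly I J O O' Z A B C D A' B' C' D')
variable [Fintype J] [Fintype O] [Fintype Z] [Fintype A] [Fintype B] [Fintype C] [DecidableEq C]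
  [Fintype D]

section
variable (f : Bits A' → Bits B')

/-- If the ancillas are as in `Inv`, then the replaced query is a query of `rand`, without any
entanglement between `Q` and the ancillas. -/
theorem tens_queryPart {z : Bits Z} {n : ℕ} {h e} (hI : T.Inv z n h e) (i : A → T.Q.W)
    (o : B ↪ T.Q.W) (hio : ∀ a b, i a ≠ o b) (ψ : Bits T.Q.W → ℂ) :
    (fun w => tens ψ e (perms f (T.queryPart i o).reverse w)) =
      tens (fun a => ψ (xorInto o (T.rand.eval f (Sum.elim (a ∘ i) z)) a)) e := by
  refine tens_perm (F := perms f (T.queryPart i o)) (fun w => perms_perms_reverse _ _ _)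
    (fun w => perms_reverse_perms _ _ _) (τ := fun a => xorInto o _ a)
    (fun a => by simp [xorInto_comp_of_ne _ _ hio]) (fun a => ?_) ψ
  have h1 : Sum.elim a e ∘ Sum.elim (fun a => Sum.inl (i a)) (fun z => Sum.inr (T.zWire z)) =
      Sum.elim (a ∘ i) z := by
    funext x
    rcases x with x | x
    · rfl
    · exact congrFun hI.z x
  have h2 : ∀ (x : A ⊕ Z) b, (Sum.elim (fun a => Sum.inl (i a)) (fun z => Sum.inr (T.zWire z)) x :
      T.AllWires) ≠ (o.trans .inl) b := by
    rintro (x | x) b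
    · simpa using hio x b
    · simp
  have h3 : Sum.elim a e ∘ (T.randEmb.trans (.inr : T.Anc ↪ T.AllWires)) = fun _ => false :=
    hI.rand
  rw [queryPart, perms_computeInto f _ _ _ _ _ _ _ _ h2 _ h3, h1, xorInto_inl,
    perms_dropCalls, Circuit.eval_eq]
  rfl

theorem perms_recordPart {z : Bits Z} {n : ℕ} {h e} (hI : T.Inv z (n + 1) h e) (i : C → T.Q.W)
    (a : Bits T.Q.W) :
    perms f (T.recordPart (T.pos n) i) (Sum.elim a e) =
      Sum.elim a (Function.extend (T.recEmb (T.pos n)) (callCode (a ∘ i)) e) := by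
  have h0 : ∀ c, e (T.recEmb (T.pos n) c) = false := fun c => by
    have := congrFun (hI.recs (T.pos n)) c
    rw [hI.unused n (by omega)] at this
    exact this
  rw [recordPart, perms_cons, perms_copy]
  have h1 : Instr.perm f (.gate (.x (Sum.inr (T.recEmb (T.pos n) none))) :
      Instr (RevGate T.AllWires) T.AllWires A' B' C' D') (Sum.elim a e) =
      Sum.elim a (Function.update e (T.recEmb (T.pos n) none) true) := by
    simp only [Instr.perm, RevGate.apply]
    rw [Sum.elim_inr, h0]
    exact (Sum.elim_update_right a e _ _).symm
  rw [h1]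
  have h2 : Sum.elim a (Function.update e (T.recEmb (T.pos n) none) true) ∘
      (fun c => Sum.inl (i c)) = a ∘ i := rfl
  rw [h2]
  have h3 : Sum.elim a (Function.extend (T.recEmb (T.pos n)) (callCode (a ∘ i)) e) =
      Function.extend ((T.recEmb (T.pos n)).trans .inr) (callCode (a ∘ i)) (Sum.elim a e) :=
    (extend_inr _ _ _ _).symm
  rw [h3]
  symm
  refine extend_eq_of _ ?_ ?_
  · funext c
    cases c with
    | none =>
      rw [Function.comp_apply, xorInto_of_ne]
      · simp [callCode]
      · intro b hb
        simp at hb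
    | some c =>
      have := xorInto_emb (((Function.Embedding.some.trans (T.recEmb (T.pos n))).trans
        (.inr : T.Anc ↪ T.AllWires))) (a ∘ i)
        (Sum.elim a (Function.update e (T.recEmb (T.pos n) none) true)) c
      refine this.trans ?_
      have h4 : Function.update e (T.recEmb (T.pos n) none) true (T.recEmb (T.pos n) (some c)) =
          false := by
        rw [Function.update_of_ne (by simp), h0]
      change xor (Function.update e (T.recEmb (T.pos n) none) true
        (T.recEmb (T.pos n) (some c))) _ = _
      rw [h4]
      simp [callCode]
  · intro k hk
    rw [xorInto_of_ne _ _ fun b => hk (some b)]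
    rcases k with k | k
    · rfl
    · exact Function.update_of_ne (fun hk' => hk none (by rw [hk']; rfl)) _ _

end

/-- The record of a call is not changed by the steps after the call, so that it may be measured as
soon as it has been written. -/
theorem fixes_body (n : ℕ) (hn : n ≤ T.Q.prog.length)
    (p : List (Instr (QGate T.Q.W) T.Q.W A B C D)) (hp : p.length ≤ n) :
    ∀ s ∈ T.body p, s.Fixes
      (Set.range fun c : C => (Sum.inr (T.recEmb (T.pos n) (some c)) : T.AllWires)) := by
  induction p with
  | nil => simp [body]
  | cons s p ih =>
    have ih' := ih (by simp at hp; omega)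
    cases s with
    | gate g =>
      intro s hs
      rcases List.mem_cons.mp hs with rfl | hs
      · cases g <;> simp [QGate.map, Instr.Fixes]
      · exact ih' s hs
    | query i o h =>
      intro s hs
      rcases List.mem_append.mp hs with hs | hs
      · simp only [queryPart, computeInto, List.map_append, List.mem_append] at hs
        rcases hs with ((((hs | hs) | hs) | hs) | hs)
        · exact Instr.fixes_toQ_copy (by simp) s hs
        · exact Instr.fixes_toQ_embed _ (by simp) _ s hs
        · exact Instr.fixes_toQ_copy (by simp) s hs
        · rw [← List.map_reverse] at hs
          exact Instr.fixes_toQ_embed _ (by simp) _ s hs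
        · exact Instr.fixes_toQ_copy (by simp) s hs
      · exact ih' s hs
    | call i o h =>
      have hne : T.pos n ≠ T.pos p.length := (T.pos_ne (by simp at hp; omega) hn).symm
      intro s hs
      simp only [body, List.mem_append] at hs
      rcases hs with hs | hs | hs | hs
      · rw [recordPart, List.map_cons, List.mem_cons] at hs
        rcases hs with rfl | hs
        · simp [Instr.toQ, Instr.Fixes, RevGate.target]
        · refine Instr.fixes_toQ_copy ?_ s hs
          rintro v ⟨c, hc⟩
          simp at hc
          exact hne hc.1
      · refine Instr.fixes_toQ_map_embed _ (fun s hs => ?_) s hs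
        rw [signPart, List.map_append, List.mem_append] at hs
        rcases hs with hs | hs
        · exact Instr.fixes_toQ_copy (by simp) s hs
        · exact Instr.fixes_toQ_embed _ (by simp) _ s hs
      · exact Instr.fixes_toQ_copy (by simp) s hs
      · exact ih' s hs

variable {St R : Type} [Fintype C'] [DecidableEq C'] [Fintype R] (f : Bits A' → Bits B')
  (step : St → Bits C' → R → Option (Bits D' × St))

/-- How a call of `Q` is answered: the circuit `sgn` is run, and the call is recorded. -/
def party (z : Bits Z) (k : ℕ) (st : St × (T.Pos → Bits (Option C))) (v : Bits C)
    (κ : Bits D → St × (T.Pos → Bits (Option C)) → ℝ) : ℝ :=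
  (T.sgn (T.pos k)).cval f step st.1 (Sum.elim v z) fun y st' =>
    κ y (st', Function.update st.2 (T.pos k) (callCode v))

theorem cexp_signPart {z : Bits Z} {n : ℕ} {h e} (hI : T.Inv z (n + 1) h e)
    (v : Bits C) (st : St) (κ : Bits T.Anc → St → ℝ) :
    cexp f step (T.signPart (T.pos n)) st
        (Function.extend (T.recEmb (T.pos n)) (callCode v) e) κ =
      cexp f step (T.sgn (T.pos n)).prog st ((T.sgn (T.pos n)).start (Sum.elim v z))
        fun w st' => κ (Function.extend (T.sgnEmb (T.pos n)) w
          (Function.extend (T.recEmb (T.pos n)) (callCode v) e)) st' := by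
  set e1 := Function.extend (T.recEmb (T.pos n)) (callCode v) e with he1
  have h1 : e1 ∘ (Sum.elim (fun c => T.recEmb (T.pos n) (some c)) T.zWire) = Sum.elim v z := by
    funext x
    rcases x with x | x
    · exact congrFun (extend_comp_emb (T.recEmb (T.pos n)) (callCode v) e) (some x)
    · have := congrFun (extend_comp_of_ne (i := T.zWire) (j := T.recEmb (T.pos n)) (callCode v) e
        (fun a b => T.zWire_ne_recEmb a _ b)) x
      exact this.trans (congrFun hI.z x)
  have h2 : e1 ∘ T.sgnEmb (T.pos n) = fun _ => false := by
    rw [he1, extend_comp_of_ne _ _ (fun a b => (T.recEmb_ne_sgnEmb b _ _ a).symm),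
      hI.sgn n (by omega)]
  rw [signPart, cexp_append, cexp_of_noCall _ _ _ fun s => isCall_of_mem_copy, perms_copy,
    cexp_embed, h1, xorInto_trans, extend_comp_emb, h2]
  have h3 : xorInto (T.sgn (T.pos n)).inp (Sum.elim v z) (fun _ => false) =
      (T.sgn (T.pos n)).start (Sum.elim v z) := by
    funext k; simp [xorInto, Circuit.start]
  rw [h3]
  simp only [extend_extend]

/-- The steps `p` of `Q`, replaced by those of the assembled circuit and followed by the steps
`last`, act as the steps `p` with the oracle `rand` and the party `party`. -/
theorem qexpect_body {val : St → Bits T.AllWires → ℝ} (z : Bits Z)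
    {valQ : St × (T.Pos → Bits (Option C)) → Bits T.Q.W → ℝ}
    {last : List (Instr (QGate T.AllWires) T.AllWires A' B' C' D')}
    (hlast : ∀ n, ∀ s ∈ last, s.Fixes
      (Set.range fun c : C => (Sum.inr (T.recEmb (T.pos n) (some c)) : T.AllWires)))
    (hbase : ∀ st h e ψ, T.Inv z 0 h e →
      qexpect f step val last st (tens ψ e) = ∑ a, ‖ψ a‖ ^ 2 * valQ (st, h) a)
    (p : List (Instr (QGate T.Q.W) T.Q.W A B C D)) (hp : p.length ≤ T.Q.prog.length) (st : St)
    (h : T.Pos → Bits (Option C)) (e : Bits T.Anc) (ψ : Bits T.Q.W → ℂ)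
    (hI : T.Inv z p.length h e) :
    qexpect f step val (T.body p ++ last) st (tens ψ e) =
      qval (fun x => T.rand.eval f (Sum.elim x z)) (T.party f step z) valQ p (st, h) ψ := by
  induction p generalizing st h e ψ with
  | nil => exact hbase st h e ψ hI
  | cons s p ih =>
    rw [List.length_cons] at hp hI
    have ih' := ih (by omega)
    cases s with
    | gate g =>
      rw [body, List.cons_append, qexpect, tens_act_inl, ih' st h e _ (hI.mono (by omega))]
      rfl
    | query i o hio =>
      rw [body, List.append_assoc, qexpect_perms, tens_queryPart T f hI i o hio,
        ih' st h e _ (hI.mono (by omega))]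
      · rfl
      · intro s hs
        simp only [queryPart, computeInto, List.mem_append, List.mem_reverse, List.mem_map] at hs
        rcases hs with ((((hs | ⟨s, hs, rfl⟩) | hs) | ⟨s, hs, rfl⟩) | hs)
        · exact isCall_of_mem_copy hs
        · rw [Instr.isCall_embed, Instr.isCall_of_mem_dropCalls _ s hs]
        · exact isCall_of_mem_copy hs
        · rw [Instr.isCall_embed, Instr.isCall_of_mem_dropCalls _ s hs]
        · exact isCall_of_mem_copy hs
    | call i o hio =>
      set k := T.pos p.length with hk
      have hrec : ∀ s ∈ (T.recordPart k i :
          List (Instr (RevGate T.AllWires) T.AllWires A' B' C' D')),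
          s.isCall = false := by
        intro s hs
        rcases List.mem_cons.mp hs with rfl | hs
        · rfl
        · exact isCall_of_mem_copy hs
      rw [body, List.append_assoc, qexpect_perms _ _ _ _ hrec,
        qexpect_split _ _ _ (fun c : C => (Sum.inr (T.recEmb k (some c)) : T.AllWires))]
      · rw [qval]
        refine Finset.sum_congr rfl fun v _ => ?_
        rw [restrict_tens_copy (F := perms f (T.recordPart k i))
          (e' := fun v => Function.extend (T.recEmb k) (callCode v) e)
          (fun w => perms_perms_reverse _ _ _) (fun w => perms_reverse_perms _ _ _) (i := i)
          (fun v => ?_) (fun a => T.perms_recordPart f hI i a)]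
        · rw [List.append_assoc, qexpect_embed_inr, hk, cexp_signPart T f step hI v]
          unfold party Circuit.cval
          congr 1
          funext w st'
          set e2 := Function.extend (T.sgnEmb (T.pos p.length)) w
            (Function.extend (T.recEmb (T.pos p.length)) (callCode v) e) with he2
          set y := w ∘ (T.sgn (T.pos p.length)).out with hy
          have hans : ∀ s ∈ (T.answerPart (T.pos p.length) o :
              List (Instr (RevGate T.AllWires) T.AllWires A' B' C' D')), s.isCall = false :=
            fun s hs => isCall_of_mem_copy hs
          rw [List.append_assoc, qexpect_perms _ _ _ _ hans]
          have hF : ∀ a, perms f (T.answerPart (T.pos p.length) o) (Sum.elim a e2) =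
              Sum.elim (xorInto o y a) e2 := by
            intro a
            rw [answerPart, perms_copy, ← xorInto_inl]
            congr 1
            funext d
            simp only [Function.comp_apply, Sum.elim_inr, he2, hy]
            exact congrFun (extend_comp_emb (T.sgnEmb (T.pos p.length)) w _) _
          rw [tens_perm (F := perms f (T.answerPart (T.pos p.length) o))
            (fun w => perms_perms_reverse _ _ _) (fun w => perms_reverse_perms _ _ _)
            (τ := xorInto o y) (fun a => xorInto_xorInto _ _ _) hF,
            ih' st' _ e2 _ (hI.call (by omega) v w)]
          congr 1
          funext a
          simp only [restrict, xorInto_comp_of_ne y a hio]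
        · funext c
          exact congrFun (extend_comp_emb (T.recEmb k) (callCode v) e) (some c)
      · intro s hs
        simp only [List.mem_append] at hs
        rcases hs with (hs | hs | hs) | hs
        · refine Instr.fixes_toQ_map_embed _ (fun s hs => ?_) s hs
          rw [signPart, List.map_append, List.mem_append] at hs
          rcases hs with hs | hs
          · exact Instr.fixes_toQ_copy (by simp) s hs
          · exact Instr.fixes_toQ_embed _ (by simp) _ s hs
        · exact Instr.fixes_toQ_copy (by simp) s hs
        · exact T.fixes_body _ (by omega) p le_rfl s hs
        · exact hlast _ s hs

/-- What the assembled circuit computes: `start` is run, then `Q`, whose oracle is `rand` and whose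
calls are answered by `sgn`, and finally `fin`. -/
theorem prob_circuit (st : St) (acc : St → Bits O' → Bool) (x : Bits I) :
    T.circuit.prob f step st acc x =
      T.start.cval f step st x fun y st1 =>
        qval (fun q => T.rand.eval f (Sum.elim q (y ∘ Sum.inr))) (T.party f step (y ∘ Sum.inr))
          (fun st a => T.fin.cval f step st.1
            (Sum.elim (fun c => st.2 c.1 c.2) (Sum.elim (a ∘ T.Q.out) (y ∘ Sum.inr)))
            fun o st3 => ind (acc st3 o))
          T.Q.prog (st1, fun _ _ => false)
          (fun a => if a = T.Q.start (y ∘ Sum.inl) then 1 else 0) := by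
  have hs : Function.extend (T.start.inp.trans (T.startEmb.trans (.inr : T.Anc ↪ T.AllWires))) x
      (fun _ => false) = Sum.elim (fun _ => false)
        (Function.extend T.startEmb (T.start.start x) fun _ => false) := by
    rw [← extend_inr]
    symm
    refine extend_eq_of _ ?_ fun k hk => ?_
    · funext w
      by_cases hw : ∃ b, T.start.inp b = w
      · obtain ⟨b, rfl⟩ := hw
        simp only [Circuit.start, T.start.inp.injective.extend_apply]
        exact (T.start.inp.trans
          (T.startEmb.trans (.inr : T.Anc ↪ T.AllWires))).injective.extend_apply _ _ b
      · rw [Circuit.start, Function.extend_apply' _ _ _ hw]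
        refine Function.extend_apply' _ _ _ fun ⟨b, hb⟩ => hw ⟨b, ?_⟩
        exact (T.startEmb.trans .inr).injective hb
    · have : ¬ ∃ b, (T.start.inp.trans (T.startEmb.trans (.inr : T.Anc ↪ T.AllWires))) b = k :=
        fun ⟨b, hb⟩ => hk _ hb
      rw [Function.extend_apply' _ _ _ this]
      cases k <;> rfl
  have h0 : (fun w : Bits T.AllWires => if w = Function.extend
        (T.start.inp.trans (T.startEmb.trans .inr)) x (fun _ => false) then (1 : ℂ) else 0) =
      tens (fun a => if a = fun _ => false then 1 else 0)
        (Function.extend T.startEmb (T.start.start x) fun _ => false) := by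
    funext w
    rw [hs]
    by_cases h : w ∘ Sum.inr = Function.extend T.startEmb (T.start.start x) fun _ => false
    · rw [tens_of_eq h]
      refine if_congr ⟨fun hw => ?_, fun hw => ?_⟩ rfl rfl
      · rw [hw, Sum.elim_comp_inl]
      · rw [← h, ← hw, Sum.elim_comp_inl_inr]
    · rw [tens_of_ne h, if_neg]
      intro hw
      exact h (by rw [hw, Sum.elim_comp_inr])
  change qexpect f step
    (fun st' (w : Bits T.AllWires) => ind (acc st' (w ∘ fun x => Sum.inr (T.finEmb (T.fin.out x)))))
    (T.startPart ++ (T.body T.Q.prog ++ T.finPart.map Instr.toQ)) st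
    (fun w : Bits T.AllWires => if w = Function.extend
        (T.start.inp.trans (T.startEmb.trans .inr)) x (fun _ => false) then (1 : ℂ) else 0) = _
  rw [h0]
  rw [startPart, List.append_assoc, qexpect_embed_inr, cexp_embed, extend_comp_emb]
  unfold Circuit.cval
  congr 1
  funext w st1
  rw [extend_extend, qexpect_perms _ _ _ _ fun s hs => isCall_of_mem_copy hs]
  set e := Function.extend T.startEmb w fun _ => false with he
  have hF : ∀ a, perms f (copy (fun j => Sum.inr (T.startEmb (T.start.out (.inl j))))
      (T.Q.inp.trans .inl) (inr_ne_trans_inl _ _) :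
        List (Instr (RevGate T.AllWires) T.AllWires A' B' C' D')) (Sum.elim a e) =
      Sum.elim (xorInto T.Q.inp ((w ∘ T.start.out) ∘ Sum.inl) a) e := by
    intro a
    rw [perms_copy, ← xorInto_inl]
    congr 1
    funext j
    exact congrFun (extend_comp_emb T.startEmb w fun _ => false) _
  rw [tens_perm (F := perms f (copy _ _ _)) (fun w => perms_perms_reverse _ _ _)
    (fun w => perms_reverse_perms _ _ _)
    (τ := xorInto T.Q.inp ((w ∘ T.start.out) ∘ Sum.inl)) (fun a => xorInto_xorInto _ _ _) hF]
  have hz : e ∘ T.zWire = (w ∘ T.start.out) ∘ Sum.inr := by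
    funext x
    exact congrFun (extend_comp_emb T.startEmb w fun _ => false) _
  rw [T.qexpect_body f step ((w ∘ T.start.out) ∘ Sum.inr) _ _ T.Q.prog le_rfl st1
    (fun _ _ => false) e]
  · congr 1
    funext a
    refine if_congr ⟨fun h => ?_, fun h => ?_⟩ rfl rfl
    · rw [← xorInto_xorInto T.Q.inp ((w ∘ T.start.out) ∘ Sum.inl) a, h]
      funext k; simp [xorInto, Circuit.start]
    · rw [h]
      funext k; simp [xorInto, Circuit.start]
  · refine ⟨?_, fun k _ => ?_, fun k => ?_, fun k _ => rfl, ?_, hz⟩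
    · exact extend_comp_of_ne _ _ (by simp)
    · exact extend_comp_of_ne _ _ (by simp)
    · exact extend_comp_of_ne _ _ (by simp)
    · exact extend_comp_of_ne _ _ (by simp)
  · intro n s hs
    rw [finPart, List.map_append, List.mem_append] at hs
    rcases hs with hs | hs
    · exact Instr.fixes_toQ_copy (by simp) s hs
    · exact Instr.fixes_toQ_embed _ (by simp) _ s hs
  · intro st h e ψ hI
    rw [qexpect_classical, sum_tens]
    refine Finset.sum_congr rfl fun a _ => ?_
    congr 1
    have h1 : Sum.elim a e ∘
        Sum.elim (fun x : T.Pos × Option C => (Sum.inr (T.recEmb x.1 x.2) : T.AllWires))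
          (Sum.elim (fun x => Sum.inl (T.Q.out x)) fun z => Sum.inr (T.zWire z)) =
        Sum.elim (fun c : T.Pos × Option C => h c.1 c.2)
          (Sum.elim (a ∘ T.Q.out) ((w ∘ T.start.out) ∘ Sum.inr)) := by
      funext x
      rcases x with x | x | x
      · exact congrFun (hI.recs x.1) x.2
      · rfl
      · exact congrFun hI.z x
    have h2 : Sum.elim a e ∘ (T.finEmb.trans (.inr : T.Anc ↪ T.AllWires)) = fun _ => false :=
      hI.fin
    rw [finPart, cexp_append, cexp_of_noCall _ _ _ fun s => isCall_of_mem_copy, perms_copy, h1,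
      cexp_embed, xorInto_trans, extend_comp_emb, h2]
    have h3 : ∀ v, xorInto T.fin.inp v (fun _ => false) = T.fin.start v := by
      intro v
      funext k; simp [xorInto, Circuit.start]
    rw [h3]
    congr 1
    funext w' st'
    rw [extend_extend]
    have h4 : (Function.extend (T.finEmb.trans (.inr : T.Anc ↪ T.AllWires)) w' (Sum.elim a e) ∘
        fun x => Sum.inr (T.finEmb (T.fin.out x))) = w' ∘ T.fin.out := by
      funext x
      exact congrFun (extend_comp_emb (T.finEmb.trans (.inr : T.Anc ↪ T.AllWires)) w' _) _
    rw [h4]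

end Assembly

end

/-! ### The size of the assembled circuit -/

section

variable {Γ V W U E X A B C D R St : Type}

theorem countP_toQ (p : List (Instr (RevGate W) W A B C D)) :
    (p.map Instr.toQ).countP Instr.isCall = p.countP Instr.isCall := by
  rw [List.countP_map]
  exact List.countP_congr fun s _ => by simp

theorem countP_embed (j : V ↪ W) (p : List (Instr (RevGate V) V A B C D)) :
    (p.map (Instr.embed j)).countP Instr.isCall = p.countP Instr.isCall := by
  rw [List.countP_map]
  exact List.countP_congr fun s _ => by simp

theorem countP_dropCalls (p : List (Instr Γ W A B Empty Empty)) :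
    (Instr.dropCalls p : List (Instr Γ W A B C D)).countP Instr.isCall = 0 :=
  List.countP_eq_zero.mpr fun s hs => by simp [Instr.isCall_of_mem_dropCalls p s hs]

theorem Circuit.card_inp_le {Γ : Type → Type} {I O : Type} [Fintype I]
    (c : Circuit Γ I O A B C D) : Fintype.card I ≤ Fintype.card c.W :=
  Fintype.card_le_of_embedding c.inp

namespace Assembly

variable {I J O O' Z A B C D A' B' C' D' : Type} (T : Assembly I J O O' Z A B C D A' B' C' D')
variable [Fintype J] [Fintype O] [Fintype Z] [Fintype A] [Fintype B] [Fintype C] [DecidableEq C]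
  [Fintype D]

theorem countP_body {c : ℕ} (hc : ∀ k, (T.sgn k).calls ≤ c)
    (p : List (Instr (QGate T.Q.W) T.Q.W A B C D)) :
    (T.body p).countP Instr.isCall ≤ p.countP Instr.isCall * c := by
  induction p with
  | nil => simp [body]
  | cons s p ih =>
    cases s with
    | gate g => simpa [body, Instr.isCall] using ih
    | query i o h =>
      simp only [body, List.countP_append, countP_toQ, queryPart, computeInto, countP_copy,
        List.countP_reverse, countP_embed, countP_dropCalls, List.countP_cons, Instr.isCall]
      simpa using ih
    | call i o h =>
      have := hc (T.pos p.length)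
      simp only [body, List.countP_append, countP_toQ, countP_embed, recordPart, signPart,
        answerPart, countP_copy, List.countP_cons, Instr.isCall, Circuit.calls] at this ⊢
      simp only [add_mul]
      simp
      omega

theorem calls_circuit_le {c : ℕ} (hc : ∀ k, (T.sgn k).calls ≤ c) :
    T.circuit.calls ≤ T.start.calls + T.Q.calls * c + T.fin.calls := by
  have := T.countP_body hc T.Q.prog
  change (T.startPart ++ (T.body T.Q.prog ++ T.finPart.map Instr.toQ)).countP Instr.isCall ≤ _
  simp only [List.countP_append, countP_toQ, countP_embed, startPart, finPart, countP_copy,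
    Circuit.calls] at this ⊢
  omega

theorem length_body {s : ℕ} (hQ : T.Q.size ≤ s) (hr : T.rand.size ≤ s)
    (hg : ∀ k, (T.sgn k).size ≤ s) (p : List (Instr (QGate T.Q.W) T.Q.W A B C D)) :
    (T.body p).length ≤ p.length * (5 * s + 1) := by
  induction p with
  | nil => simp [body]
  | cons x p ih =>
    rw [List.length_cons, add_mul, one_mul]
    cases x with
    | gate g => simp only [body, List.length_cons]; omega
    | query i o h =>
      have h1 := T.rand.card_inp_le
      have h2 := Fintype.card_le_of_embedding o
      have h3 := Instr.length_dropCalls_le (C := C') (D := D') T.rand.prog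
      simp only [Circuit.size] at hQ hr
      simp only [body, List.length_append, List.length_map, queryPart, computeInto, length_copy,
        List.length_reverse]
      omega
    | call i o h =>
      have h1 := (T.sgn (T.pos p.length)).card_inp_le
      have h2 := Fintype.card_le_of_embedding o
      have h3 := hg (T.pos p.length)
      simp only [Circuit.size, Fintype.card_sum] at hQ h1 h3
      simp only [body, List.length_append, List.length_map, recordPart, signPart, answerPart,
        length_copy, List.length_cons, Fintype.card_sum]
      omega

theorem size_circuit_le {s : ℕ} (hQ : T.Q.size ≤ s) (hs : T.start.size ≤ s)
    (hr : T.rand.size ≤ s) (hg : ∀ k, (T.sgn k).size ≤ s) (hf : T.fin.size ≤ s) :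
    T.circuit.size ≤ 11 * (s + 1) ^ 2 := by
  have hbody := T.length_body hQ hr hg T.Q.prog
  have h1 := T.Q.card_inp_le
  have h2 := T.fin.card_inp_le
  have h3 : Fintype.card C ≤ s := by
    have h := (T.sgn 0).card_inp_le
    have h' := hg 0
    simp only [Circuit.size, Fintype.card_sum] at h h'
    omega
  have h4 : ∑ k : T.Pos, Fintype.card (T.sgn k).W ≤ (s + 1) * s := by
    refine (Finset.sum_le_card_nsmul _ _ s fun k _ => ?_).trans ?_
    · have := hg k
      simp only [Circuit.size] at this
      omega
    · rw [Finset.card_univ, Fintype.card_fin, smul_eq_mul]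
      refine Nat.mul_le_mul_right _ ?_
      simp only [Circuit.size] at hQ
      omega
  have h5 : T.circuit.W = T.AllWires := rfl
  have hlen : T.circuit.prog.length = (T.startPart ++ (T.body T.Q.prog ++
    T.finPart.map Instr.toQ)).length := rfl
  have hW : Fintype.card T.circuit.W = Fintype.card T.AllWires := by
    congr 1
  have h6 : T.Q.prog.length * (5 * s + 1) ≤ s * (5 * s + 1) := by
    refine Nat.mul_le_mul_right _ ?_
    simp only [Circuit.size] at hQ
    omega
  have h7 : (T.Q.prog.length + 1) * (Fintype.card C + 1) ≤ (s + 1) * (s + 1) := by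
    refine Nat.mul_le_mul ?_ (by omega)
    simp only [Circuit.size] at hQ
    omega
  simp only [Circuit.size] at hQ hs hr hf
  rw [Circuit.size, hlen, hW]
  simp only [startPart, finPart, List.length_append, List.length_map, length_copy,
    Fintype.card_sum, Fintype.card_sigma, Fintype.card_prod, Fintype.card_fin,
    Fintype.card_option] at h2 ⊢
  nlinarith

end Assembly

end

/-! ### Building classical circuits -/

section

variable {Γ V W U E X I J K M O O' Z A B C D R St : Type}

/-- A monomial of degree at most two in the bits of a string. -/
inductive Term (I : Type) : Type
  | one : Term I
  | lin (i : I) : Term I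
  | quad (i j : I) : Term I

namespace Term

/-- The value of a monomial. -/
def eval (x : Bits I) : Term I → Bool
  | one => true
  | lin i => x i
  | quad i j => x i && x j

/-- The gate that adds a monomial in the wires `I` to a wire in `O`. -/
def gate (o : O) : Term I → RevGate (I ⊕ O)
  | one => .x (.inr o)
  | lin i => .cx (.inl i) (.inr o) (by simp)
  | quad i j => .ccx (.inl i) (.inl j) (.inr o) (by simp) (by simp)

/-- The value of a polynomial over `𝔽₂`, given as a list of monomials. -/
def parity (x : Bits I) (ts : List (Term I)) : Bool :=
  ts.foldr (fun t b => xor (t.eval x) b) false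

@[simp] theorem parity_nil (x : Bits I) : parity x [] = false := rfl
@[simp] theorem parity_cons (x : Bits I) (t : Term I) (ts) :
    parity x (t :: ts) = xor (t.eval x) (parity x ts) := rfl

theorem apply_gate [DecidableEq I] [DecidableEq O] (o : O) (t : Term I) (x : Bits I)
    (y : Bits O) : (t.gate o).apply (Sum.elim x y) =
      Sum.elim x (Function.update y o (xor (y o) (t.eval x))) := by
  rw [← Sum.update_elim_inr]
  cases t
  · simp only [gate, RevGate.apply, eval, Sum.elim_inr, Bool.xor_true]
  · simp only [gate, RevGate.apply, eval, Sum.elim_inr, Sum.elim_inl]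
  · simp only [gate, RevGate.apply, eval, Sum.elim_inr, Sum.elim_inl]

end Term

/-- The circuit that computes a polynomial of degree at most two for each output bit. -/
def layer [Fintype I] [DecidableEq I] [Fintype O] [DecidableEq O] (t : O → List (Term I)) :
    CAlg I O A B C D where
  W := I ⊕ O
  inp := .inl
  out := .inr
  prog := Finset.univ.toList.flatMap fun o => (t o).map fun m => .gate (m.gate o)

section layer
variable [Fintype I] [DecidableEq I] [Fintype O] [DecidableEq O] (t : O → List (Term I))

theorem isCall_of_mem_layer {s} (hs : s ∈ (layer t : CAlg I O A B C D).prog) :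
    s.isCall = false := by
  obtain ⟨o, -, hs⟩ := List.mem_flatMap.mp hs
  obtain ⟨m, -, rfl⟩ := List.mem_map.mp hs
  rfl

theorem perms_layer (f : Bits A → Bits B) (x : Bits I) :
    perms f (layer t : CAlg I O A B C D).prog (Sum.elim x fun _ => false) =
      Sum.elim x fun o => Term.parity x (t o) := by
  have h1 : ∀ (o : O) (ts : List (Term I)) (y : Bits O),
      perms f (ts.map fun m => (.gate (m.gate o) : Instr (RevGate (I ⊕ O)) (I ⊕ O) A B C D))
        (Sum.elim x y) = Sum.elim x (Function.update y o (xor (y o) (Term.parity x ts))) := by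
    intro o ts
    induction ts with
    | nil =>
      intro y
      rw [List.map_nil, perms_nil, Term.parity_nil, Bool.xor_false, Function.update_eq_self]
    | cons m ts ih =>
      intro y
      rw [List.map_cons, perms_cons, Instr.perm, Term.apply_gate, ih, Function.update_self,
        Function.update_idem, Term.parity_cons, Bool.xor_assoc]
  have h2 : ∀ (l : List O), l.Nodup → ∀ y : Bits O,
      perms f (l.flatMap fun o => (t o).map fun m =>
        (.gate (m.gate o) : Instr (RevGate (I ⊕ O)) (I ⊕ O) A B C D)) (Sum.elim x y) =
      Sum.elim x fun o => if o ∈ l then xor (y o) (Term.parity x (t o)) else y o := by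
    intro l
    induction l with
    | nil => intro _ y; simp
    | cons a l ih =>
      intro hl y
      rw [List.flatMap_cons, perms_append, h1, ih (List.nodup_cons.mp hl).2]
      congr 1
      funext o
      by_cases ho : o = a
      · subst ho
        simp [(List.nodup_cons.mp hl).1]
      · simp [ho]
  refine (h2 _ (Finset.nodup_toList _) _).trans ?_
  simp

theorem start_layer (x : Bits I) :
    (layer t : CAlg I O A B C D).start x = Sum.elim x fun _ => false := by
  refine extend_eq_of (.inl : I ↪ I ⊕ O) (by funext i; rfl) ?_
  rintro (i | o) hk
  · exact absurd rfl (hk i)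
  · rfl

theorem cval_layer [Fintype R] (f : Bits A → Bits B)
    (step : St → Bits C → R → Option (Bits D × St)) (st : St) (x : Bits I)
    (κ : Bits O → St → ℝ) :
    (layer t : CAlg I O A B C D).cval f step st x κ = κ (fun o => Term.parity x (t o)) st := by
  rw [Circuit.cval, cexp_of_noCall _ _ _ fun s => isCall_of_mem_layer t, start_layer, perms_layer]
  rfl

theorem eval_layer (f : Bits A → Bits B) (x : Bits I) :
    (layer t : CAlg I O A B Empty Empty).eval f x = fun o => Term.parity x (t o) := by
  rw [Circuit.eval_eq, start_layer, perms_layer]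
  rfl

theorem size_layer : (layer t : CAlg I O A B C D).size =
    ∑ o, (t o).length + (Fintype.card I + Fintype.card O) := by
  have h1 : (layer t : CAlg I O A B C D).prog.length = ∑ o, (t o).length := by
    simp [layer, List.length_flatMap]
  have h2 : Fintype.card (layer t : CAlg I O A B C D).W = Fintype.card I + Fintype.card O :=
    Fintype.card_sum
  rw [Circuit.size, h1, h2]

theorem calls_layer : (layer t : CAlg I O A B C D).calls = 0 :=
  List.countP_eq_zero.mpr fun s hs => by simp [isCall_of_mem_layer t hs]

end layer

/-- The circuit whose output bits are input bits or constants. -/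
def wires [Fintype I] [DecidableEq I] [Fintype O] [DecidableEq O] (σ : O → I ⊕ Bool) :
    CAlg I O A B C D :=
  layer fun o => match σ o with
    | .inl i => [.lin i]
    | .inr true => [.one]
    | .inr false => []

section wires
variable [Fintype I] [DecidableEq I] [Fintype O] [DecidableEq O] (σ : O → I ⊕ Bool)

theorem parity_wires (x : Bits I) (o : O) : Term.parity x (match σ o with
    | .inl i => [.lin i]
    | .inr true => [.one]
    | .inr false => []) = Sum.elim x id (σ o) := by
  rcases σ o with i | (_ | _) <;> simp [Term.eval]

theorem cval_wires [Fintype R] (f : Bits A → Bits B)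
    (step : St → Bits C → R → Option (Bits D × St)) (st : St) (x : Bits I)
    (κ : Bits O → St → ℝ) :
    (wires σ : CAlg I O A B C D).cval f step st x κ = κ (fun o => Sum.elim x id (σ o)) st := by
  rw [wires, cval_layer]
  congr 1
  exact funext fun o => parity_wires σ x o

theorem eval_wires (f : Bits A → Bits B) (x : Bits I) :
    (wires σ : CAlg I O A B Empty Empty).eval f x = fun o => Sum.elim x id (σ o) := by
  rw [wires, eval_layer]
  exact funext fun o => parity_wires σ x o

theorem size_wires_le : (wires σ : CAlg I O A B C D).size ≤
    Fintype.card I + 2 * Fintype.card O := by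
  rw [wires, size_layer]
  have : ∑ o : O, (match σ o with
    | .inl i => [.lin i]
    | .inr true => [.one]
    | .inr false => [] : List (Term I)).length ≤ Fintype.card O • 1 := by
    refine Finset.sum_le_card_nsmul _ _ 1 fun o _ => ?_
    rcases σ o with i | (_ | _) <;> simp
  simp only [smul_eq_mul, mul_one] at this
  omega

theorem calls_wires : (wires σ : CAlg I O A B C D).calls = 0 := calls_layer _

end wires

theorem inl_ne_trans_inr (u : X → U) (o : B ↪ E) (a : X) (b : B) :
    (Sum.inl (u a) : U ⊕ E) ≠ (o.trans .inr) b := Sum.inl_ne_inr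

/-- The first circuit of a sequential composition, and the transfer of its output. -/
def Circuit.compLeft [Fintype M] (c₁ : CAlg I M A B Empty Empty) (c₂ : CAlg M O A B C D) :
    List (Instr (RevGate (c₁.W ⊕ c₂.W)) (c₁.W ⊕ c₂.W) A B C D) :=
  (Instr.dropCalls c₁.prog).map (Instr.embed .inl) ++
    copy (fun m => .inl (c₁.out m)) (c₂.inp.trans .inr) (inl_ne_trans_inr _ _)

/-- The steps of a sequential composition. -/
def Circuit.compProg [Fintype M] (c₁ : CAlg I M A B Empty Empty) (c₂ : CAlg M O A B C D) :
    List (Instr (RevGate (c₁.W ⊕ c₂.W)) (c₁.W ⊕ c₂.W) A B C D) :=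
  c₁.compLeft c₂ ++ c₂.prog.map (Instr.embed .inr)

/-- Sequential composition. -/
def Circuit.comp [Fintype M] (c₁ : CAlg I M A B Empty Empty) (c₂ : CAlg M O A B C D) :
    CAlg I O A B C D where
  W := c₁.W ⊕ c₂.W
  inp := c₁.inp.trans .inl
  out x := .inr (c₂.out x)
  prog := c₁.compProg c₂

theorem extend_inl_elim (v : Bits U) (a : Bits U) (e : Bits E) :
    Function.extend (.inl : U ↪ U ⊕ E) v (Sum.elim a e) = Sum.elim v e :=
  extend_eq_of _ rfl fun k hk => by
    rcases k with k | k
    · exact absurd rfl (hk k)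
    · rfl

theorem extend_inr_elim (v : Bits E) (a : Bits U) (e : Bits E) :
    Function.extend (.inr : E ↪ U ⊕ E) v (Sum.elim a e) = Sum.elim a v :=
  extend_eq_of _ rfl fun k hk => by
    rcases k with k | k
    · rfl
    · exact absurd rfl (hk k)

theorem xorInto_inr (o : B ↪ E) (y : Bits B) (a : Bits U) (e : Bits E) :
    xorInto (o.trans (.inr : E ↪ U ⊕ E)) y (Sum.elim a e) = Sum.elim a (xorInto o y e) := by
  rw [xorInto_trans]
  exact extend_inr_elim _ _ _

section comp
variable [Fintype M] (c₁ : CAlg I M A B Empty Empty) (c₂ : CAlg M O A B C D)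

theorem start_comp (x : Bits I) :
    Function.extend (c₁.inp.trans (.inl : c₁.W ↪ c₁.W ⊕ c₂.W)) x (fun _ => false) =
      Sum.elim (c₁.start x) (fun _ => false) := by
  refine extend_eq_of (c₁.inp.trans (.inl : c₁.W ↪ c₁.W ⊕ c₂.W)) ?_ ?_
  · exact extend_comp_emb c₁.inp x fun _ => false
  · rintro (k | k) hk
    · exact extend_of_ne (j := c₁.inp) x (fun _ => false) fun b hb => hk b (congrArg Sum.inl hb)
    · rfl

theorem perms_compLeft (f : Bits A → Bits B) (x : Bits I) :
    perms f (c₁.compLeft c₂) (Sum.elim (c₁.start x) (fun _ => false)) =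
      Sum.elim (perms f c₁.prog (c₁.start x)) (c₂.start (c₁.eval f x)) := by
  rw [Circuit.compLeft, perms_append, perms_copy, perms_embed]
  have h1 : Sum.elim (c₁.start x) (fun _ => false) ∘ (.inl : c₁.W ↪ c₁.W ⊕ c₂.W) = c₁.start x :=
    rfl
  rw [h1, perms_dropCalls, extend_inl_elim, xorInto_inr, Circuit.eval_eq]
  congr 1
  funext k
  simp only [xorInto, Circuit.start, Bool.false_xor]
  rfl

theorem isCall_of_mem_compLeft {s} (hs : s ∈ c₁.compLeft c₂) : s.isCall = false := by
  rcases List.mem_append.mp hs with hs | hs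
  · obtain ⟨s', hs', rfl⟩ := List.mem_map.mp hs
    rw [Instr.isCall_embed]
    exact Instr.isCall_of_mem_dropCalls _ s' hs'
  · exact isCall_of_mem_copy hs

theorem Circuit.cval_comp [Fintype R] (f : Bits A → Bits B)
    (step : St → Bits C → R → Option (Bits D × St)) (st : St) (x : Bits I)
    (κ : Bits O → St → ℝ) :
    (c₁.comp c₂).cval f step st x κ = c₂.cval f step st (c₁.eval f x) κ := by
  change cexp (W := c₁.W ⊕ c₂.W) f step (c₁.compProg c₂) st
    (Function.extend (c₁.inp.trans .inl) x fun _ => false)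
    (fun w st' => κ (w ∘ fun x => Sum.inr (c₂.out x)) st') = _
  rw [start_comp, Circuit.compProg, cexp_append,
    cexp_of_noCall _ _ _ fun s => isCall_of_mem_compLeft c₁ c₂, perms_compLeft, cexp_embed]
  simp only [extend_inr_elim]
  rfl

theorem Circuit.eval_comp (c₂ : CAlg M O A B Empty Empty) (f : Bits A → Bits B) (x : Bits I) :
    (c₁.comp c₂).eval f x = c₂.eval f (c₁.eval f x) := by
  rw [Circuit.eval_eq]
  change perms (W := c₁.W ⊕ c₂.W) f (c₁.compProg c₂)
    (Function.extend (c₁.inp.trans .inl) x fun _ => false) ∘ (fun x => Sum.inr (c₂.out x)) = _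
  rw [start_comp, Circuit.compProg, perms_append, perms_compLeft, perms_embed, extend_inr_elim,
    Circuit.eval_eq c₂]
  rfl

theorem Circuit.size_comp_le : (c₁.comp c₂).size ≤ c₁.size + 2 * c₂.size := by
  have h1 : (c₁.comp c₂).prog.length = (c₁.compProg c₂).length := rfl
  have h2 : Fintype.card (c₁.comp c₂).W = Fintype.card c₁.W + Fintype.card c₂.W :=
    Fintype.card_sum
  have h3 := c₂.card_inp_le
  have h4 := Instr.length_dropCalls_le (C := C) (D := D) c₁.prog
  rw [Circuit.size, h1, h2]
  simp only [compProg, compLeft, List.length_append, List.length_map, length_copy, Circuit.size]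
  omega

theorem Circuit.calls_comp : (c₁.comp c₂).calls = c₂.calls := by
  change (c₁.compProg c₂).countP Instr.isCall = _
  simp only [compProg, compLeft, List.countP_append, countP_embed, countP_dropCalls, countP_copy,
    Circuit.calls]
  omega

end comp

theorem inl_ne_trans_trans_inr (o : I ↪ V) (j : V ↪ E) (a : I) (b : I) :
    (Sum.inl a : I ⊕ E) ≠ ((o.trans j).trans .inr) b := Sum.inl_ne_inr

/-- The steps of the parallel run of two circuits, each on a copy of the input. -/
def Circuit.pairProg [Fintype I] (c₁ : CAlg I O A B Empty Empty)
    (c₂ : CAlg I O' A B Empty Empty) :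
    List (Instr (RevGate (I ⊕ (c₁.W ⊕ c₂.W))) (I ⊕ (c₁.W ⊕ c₂.W)) A B Empty Empty) :=
  copy .inl ((c₁.inp.trans .inl).trans .inr) (inl_ne_trans_trans_inr _ _) ++
    ((c₁.prog.map (Instr.embed .inl)).map (Instr.embed .inr) ++
    (copy .inl ((c₂.inp.trans .inr).trans .inr) (inl_ne_trans_trans_inr _ _) ++
      (c₂.prog.map (Instr.embed .inr)).map (Instr.embed .inr)))

/-- Two circuits run on the same input. -/
def Circuit.pair [Fintype I] [DecidableEq I] (c₁ : CAlg I O A B Empty Empty)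
    (c₂ : CAlg I O' A B Empty Empty) : CAlg I (O ⊕ O') A B Empty Empty where
  W := I ⊕ (c₁.W ⊕ c₂.W)
  inp := .inl
  out := Sum.elim (fun x => .inr (.inl (c₁.out x))) (fun x => .inr (.inr (c₂.out x)))
  prog := c₁.pairProg c₂

theorem Circuit.eval_pair [Fintype I] [DecidableEq I] (c₁ : CAlg I O A B Empty Empty)
    (c₂ : CAlg I O' A B Empty Empty) (f : Bits A → Bits B) (x : Bits I) :
    (c₁.pair c₂).eval f x = Sum.elim (c₁.eval f x) (c₂.eval f x) := by
  have hs : Function.extend (.inl : I ↪ I ⊕ (c₁.W ⊕ c₂.W)) x (fun _ => false) =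
      Sum.elim x (Sum.elim (fun _ => false) (fun _ => false)) := by
    refine extend_eq_of (.inl : I ↪ I ⊕ (c₁.W ⊕ c₂.W)) rfl ?_
    rintro (k | k | k) hk
    · exact absurd rfl (hk k)
    · rfl
    · rfl
  have hx : ∀ {V : Type} (o : I ↪ V), xorInto o x (fun _ => false) =
      Function.extend o x (fun _ => false) := fun o => by funext k; simp [xorInto]
  have h1 : ∀ (y : Bits c₁.W) (y' : Bits c₂.W),
      perms f ((c₁.prog.map (Instr.embed (.inl : c₁.W ↪ c₁.W ⊕ c₂.W))).map
        (Instr.embed (.inr : c₁.W ⊕ c₂.W ↪ I ⊕ (c₁.W ⊕ c₂.W)))) (Sum.elim x (Sum.elim y y')) =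
      Sum.elim x (Sum.elim (perms f c₁.prog y) y') := fun y y' => by
    rw [perms_embed, extend_inr_elim, perms_embed, ← extend_inl_elim (perms f c₁.prog y) y y']
    rfl
  have h2 : ∀ (y : Bits c₁.W) (y' : Bits c₂.W),
      perms f ((c₂.prog.map (Instr.embed (.inr : c₂.W ↪ c₁.W ⊕ c₂.W))).map
        (Instr.embed (.inr : c₁.W ⊕ c₂.W ↪ I ⊕ (c₁.W ⊕ c₂.W)))) (Sum.elim x (Sum.elim y y')) =
      Sum.elim x (Sum.elim y (perms f c₂.prog y')) := fun y y' => by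
    rw [perms_embed, extend_inr_elim, perms_embed, ← extend_inr_elim (perms f c₂.prog y') y y']
    rfl
  have h3 : ∀ (y : Bits c₁.W) (y' : Bits c₂.W),
      perms f (copy (A := A) (B := B) (C := Empty) (D := Empty) .inl
        ((c₁.inp.trans (.inl : c₁.W ↪ c₁.W ⊕ c₂.W)).trans .inr)
        (inl_ne_trans_trans_inr _ _)) (Sum.elim x (Sum.elim y y')) =
      Sum.elim x (Sum.elim (xorInto c₁.inp x y) y') := fun y y' => by
    rw [perms_copy, xorInto_inr, xorInto_trans, ← extend_inl_elim (xorInto c₁.inp x y) y y']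
    rfl
  have h4 : ∀ (y : Bits c₁.W) (y' : Bits c₂.W),
      perms f (copy (A := A) (B := B) (C := Empty) (D := Empty) .inl
        ((c₂.inp.trans (.inr : c₂.W ↪ c₁.W ⊕ c₂.W)).trans .inr)
        (inl_ne_trans_trans_inr _ _)) (Sum.elim x (Sum.elim y y')) =
      Sum.elim x (Sum.elim y (xorInto c₂.inp x y')) := fun y y' => by
    rw [perms_copy, xorInto_inr, xorInto_trans, ← extend_inr_elim (xorInto c₂.inp x y') y y']
    rfl
  rw [Circuit.eval_eq]
  change perms (W := I ⊕ (c₁.W ⊕ c₂.W)) f (c₁.pairProg c₂)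
    (Function.extend (.inl : I ↪ I ⊕ (c₁.W ⊕ c₂.W)) x fun _ => false) ∘
    Sum.elim (fun x => .inr (.inl (c₁.out x))) (fun x => .inr (.inr (c₂.out x))) = _
  rw [hs, Circuit.pairProg, perms_append, perms_append, perms_append, h3, h1, h4, h2, hx, hx,
    Circuit.eval_eq, Circuit.eval_eq]
  funext o
  rcases o with o | o <;> rfl

theorem Circuit.size_pair_le [Fintype I] [DecidableEq I] (c₁ : CAlg I O A B Empty Empty)
    (c₂ : CAlg I O' A B Empty Empty) :
    (c₁.pair c₂).size ≤ c₁.size + c₂.size + 3 * Fintype.card I := by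
  have h2 : Fintype.card (c₁.pair c₂).W =
      Fintype.card I + (Fintype.card c₁.W + Fintype.card c₂.W) := by
    rw [← Fintype.card_sum, ← Fintype.card_sum]; rfl
  rw [Circuit.size, h2]
  simp only [Circuit.pair, Circuit.pairProg, List.length_append, List.length_map, length_copy,
    Circuit.size]
  omega

/-- The circuit with its output bits rearranged. -/
def Circuit.reout {Γ : Type → Type} (c : Circuit Γ I O A B C D) (σ : O' → O) :
    Circuit Γ I O' A B C D :=
  { c with out := c.out ∘ σ }

/-- Forget the queries to an oracle that does not exist. -/
def Instr.dropQueries : List (Instr Γ W Empty Empty C D) → List (Instr Γ W A B C D)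
  | [] => []
  | .gate g :: p => .gate g :: dropQueries p
  | .call i o h :: p => .call i o h :: dropQueries p
  | .query _ _ _ :: p => dropQueries p

/-- A circuit that uses no oracle, as a circuit with any oracle. -/
def Circuit.dropQueries {Γ : Type → Type} (c : Circuit Γ I O Empty Empty C D) :
    Circuit Γ I O A B C D :=
  { W := c.W, inp := c.inp, out := c.out, prog := Instr.dropQueries c.prog }

theorem Circuit.cval_dropQueries [Fintype R] (c : CAlg I O Empty Empty C D) (f : Bits A → Bits B)
    (step : St → Bits C → R → Option (Bits D × St)) (st : St) (x : Bits I)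
    (κ : Bits O → St → ℝ) :
    (c.dropQueries : CAlg I O A B C D).cval f step st x κ = c.cval id step st x κ := by
  have key : ∀ (p : List (Instr (RevGate c.W) c.W Empty Empty C D)) (st : St) (w : Bits c.W)
      (κ : Bits c.W → St → ℝ), cexp f step (Instr.dropQueries p) st w κ =
        cexp id step p st w κ := by
    intro p
    induction p with
    | nil => intros; rfl
    | cons s p ih => intro st w κ; cases s <;> simp [Instr.dropQueries, cexp, ih]
  exact key _ _ _ _

theorem Circuit.size_dropQueries_le {Γ : Type → Type} (c : Circuit Γ I O Empty Empty C D) :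
    (c.dropQueries : Circuit Γ I O A B C D).size ≤ c.size := by
  have key : ∀ (p : List (Instr (Γ c.W) c.W Empty Empty C D)),
      (Instr.dropQueries p : List (Instr (Γ c.W) c.W A B C D)).length ≤ p.length := by
    intro p
    induction p with
    | nil => simp [Instr.dropQueries]
    | cons s p ih => cases s <;> simp [Instr.dropQueries] <;> omega
  exact Nat.add_le_add_right (key c.prog) (Fintype.card c.W)

/-- A single oracle query, which ignores the input bits `Z`. -/
def queryCircuit [Fintype A] [DecidableEq A] [Fintype Z] [DecidableEq Z] [Fintype B]
    [DecidableEq B] : CAlg (A ⊕ Z) B A B Empty Empty where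
  W := (A ⊕ Z) ⊕ B
  inp := .inl
  out := .inr
  prog := [.query (fun a => .inl (.inl a)) .inr (fun _ _ => Sum.inl_ne_inr)]

theorem eval_queryCircuit [Fintype A] [DecidableEq A] [Fintype Z] [DecidableEq Z] [Fintype B]
    [DecidableEq B] (f : Bits A → Bits B) (x : Bits A) (z : Bits Z) :
    queryCircuit.eval f (Sum.elim x z) = f x := by
  have hs : (queryCircuit : CAlg (A ⊕ Z) B A B Empty Empty).start (Sum.elim x z) =
      Sum.elim (Sum.elim x z) fun _ => false := by
    refine extend_eq_of (.inl : A ⊕ Z ↪ (A ⊕ Z) ⊕ B) rfl ?_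
    rintro (k | k) hk
    · exact absurd rfl (hk k)
    · rfl
  rw [Circuit.eval_eq, hs]
  funext b
  have := xorInto_emb (.inr : B ↪ (A ⊕ Z) ⊕ B) (f x) (Sum.elim (Sum.elim x z) fun _ => false) b
  refine this.trans ?_
  simp

/-- A single call to the other party, which ignores the input bits `Z`. -/
def callCircuit [Fintype C] [DecidableEq C] [Fintype Z] [DecidableEq Z] [Fintype D]
    [DecidableEq D] : CAlg (C ⊕ Z) D A B C D where
  W := (C ⊕ Z) ⊕ D
  inp := .inl
  out := .inr
  prog := [.call (fun a => .inl (.inl a)) .inr (fun _ _ => Sum.inl_ne_inr)]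

theorem cval_callCircuit [Fintype C] [DecidableEq C] [Fintype Z] [DecidableEq Z] [Fintype D]
    [DecidableEq D] [Fintype R] (f : Bits A → Bits B)
    (step : St → Bits C → R → Option (Bits D × St)) (st : St) (v : Bits C) (z : Bits Z)
    (κ : Bits D → St → ℝ) :
    (callCircuit : CAlg (C ⊕ Z) D A B C D).cval f step st (Sum.elim v z) κ =
      respond step st v κ := by
  have hs : (callCircuit : CAlg (C ⊕ Z) D A B C D).start (Sum.elim v z) =
      Sum.elim (Sum.elim v z) fun _ => false := by
    refine extend_eq_of (.inl : C ⊕ Z ↪ (C ⊕ Z) ⊕ D) rfl ?_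
    rintro (k | k) hk
    · exact absurd rfl (hk k)
    · rfl
  rw [Circuit.cval, hs]
  change respond step st v (fun y st' => κ (xorInto (.inr : D ↪ (C ⊕ Z) ⊕ D) y
    (Sum.elim (Sum.elim v z) fun _ => false) ∘ Sum.inr) st') = _
  congr 1
  funext y st'
  have : xorInto (.inr : D ↪ (C ⊕ Z) ⊕ D) y (Sum.elim (Sum.elim v z) fun _ => false) ∘
      Sum.inr = y := by
    funext d
    refine (xorInto_emb (.inr : D ↪ (C ⊕ Z) ⊕ D) y _ d).trans ?_
    simp
  exact congrArg (fun y => κ y st') this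

theorem size_queryCircuit [Fintype A] [DecidableEq A] [Fintype Z] [DecidableEq Z] [Fintype B]
    [DecidableEq B] : (queryCircuit : CAlg (A ⊕ Z) B A B Empty Empty).size =
      1 + (Fintype.card A + Fintype.card Z + Fintype.card B) := by
  have h : Fintype.card (queryCircuit : CAlg (A ⊕ Z) B A B Empty Empty).W =
      Fintype.card A + Fintype.card Z + Fintype.card B := by
    rw [← Fintype.card_sum, ← Fintype.card_sum]; rfl
  rw [Circuit.size, h]
  rfl

theorem size_callCircuit [Fintype C] [DecidableEq C] [Fintype Z] [DecidableEq Z] [Fintype D]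
    [DecidableEq D] : (callCircuit : CAlg (C ⊕ Z) D A B C D).size =
      1 + (Fintype.card C + Fintype.card Z + Fintype.card D) := by
  have h : Fintype.card (callCircuit : CAlg (C ⊕ Z) D A B C D).W =
      Fintype.card C + Fintype.card Z + Fintype.card D := by
    rw [← Fintype.card_sum, ← Fintype.card_sum]; rfl
  rw [Circuit.size, h]
  rfl

theorem calls_callCircuit [Fintype C] [DecidableEq C] [Fintype Z] [DecidableEq Z] [Fintype D]
    [DecidableEq D] : (callCircuit : CAlg (C ⊕ Z) D A B C D).calls = 1 := rfl

/-- A circuit that talks to no other party is deterministic. -/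
theorem Circuit.cval_empty (c : CAlg I O A B Empty Empty) (f : Bits A → Bits B) (st : St)
    (x : Bits I) (κ : Bits O → St → ℝ) :
    c.cval f (fun st _ (_ : Unit) => some (Empty.elim, st)) st x κ = κ (c.eval f x) st := by
  have key : ∀ (p : List (Instr (RevGate c.W) c.W A B Empty Empty)) (w : Bits c.W)
      (κ : Bits c.W → St → ℝ),
      cexp f (fun st _ (_ : Unit) => some (Empty.elim, st)) p st w κ = κ (perms f p w) st := by
    intro p
    induction p with
    | nil => intros; rfl
    | cons s p ih =>
      intro w κ
      cases s with
      | gate g => simp [cexp, ih, Instr.perm]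
      | query i o h => simp [cexp, ih, Instr.perm]
      | call i o h =>
        rw [cexp, respond_some _ _ _ (Empty.elim, st) _ fun _ => rfl, ih]
        simp [Instr.perm]
  rw [Circuit.cval, key, Circuit.eval_eq]

/-- `g` is computed by a classical circuit of size at most `s`. -/
def Computes (s : ℕ) (g : (Bits A → Bits B) → Bits I → Bits O) : Prop :=
  ∃ c : CAlg I O A B Empty Empty, c.size ≤ s ∧ ∀ f x, c.eval f x = g f x

namespace Computes

theorem comp [Fintype M] {s₁ s₂ : ℕ} {g₁ : (Bits A → Bits B) → Bits I → Bits M}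
    {g₂ : (Bits A → Bits B) → Bits M → Bits O} (h₁ : Computes s₁ g₁) (h₂ : Computes s₂ g₂) :
    Computes (s₁ + 2 * s₂) fun f x => g₂ f (g₁ f x) := by
  obtain ⟨c₁, hs₁, h₁⟩ := h₁
  obtain ⟨c₂, hs₂, h₂⟩ := h₂
  refine ⟨c₁.comp c₂, (c₁.size_comp_le c₂).trans (by omega), fun f x => ?_⟩
  rw [Circuit.eval_comp, h₁, h₂]

theorem pair [Fintype I] [DecidableEq I] {s₁ s₂ : ℕ} {g₁ : (Bits A → Bits B) → Bits I → Bits O}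
    {g₂ : (Bits A → Bits B) → Bits I → Bits O'} (h₁ : Computes s₁ g₁) (h₂ : Computes s₂ g₂) :
    Computes (s₁ + s₂ + 3 * Fintype.card I) fun f x => Sum.elim (g₁ f x) (g₂ f x) := by
  obtain ⟨c₁, hs₁, h₁⟩ := h₁
  obtain ⟨c₂, hs₂, h₂⟩ := h₂
  refine ⟨c₁.pair c₂, (c₁.size_pair_le c₂).trans (by omega), fun f x => ?_⟩
  rw [Circuit.eval_pair, h₁, h₂]

theorem mono {s s' : ℕ} {g : (Bits A → Bits B) → Bits I → Bits O} (h : Computes s g)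
    (hs : s ≤ s') : Computes s' g := by
  obtain ⟨c, hc, h⟩ := h
  exact ⟨c, hc.trans hs, h⟩

theorem of_layer [Fintype I] [DecidableEq I] [Fintype O] [DecidableEq O]
    (t : O → List (Term I)) {n : ℕ} (hn : ∀ o, (t o).length ≤ n) :
    Computes (Fintype.card O * n + (Fintype.card I + Fintype.card O))
      fun (_ : Bits A → Bits B) x o => Term.parity x (t o) := by
  refine ⟨layer t, ?_, fun f x => eval_layer t f x⟩
  rw [size_layer]
  have := Finset.sum_le_card_nsmul Finset.univ (fun o => (t o).length) n fun o _ => hn o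
  simp only [smul_eq_mul, Finset.card_univ] at this
  omega

theorem of_wires [Fintype I] [DecidableEq I] [Fintype O] [DecidableEq O] (σ : O → I ⊕ Bool) :
    Computes (Fintype.card I + 2 * Fintype.card O)
      fun (_ : Bits A → Bits B) x o => Sum.elim x id (σ o) :=
  ⟨wires σ, size_wires_le σ, fun f x => eval_wires σ f x⟩

/-- The conjunction of two predicates. -/
theorem and [Fintype I] [DecidableEq I] {s₁ s₂ : ℕ} {p₁ p₂ : (Bits A → Bits B) → Bits I → Bool}
    (h₁ : Computes s₁ fun f x (_ : Unit) => p₁ f x)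
    (h₂ : Computes s₂ fun f x (_ : Unit) => p₂ f x) :
    Computes (s₁ + s₂ + 3 * Fintype.card I + 8) fun f x (_ : Unit) => p₁ f x && p₂ f x := by
  have h := (h₁.pair h₂).comp
    (of_layer (fun _ : Unit => [Term.quad (.inl ()) (.inr ())]) (n := 1) (by simp))
  refine (h.mono ?_).imp fun c hc => ⟨hc.1, fun f x => ?_⟩
  · simp
  · rw [hc.2]
    simp [Term.eval]

/-- The conjunction of a list of predicates. -/
theorem all [Fintype I] [DecidableEq I] {s : ℕ} {p : K → (Bits A → Bits B) → Bits I → Bool}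
    (h : ∀ k, Computes s fun f x (_ : Unit) => p k f x) (l : List K) :
    Computes (l.length * (s + 3 * Fintype.card I + 8) + (Fintype.card I + 2))
      fun f x (_ : Unit) => l.all fun k => p k f x := by
  induction l with
  | nil =>
    have := of_layer (A := A) (B := B) (I := I) (fun _ : Unit => [Term.one]) (n := 1) (by simp)
    refine (this.mono ?_).imp fun c hc => ⟨hc.1, fun f x => ?_⟩
    · simp
      omega
    · rw [hc.2]; simp [Term.eval]
  | cons k l ih =>
    refine (((h k).and ih).mono ?_).imp fun c hc => ⟨hc.1, fun f x => ?_⟩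
    · rw [List.length_cons, add_mul]; omega
    · rw [hc.2]; simp

/-- The negation of a predicate. -/
theorem not {s : ℕ} {p : (Bits A → Bits B) → Bits I → Bool}
    (h : Computes s fun f x (_ : Unit) => p f x) :
    Computes (s + 8) fun f x (_ : Unit) => !(p f x) := by
  have h := h.comp (of_layer (fun _ : Unit => [Term.one, Term.lin ()]) (n := 2) (by simp))
  refine (h.mono ?_).imp fun c hc => ⟨hc.1, fun f x => ?_⟩
  · simp
  · rw [hc.2]; simp [Term.eval]

end Computes

end

/-! ### Comparison of quantum runs -/

section

variable {W A B C D R St St' : Type} [Fintype W] [DecidableEq W] [Fintype C] [DecidableEq C]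

/-- Two runs of the same quantum circuit agree if a relation `Rel k` between the states of the two
parties, when `k` steps are left, is preserved. -/
theorem qval_eq_qval (f : Bits A → Bits B) {K : ℕ → St → Bits C → (Bits D → St → ℝ) → ℝ}
    {K' : ℕ → St' → Bits C → (Bits D → St' → ℝ) → ℝ} {val : St → Bits W → ℝ}
    {val' : St' → Bits W → ℝ} {Rel : ℕ → St → St' → Prop}
    (hRel : ∀ k st st', Rel (k + 1) st st' → Rel k st st')
    (hK : ∀ k st st' v κ κ', Rel (k + 1) st st' →
      (∀ y s s', Rel k s s' → κ y s = κ' y s') → K k st v κ = K' k st' v κ')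
    (hval : ∀ st st' w, Rel 0 st st' → val st w = val' st' w)
    (p : List (Instr (QGate W) W A B C D)) (st : St) (st' : St') (h : Rel p.length st st')
    (ψ : Bits W → ℂ) : qval f K val p st ψ = qval f K' val' p st' ψ := by
  induction p generalizing st st' ψ with
  | nil => exact Finset.sum_congr rfl fun w _ => by rw [hval _ _ _ h]
  | cons s p ih =>
    cases s with
    | gate g => exact ih _ _ (hRel _ _ _ h) _
    | query i o _ => exact ih _ _ (hRel _ _ _ h) _
    | call i o _ =>
      exact Finset.sum_congr rfl fun v _ => hK _ _ _ _ _ _ h fun y s s' hs => ih _ _ hs _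

/-- The operator `K k` only matters at the calls that are followed by `k` steps. -/
theorem qval_congr (f : Bits A → Bits B) {K K' : ℕ → St → Bits C → (Bits D → St → ℝ) → ℝ}
    {val : St → Bits W → ℝ} (p : List (Instr (QGate W) W A B C D))
    (h : ∀ k < p.length, K k = K' k) (st : St) (ψ : Bits W → ℂ) :
    qval f K val p st ψ = qval f K' val p st ψ := by
  induction p generalizing st ψ with
  | nil => rfl
  | cons s p ih =>
    have ih' := ih fun k hk => h k (hk.trans (by simp))
    cases s with
    | gate g => exact ih' _ _
    | query i o _ => exact ih' _ _
    | call i o _ => simp only [qval, h p.length (by simp), ih']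

section qexpect
variable [Fintype R] (f : Bits A → Bits B) (step : St → Bits C → R → Option (Bits D × St))

theorem qexpect_nonneg {val : St → Bits W → ℝ} (hval : ∀ st w, 0 ≤ val st w)
    (p : List (Instr (QGate W) W A B C D)) (st : St) (ψ : Bits W → ℂ) :
    0 ≤ qexpect f step val p st ψ := by
  induction p generalizing st ψ with
  | nil => exact Finset.sum_nonneg fun w _ => mul_nonneg (by positivity) (hval _ _)
  | cons s p ih =>
    cases s with
    | gate g => exact ih _ _
    | query i o _ => exact ih _ _
    | call i o _ =>
      refine Finset.sum_nonneg fun v _ => Finset.expect_nonneg fun r _ => ?_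
      rcases step st v r with - | ⟨y, st'⟩
      · exact le_rfl
      · exact ih _ _

theorem qexpect_le_nsq [Nonempty R] {val : St → Bits W → ℝ} (hval : ∀ st w, val st w ≤ 1)
    (p : List (Instr (QGate W) W A B C D)) (st : St) (ψ : Bits W → ℂ) :
    qexpect f step val p st ψ ≤ nsq ψ := by
  induction p generalizing st ψ with
  | nil => exact Finset.sum_le_sum fun w _ => mul_le_of_le_one_right (by positivity) (hval _ _)
  | cons s p ih =>
    cases s with
    | gate g => exact (ih _ _).trans_eq (nsq_act g ψ)
    | query i o h => exact (ih _ _).trans_eq (nsq_query f i o h ψ)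
    | call i o h =>
      refine (Finset.sum_le_sum fun v _ => ?_).trans_eq (sum_nsq_restrict i ψ)
      refine Finset.expect_le Finset.univ_nonempty fun r _ => ?_
      rcases step st v r with - | ⟨y, st'⟩
      · exact nsq_nonneg _
      · exact (ih _ _).trans_eq (nsq_call i o h v y ψ)

theorem qexpect_sub {val val' : St → Bits W → ℝ} (c : ℝ)
    (p : List (Instr (QGate W) W A B C D)) (st : St) (ψ : Bits W → ℂ) :
    qexpect f step (fun st w => val st w - c * val' st w) p st ψ =
      qexpect f step val p st ψ - c * qexpect f step val' p st ψ := by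
  induction p generalizing st ψ with
  | nil =>
    simp only [qexpect]
    rw [Finset.mul_sum, ← Finset.sum_sub_distrib]
    exact Finset.sum_congr rfl fun w _ => by ring
  | cons s p ih =>
    cases s with
    | gate g => exact ih _ _
    | query i o _ => exact ih _ _
    | call i o _ =>
      simp only [qexpect]
      rw [Finset.mul_sum, ← Finset.sum_sub_distrib]
      refine Finset.sum_congr rfl fun v _ => ?_
      rw [Finset.mul_expect, ← Finset.expect_sub_distrib]
      refine Finset.expect_congr rfl fun r _ => ?_
      rcases step st v r with - | ⟨y, st'⟩
      · simp
      · exact ih _ _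

end qexpect

theorem nsq_basis (w₀ : Bits W) : nsq (fun w => if w = w₀ then 1 else 0) = 1 := by
  rw [nsq, Finset.sum_eq_single w₀] <;> simp +contextual

theorem ind_nonneg (b : Bool) : 0 ≤ ind b := by cases b <;> simp [ind]

theorem ind_le_one (b : Bool) : ind b ≤ 1 := by cases b <;> simp [ind]

section prob
variable {I O : Type} [Fintype R] (c : QAlg I O A B C D) (f : Bits A → Bits B)
  (step : St → Bits C → R → Option (Bits D × St)) (st : St) (acc : St → Bits O → Bool) (x : Bits I)

theorem Circuit.prob_nonneg : 0 ≤ c.prob f step st acc x :=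
  qexpect_nonneg f step (fun _ _ => ind_nonneg _) _ _ _

theorem Circuit.prob_le_one [Nonempty R] : c.prob f step st acc x ≤ 1 :=
  (qexpect_le_nsq f step (fun _ _ => ind_le_one _) _ _ _).trans_eq (nsq_basis _)

end prob

/-! ### Derandomization -/

/-- The coins of the party can be fixed, as a function of the number of remaining steps, so that a
weighted sum of expected values does not decrease. -/
theorem exists_coins [Fintype R] [Nonempty R] {Ω : Type} [Fintype Ω] (c : Ω → ℝ)
    (f : Ω → Bits A → Bits B) (step : Ω → St → Bits C → R → Option (Bits D × St))
    (val : Ω → St → Bits W → ℝ) (p : List (Instr (QGate W) W A B C D)) (st : Ω → St)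
    (ψ : Ω → Bits W → ℂ) :
    ∃ ρ : ℕ → R, ∑ ω, c ω * qexpect (f ω) (step ω) (val ω) p (st ω) (ψ ω) ≤
      ∑ ω, c ω * qval (f ω) (fun k => respond fun st v (_ : Unit) => step ω st v (ρ k)) (val ω) p
        (st ω) (ψ ω) := by
  induction p generalizing Ω with
  | nil => exact ⟨fun _ => Classical.arbitrary R, le_rfl⟩
  | cons s p ih =>
    cases s with
    | gate g => exact ih c f step val st fun ω => g.act (ψ ω)
    | query i o _ => exact ih c f step val st fun ω w => ψ ω (xorInto o (f ω (w ∘ i)) w)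
    | call i o _ =>
      let G : R → ℝ := fun r => ∑ ω, c ω * ∑ v, match step ω (st ω) v r with
        | none => 0
        | some (y, st') => qexpect (f ω) (step ω) (val ω) p st' fun w =>
          if w ∘ i = v then ψ ω (xorInto o y w) else 0
      obtain ⟨r₀, hr₀⟩ := Finite.exists_max G
      -- After the call, the outcome of the measurement is one of the parameters of the family.
      -- Members of the family with an abort get the weight `0`.
      obtain ⟨ρ, hρ⟩ := ih (Ω := Ω × Bits C)
        (fun ω => match step ω.1 (st ω.1) ω.2 r₀ with
          | none => 0
          | some _ => c ω.1)
        (fun ω => f ω.1) (fun ω => step ω.1) (fun ω => val ω.1)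
        (fun ω => match step ω.1 (st ω.1) ω.2 r₀ with
          | none => st ω.1
          | some (_, st') => st')
        (fun ω => match step ω.1 (st ω.1) ω.2 r₀ with
          | none => ψ ω.1
          | some (y, _) => fun w => if w ∘ i = ω.2 then ψ ω.1 (xorInto o y w) else 0)
      refine ⟨Function.update ρ p.length r₀, ?_⟩
      calc
        _ = 𝔼 r, G r := by
          simp only [G, qexpect]
          rw [Finset.expect_sum_comm]
          refine Finset.sum_congr rfl fun ω _ => ?_
          rw [← Finset.mul_expect, Finset.expect_sum_comm]
        _ ≤ G r₀ := Finset.expect_le Finset.univ_nonempty fun r _ => hr₀ r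
        _ = _ := by
          simp only [G, Finset.mul_sum]
          rw [← Finset.sum_product', Finset.univ_product_univ]
          refine Finset.sum_congr rfl fun ω _ => ?_
          rcases step ω.1 (st ω.1) ω.2 r₀ with - | ⟨y, st'⟩
          · simp
          · rfl
        _ ≤ _ := hρ
        _ = _ := by
          simp only [qval, Finset.mul_sum]
          rw [← Finset.univ_product_univ, Finset.sum_product]
          refine Finset.sum_congr rfl fun ω _ => Finset.sum_congr rfl fun v _ => ?_
          simp only [Function.update_self, respond, Finset.univ_unique, Finset.expect_singleton]
          rcases step ω (st ω) v r₀ with - | ⟨y, st'⟩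
          · simp
          · refine congrArg (c ω * ·) (qval_congr _ _ ?_ _ _)
            intro k hk
            rw [Function.update_of_ne hk.ne]

/-! ### Optimal classical strategies -/

/-- The party keeps a record of its calls. -/
def track (step : St → Bits C → R → Option (Bits D × St)) (st : Transcript C D × St) (v : Bits C)
    (r : R) : Option (Bits D × Transcript C D × St) :=
  (step st.2 v r).map fun a => (a.1, st.1 ++ [(v, a.1)], a.2)

theorem play_congr {M Sg : Type} [Fintype R] {next next' : List (M × Sg) → Option M}
    {step : St → M → R → Option (Sg × St)} {val val' : List (M × Sg) → St → ℝ} (k : ℕ)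
    (t : List (M × Sg)) (st : St) (hn : ∀ t', t <+: t' → next t' = next' t')
    (hv : ∀ t' st', t <+: t' → val t' st' = val' t' st') :
    play next step val k t st = play next' step val' k t st := by
  induction k generalizing t st with
  | zero => exact hv _ _ List.prefix_rfl
  | succ k ih =>
    simp only [play]
    rw [← hn t List.prefix_rfl]
    rcases next t with - | m
    · exact hv _ _ List.prefix_rfl
    · refine Finset.expect_congr rfl fun r _ => ?_
      rcases step st m r with - | ⟨y, st'⟩
      · rfl
      · exact ih _ _ (fun t' ht => hn _ ((List.prefix_append _ _).trans ht))
          fun t' st' ht => hv _ _ ((List.prefix_append _ _).trans ht)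

/-- A quantum algorithm that accesses a fixed oracle `f` and a party which depends on hidden
parameters `ω` is not better than a suitable deterministic strategy: its state depends on `ω` only
through the answers of the party, so that the weighted sum over `ω` is an average over the outcomes
of its measurements, and these can be replaced by the best ones. The weights `c` and the values
`val` may be negative. -/
theorem exists_strategy [Fintype D] [Fintype R] {Ω : Type} [Fintype Ω] (c : Ω → ℝ)
    (f : Bits A → Bits B) (step : Ω → St → Bits C → R → Option (Bits D × St))
    (val : Ω → Transcript C D → St → Bits W → ℝ) (p : List (Instr (QGate W) W A B C D)) {k : ℕ}
    (hk : p.countP Instr.isCall ≤ k) (t : Transcript C D) (st : Ω → St) (ψ : Bits W → ℂ) :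
    ∃ (next : Transcript C D → Option (Bits C)) (out : Transcript C D → Bits W),
      ∑ ω, c ω * qexpect f (track (step ω)) (fun s => val ω s.1 s.2) p (t, st ω) ψ ≤
        nsq ψ * ∑ ω, c ω * play next (step ω) (fun t' st' => val ω t' st' (out t')) k t (st ω) := by
  classical
  induction p generalizing Ω k t ψ with
  | nil =>
    obtain ⟨w₀, hw₀⟩ := Finite.exists_max fun w => ∑ ω, c ω * val ω t (st ω) w
    refine ⟨fun _ => none, fun _ => w₀, ?_⟩
    have hplay : ∀ ω, play (fun _ => none) (step ω) (fun t' st' => val ω t' st' w₀) k t (st ω) =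
        val ω t (st ω) w₀ := fun ω => by cases k <;> rfl
    simp only [hplay, qexpect, Finset.mul_sum]
    rw [Finset.sum_comm, ← Finset.mul_sum, nsq, Finset.sum_mul]
    refine Finset.sum_le_sum fun w _ => ?_
    refine le_trans (le_of_eq ?_) (mul_le_mul_of_nonneg_left (hw₀ w) (by positivity))
    rw [Finset.mul_sum]
    exact Finset.sum_congr rfl fun ω _ => by ring
  | cons s p ih =>
    cases s with
    | gate g =>
      have := ih c step val (k := k) (by simpa [Instr.isCall] using hk) t st (g.act ψ)
      rwa [nsq_act] at this
    | query i o h =>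
      have := ih c step val (k := k) (by simpa [Instr.isCall] using hk) t st
        fun w => ψ (xorInto o (f (w ∘ i)) w)
      rwa [nsq_query f i o h] at this
    | call i o h =>
      obtain _ | k := k
      · rw [List.countP_cons_of_pos rfl] at hk
        exact absurd hk (Nat.not_succ_le_zero _)
      have hk' : p.countP Instr.isCall ≤ k := by
        rw [List.countP_cons_of_pos rfl] at hk
        exact Nat.le_of_succ_le_succ hk
      -- After the query `v` and the answer `y`, the coins `r` of the call are among the hidden
      -- parameters, and those that do not lead to the answer `y` have weight `0`.
      have key : ∀ (v : Bits C) (y : Bits D), ∃ (next : Transcript C D → Option (Bits C))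
          (out : Transcript C D → Bits W), _ := fun v y => ih (Ω := Ω × R)
        (fun ω => if (step ω.1 (st ω.1) v ω.2).map Prod.fst = some y then
          c ω.1 / Fintype.card R else 0)
        (fun ω => step ω.1) (fun ω => val ω.1) hk' (t ++ [(v, y)])
        (fun ω => (step ω.1 (st ω.1) v ω.2).elim (st ω.1) Prod.snd)
        (fun w => if w ∘ i = v then ψ (xorInto o y w) else 0)
      choose next out hno using key
      let G : Bits C → ℝ := fun v => ∑ ω, c ω * 𝔼 r, match step ω (st ω) v r with
        | none => 0
        | some (y, st') => play (next v y) (step ω) (fun t' st' => val ω t' st' (out v y t')) k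
          (t ++ [(v, y)]) st'
      obtain ⟨v₀, hv₀⟩ := Finite.exists_max G
      -- The answer to the query `v₀` is read off from the transcript.
      refine ⟨fun t' => if h : t.length < t'.length then next v₀ (t'[t.length]).2 t' else some v₀,
        fun t' => if h : t.length < t'.length then out v₀ (t'[t.length]).2 t' else default, ?_⟩
      -- An average over the coins is split according to the answer.
      have split : ∀ (v : Bits C) (H : Ω → Bits D → St → ℝ),
          ∑ ω, c ω * (𝔼 r, match step ω (st ω) v r with
            | none => 0
            | some (y, st') => H ω y st') =
          ∑ y, ∑ ω : Ω × R, (if (step ω.1 (st ω.1) v ω.2).map Prod.fst = some y then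
            c ω.1 / Fintype.card R else 0) *
              H ω.1 y ((step ω.1 (st ω.1) v ω.2).elim (st ω.1) Prod.snd) := by
        intro v H
        rw [Finset.sum_comm, ← Finset.univ_product_univ, Finset.sum_product]
        refine Finset.sum_congr rfl fun ω _ => ?_
        rw [Finset.mul_expect, Finset.expect_eq_sum_div_card, Finset.sum_div]
        refine Finset.sum_congr rfl fun r _ => ?_
        rcases step ω (st ω) v r with - | ⟨y, st'⟩
        · simp
        · rw [Finset.sum_eq_single y]
          · simp only [Option.map_some, if_true, Option.elim_some, Finset.card_univ]
            ring
          · intro y' _ hy'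
            rw [if_neg (by simpa using hy'.symm), zero_mul]
          · simp
      calc
        _ = ∑ v, ∑ ω, c ω * 𝔼 r, match step ω (st ω) v r with
            | none => 0
            | some (y, st') => qexpect f (track (step ω)) (fun s => val ω s.1 s.2) p
              (t ++ [(v, y)], st') fun w => if w ∘ i = v then ψ (xorInto o y w) else 0 := by
          rw [Finset.sum_comm]
          refine Finset.sum_congr rfl fun ω _ => ?_
          rw [← Finset.mul_sum]
          refine congrArg (c ω * ·) (Finset.sum_congr rfl fun v _ => ?_)
          refine Finset.expect_congr rfl fun r _ => ?_
          simp only [track]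
          rcases step ω (st ω) v r with - | ⟨y, st'⟩ <;> rfl
        _ ≤ ∑ v, nsq (restrict i v ψ) * G v := by
          refine Finset.sum_le_sum fun v _ => ?_
          have hG : G v = _ := split v fun ω y st' => play (next v y) (step ω)
            (fun t' st' => val ω t' st' (out v y t')) k (t ++ [(v, y)]) st'
          rw [split v fun ω y st' => qexpect f (track (step ω)) (fun s => val ω s.1 s.2) p
              (t ++ [(v, y)], st') fun w => if w ∘ i = v then ψ (xorInto o y w) else 0,
            hG, Finset.mul_sum]
          refine Finset.sum_le_sum fun y _ => (hno v y).trans_eq ?_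
          rw [nsq_call i o h]
        _ ≤ ∑ v, nsq (restrict i v ψ) * G v₀ := Finset.sum_le_sum fun v _ =>
          mul_le_mul_of_nonneg_left (hv₀ v) (nsq_nonneg _)
        _ = nsq ψ * G v₀ := by rw [← Finset.sum_mul, sum_nsq_restrict]
        _ = _ := by
          refine congrArg (nsq ψ * ·) (Finset.sum_congr rfl fun ω _ => congrArg (c ω * ·) ?_)
          simp only [play, lt_irrefl, dif_neg, not_false_eq_true]
          refine Finset.expect_congr rfl fun r _ => ?_
          rcases step ω (st ω) v₀ r with - | ⟨y, st'⟩
          · rfl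
          · have ht : ∀ t' : Transcript C D, t ++ [(v₀, y)] <+: t' →
                ∃ h : t.length < t'.length, t'[t.length].2 = y := by
              rintro _ ⟨t', rfl⟩
              exact ⟨by simp, by simp⟩
            refine play_congr _ _ _ (fun t' h => ?_) fun t' st'' h => ?_
            · obtain ⟨h1, h2⟩ := ht t' h
              rw [dif_pos h1, h2]
            · obtain ⟨h1, h2⟩ := ht t' h
              rw [dif_pos h1, h2]

end

/-! ### Quantum queries and low degree -/

section

variable {W A B C D R St : Type}

/-- Linear combinations of functions of an oracle that depend on at most `d` values of it. -/
def LowDeg (A B : Type) (d : ℕ) : Submodule ℂ ((Bits A → Bits B) → ℂ) :=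
  Submodule.span ℂ {g | ∃ S : Finset (Bits A), S.card ≤ d ∧
    ∀ f f' : Bits A → Bits B, (∀ a ∈ S, f a = f' a) → g f = g f'}

namespace LowDeg

theorem mono {d d' : ℕ} (h : d ≤ d') : LowDeg A B d ≤ LowDeg A B d' :=
  Submodule.span_mono fun _ ⟨S, hS, hg⟩ => ⟨S, hS.trans h, hg⟩

theorem const (c : ℂ) : (fun _ => c) ∈ LowDeg A B 0 :=
  Submodule.subset_span ⟨∅, by simp, fun _ _ _ => rfl⟩

theorem eval (a : Bits A) (φ : Bits B → ℂ) : (fun f => φ (f a)) ∈ LowDeg A B 1 :=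
  Submodule.subset_span ⟨{a}, by simp, fun f f' h => congrArg φ (h a (by simp))⟩

theorem congr {d : ℕ} {g g' : (Bits A → Bits B) → ℂ} (hg : g ∈ LowDeg A B d)
    (h : ∀ f, g f = g' f) : g' ∈ LowDeg A B d :=
  (funext h : g = g') ▸ hg

theorem zero {d : ℕ} : (fun _ => 0) ∈ LowDeg A B d := Submodule.zero_mem _

theorem const_mul {d : ℕ} {g : (Bits A → Bits B) → ℂ} (c : ℂ) (hg : g ∈ LowDeg A B d) :
    (fun f => c * g f) ∈ LowDeg A B d :=
  Submodule.smul_mem _ c hg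

theorem mul {d d' : ℕ} {g g' : (Bits A → Bits B) → ℂ} (hg : g ∈ LowDeg A B d)
    (hg' : g' ∈ LowDeg A B d') : (fun f => g f * g' f) ∈ LowDeg A B (d + d') := by
  classical
  induction hg using Submodule.span_induction with
  | mem g h =>
    obtain ⟨S, hS, h⟩ := h
    induction hg' using Submodule.span_induction with
    | mem g' h' =>
      obtain ⟨S', hS', h'⟩ := h'
      refine Submodule.subset_span ⟨S ∪ S', (Finset.card_union_le _ _).trans (by omega),
        fun f f' hf => ?_⟩
      show g f * g' f = g f' * g' f'
      rw [h f f' fun a ha => hf a (Finset.mem_union_left _ ha),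
        h' f f' fun a ha => hf a (Finset.mem_union_right _ ha)]
    | zero => exact congr zero fun f => (mul_zero _).symm
    | add g₁ g₂ _ _ h₁ h₂ => exact congr (Submodule.add_mem _ h₁ h₂) fun f => (mul_add _ _ _).symm
    | smul c g₁ _ h₁ => exact congr (const_mul c h₁) fun f => mul_left_comm _ _ _
  | zero => exact congr zero fun f => (zero_mul _).symm
  | add g₁ g₂ _ _ h₁ h₂ => exact congr (Submodule.add_mem _ h₁ h₂) fun f => (add_mul _ _ _).symm
  | smul c g₁ _ h₁ => exact congr (const_mul c h₁) fun f => (mul_assoc _ _ _).symm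

theorem conj {d : ℕ} {g : (Bits A → Bits B) → ℂ} (hg : g ∈ LowDeg A B d) :
    (fun f => (starRingEnd ℂ) (g f)) ∈ LowDeg A B d := by
  induction hg using Submodule.span_induction with
  | mem g h =>
    obtain ⟨S, hS, h⟩ := h
    exact Submodule.subset_span ⟨S, hS, fun f f' hf => congrArg _ (h f f' hf)⟩
  | zero => exact congr zero fun f => (map_zero _).symm
  | add g₁ g₂ _ _ h₁ h₂ => exact congr (Submodule.add_mem _ h₁ h₂) fun f => (map_add _ _ _).symm
  | smul c g₁ _ h₁ =>
    exact congr (const_mul ((starRingEnd ℂ) c) h₁) fun f => (map_mul (starRingEnd ℂ) _ _).symm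

theorem sum {ι : Type} (s : Finset ι) {d : ℕ} {g : ι → (Bits A → Bits B) → ℂ}
    (hg : ∀ i ∈ s, g i ∈ LowDeg A B d) : (fun f => ∑ i ∈ s, g i f) ∈ LowDeg A B d :=
  congr (Submodule.sum_mem (LowDeg A B d) hg) fun _ => Finset.sum_apply _ _ _

end LowDeg

/-- Whether a step is an oracle query. -/
def Instr.isQuery {Γ : Type} : Instr Γ W A B C D → Bool
  | .query _ _ _ => true
  | _ => false

theorem LowDeg.act [Fintype W] [DecidableEq W] {d : ℕ} {ψ : (Bits A → Bits B) → Bits W → ℂ}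
    (hψ : ∀ w, (fun f => ψ f w) ∈ LowDeg A B d) (g : QGate W) (w : Bits W) :
    (fun f => g.act (ψ f) w) ∈ LowDeg A B d := by
  cases g with
  | rev g => exact hψ _
  | had i =>
    refine LowDeg.congr (LowDeg.const_mul (Real.sqrt 2 : ℂ)⁻¹ (Submodule.add_mem _
      (hψ (Function.update w i false))
      (LowDeg.const_mul (if w i then -1 else 1) (hψ (Function.update w i true))))) fun f => ?_
    simp only [QGate.act, Pi.add_apply]
    ring
  | phase i => exact LowDeg.const_mul _ (hψ w)
  | t i => exact LowDeg.const_mul _ (hψ w)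

/-- Each quantum query increases the degree of the amplitudes by one, hence the degree of the
probabilities by two. -/
theorem LowDeg.qexpect [Fintype W] [DecidableEq W] [Fintype B] [Fintype C] [DecidableEq C]
    [Fintype R] (step : St → Bits C → R → Option (Bits D × St)) (val : St → Bits W → ℝ)
    (p : List (Instr (QGate W) W A B C D)) {d : ℕ} (st : St)
    {ψ : (Bits A → Bits B) → Bits W → ℂ} (hψ : ∀ w, (fun f => ψ f w) ∈ LowDeg A B d) :
    (fun f => ((qexpect f step val p st (ψ f) : ℝ) : ℂ)) ∈
      LowDeg A B (2 * (d + p.countP Instr.isQuery)) := by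
  classical
  induction p generalizing d st ψ with
  | nil =>
    have : ∀ f, ((QROM.qexpect f step val [] st (ψ f) : ℝ) : ℂ) =
        ∑ w, (val st w : ℂ) * (ψ f w * (starRingEnd ℂ) (ψ f w)) := by
      intro f
      simp only [QROM.qexpect, Complex.ofReal_sum, Complex.ofReal_mul, Complex.ofReal_pow,
        Complex.mul_conj, Complex.normSq_eq_norm_sq]
      exact Finset.sum_congr rfl fun w _ => mul_comm _ _
    simp only [this]
    refine LowDeg.sum _ fun w _ => LowDeg.const_mul _ (LowDeg.mono ?_
      (LowDeg.mul (hψ w) (LowDeg.conj (hψ w))))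
    simp only [List.countP_nil]
    omega
  | cons s p ih =>
    cases s with
    | gate g =>
      rw [List.countP_cons_of_neg (by simp [Instr.isQuery])]
      exact ih st fun w => LowDeg.act hψ g w
    | query i o h =>
      rw [List.countP_cons_of_pos rfl]
      have := ih (d := d + 1) st (ψ := fun f w => ψ f (xorInto o (f (w ∘ i)) w)) fun w => ?_
      · exact LowDeg.mono (by omega) this
      · have h1 : ∀ f : Bits A → Bits B, ψ f (xorInto o (f (w ∘ i)) w) =
            ∑ y, ψ f (xorInto o y w) * if f (w ∘ i) = y then 1 else 0 := by
          intro f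
          rw [Finset.sum_eq_single (f (w ∘ i))] <;> simp +contextual [eq_comm]
        simp only [h1]
        exact LowDeg.sum _ fun y _ => LowDeg.mul (hψ _)
          (LowDeg.eval (w ∘ i) fun v => if v = y then 1 else 0)
    | call i o h =>
      rw [List.countP_cons_of_neg (by simp [Instr.isQuery])]
      simp only [QROM.qexpect, Complex.ofReal_sum]
      refine LowDeg.sum _ fun v _ => LowDeg.congr (LowDeg.const_mul (Fintype.card R : ℂ)⁻¹
        (LowDeg.sum Finset.univ fun r _ => ?_)) fun f => (?_ : _ * ∑ r : R, ((match step st v r with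
          | none => 0
          | some (y, st') => QROM.qexpect f step val p st'
            (fun w => if w ∘ i = v then ψ f (xorInto o y w) else 0) : ℝ) : ℂ) = _)
      swap
      · rw [Finset.expect_eq_sum_div_card, Complex.ofReal_div, Complex.ofReal_sum, div_eq_inv_mul,
          Finset.card_univ, Complex.ofReal_natCast]
      rcases step st v r with - | ⟨y, st'⟩
      · exact LowDeg.congr LowDeg.zero fun f => Complex.ofReal_zero.symm
      · refine ih st' fun w => ?_
        by_cases hw : w ∘ i = v
        · simpa only [hw, if_true] using hψ (xorInto o y w)
        · simpa only [hw, if_false] using LowDeg.zero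

/-- If a family of functions is additive in the key and takes all possible values at any `d` points,
then its values at these points are independent and uniform: `d` values do not distinguish it from a
random function. -/
theorem LowDeg.expect_eq [Fintype A] [DecidableEq A] [Fintype B] [DecidableEq B] {K : Type}
    [Fintype K] [AddCommGroup K] {d : ℕ} (F : K → Bits A → Bits B)
    (hadd : ∀ k k' a b, F (k + k') a b = xor (F k a b) (F k' a b))
    (hex : ∀ (S : Finset (Bits A)) (φ : Bits A → Bits B), S.card ≤ d →
      ∃ k, ∀ a ∈ S, F k a = φ a)
    {g : (Bits A → Bits B) → ℂ} (hg : g ∈ LowDeg A B d) :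
    𝔼 k, g (F k) = 𝔼 f, g f := by
  classical
  induction hg using Submodule.span_induction with
  | mem g h =>
    obtain ⟨S, hS, h⟩ := h
    -- Both sides are averages over the shifts of `F k` by a function `φ`.
    have h1 : ∀ φ : Bits A → Bits B, 𝔼 k, g (F k) = 𝔼 k, g fun a b => xor (F k a b) (φ a b) := by
      intro φ
      obtain ⟨k₀, hk₀⟩ := hex S φ hS
      rw [← Fintype.expect_equiv (Equiv.addRight k₀) (fun k => g (F (k + k₀))) (fun k => g (F k))
        fun k => rfl]
      refine Finset.expect_congr rfl fun k _ => h _ _ fun a ha => ?_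
      funext b
      rw [hadd, hk₀ a ha]
    have h2 : ∀ k, 𝔼 φ : Bits A → Bits B, g (fun a b => xor (F k a b) (φ a b)) = 𝔼 f, g f := by
      intro k
      exact Fintype.expect_equiv (Function.Involutive.toPerm
        (fun (φ : Bits A → Bits B) a b => xor (F k a b) (φ a b))
        fun φ => by funext a b; simp) _ _ fun φ => rfl
    calc
      _ = 𝔼 φ : Bits A → Bits B, 𝔼 k, g fun a b => xor (F k a b) (φ a b) := by
        simp only [← h1]
        rw [Finset.expect_const Finset.univ_nonempty]
      _ = _ := by
        rw [Finset.expect_comm]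
        simp only [h2]
        rw [Finset.expect_const Finset.univ_nonempty]
  | zero => simp only [Pi.zero_apply, Finset.expect_const_zero]
  | add g₁ g₂ _ _ h₁ h₂ => simp only [Pi.add_apply, Finset.expect_add_distrib, h₁, h₂]
  | smul c g₁ _ h₁ => simp only [Pi.smul_apply, smul_eq_mul, ← Finset.mul_expect, h₁]

/-! ### Polynomials over a field with `2 ^ m` elements -/

/-- The bits of an element of a vector space over `𝔽₂`. -/
def fieldBits {m : ℕ} {F : Type} [Field F] [Algebra (ZMod 2) F]
    (e : Module.Basis (Fin m) (ZMod 2) F) (x : F) : Bits (Fin m) := fun i => decide (e.repr x i = 1)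

theorem exists_field (m : ℕ) (hm : m ≠ 0) : ∃ (F : Type) (_ : Field F) (_ : Fintype F)
    (_ : Algebra (ZMod 2) F), Nonempty (Module.Basis (Fin m) (ZMod 2) F) := by
  have : Fact (Nat.Prime 2) := ⟨Nat.prime_two⟩
  refine ⟨GaloisField 2 m, inferInstance, Fintype.ofFinite _, inferInstance, ⟨?_⟩⟩
  exact Module.finBasisOfFinrankEq (ZMod 2) (GaloisField 2 m) (GaloisField.finrank 2 hm)

/-- A bit as an element of `𝔽₂`. -/
def bitVal (b : Bool) : ZMod 2 := if b then 1 else 0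

theorem bitVal_xor (a b : Bool) : bitVal (xor a b) = bitVal a + bitVal b := by
  cases a <;> cases b <;> decide

theorem bitVal_and (a b : Bool) : bitVal (a && b) = bitVal a * bitVal b := by
  cases a <;> cases b <;> decide

theorem bitVal_decide (x : ZMod 2) : bitVal (decide (x = 1)) = x := by
  revert x; decide

theorem bitVal_injective : Function.Injective bitVal := by
  intro a b; revert a b; decide

section field
variable {m : ℕ} {F : Type} [Field F] [Algebra (ZMod 2) F] (e : Module.Basis (Fin m) (ZMod 2) F)

theorem bitVal_fieldBits (x : F) (i : Fin m) : bitVal (fieldBits e x i) = e.repr x i :=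
  bitVal_decide _

/-- The field element with the given bits. -/
def ofBits (v : Bits (Fin m)) : F := ∑ i, bitVal (v i) • e i

@[simp] theorem fieldBits_ofBits (v : Bits (Fin m)) : fieldBits e (ofBits e v) = v := by
  funext i
  apply bitVal_injective
  rw [bitVal_fieldBits, ofBits, e.repr_sum_self fun i => bitVal (v i)]

@[simp] theorem ofBits_fieldBits (x : F) : ofBits e (fieldBits e x) = x := by
  simp only [ofBits, bitVal_fieldBits]
  exact e.sum_repr x

theorem fieldBits_add (x y : F) (i : Fin m) :
    fieldBits e (x + y) i = xor (fieldBits e x i) (fieldBits e y i) := by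
  apply bitVal_injective
  simp [bitVal_xor, bitVal_fieldBits]

theorem bitVal_parity {I : Type} (x : Bits I) (ts : List (Term I)) :
    bitVal (Term.parity x ts) = (ts.map fun t => bitVal (t.eval x)).sum := by
  induction ts with
  | nil => rfl
  | cons t ts ih => rw [Term.parity_cons, bitVal_xor, ih, List.map_cons, List.sum_cons]

/-- The monomials of bit `i` of the field element `c + x * y`. -/
def mulAddTerms (c : F) (i : Fin m) : List (Term (Fin m ⊕ Fin m)) :=
  (if fieldBits e c i then [.one] else []) ++ (Finset.univ.toList.filter
    fun j : Fin m × Fin m => fieldBits e (e j.1 * e j.2) i).map fun j => .quad (.inl j.1) (.inr j.2)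

theorem parity_mulAddTerms (c : F) (i : Fin m) (u v : Bits (Fin m)) :
    Term.parity (Sum.elim u v) (mulAddTerms e c i) =
      fieldBits e (c + ofBits e u * ofBits e v) i := by
  apply bitVal_injective
  rw [bitVal_parity, bitVal_fieldBits, mulAddTerms, List.map_append, List.sum_append, List.map_map,
    map_add, Finsupp.add_apply]
  congr 1
  · rw [← bitVal_fieldBits]
    cases fieldBits e c i <;> simp [bitVal, Term.eval]
  · have h1 : ∀ l : List (Fin m × Fin m), ((l.filter fun j => fieldBits e (e j.1 * e j.2) i).map
        ((fun t => bitVal (Term.eval (Sum.elim u v) t)) ∘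
          fun j : Fin m × Fin m => Term.quad (.inl j.1) (.inr j.2))).sum =
        (l.map fun j : Fin m × Fin m =>
          bitVal (u j.1) * bitVal (v j.2) * e.repr (e j.1 * e j.2) i).sum := by
      intro l
      induction l with
      | nil => rfl
      | cons j l ih =>
        rw [List.map_cons, List.sum_cons, ← ih, ← bitVal_fieldBits]
        cases hj : fieldBits e (e j.1 * e j.2) i
        · rw [List.filter_cons_of_neg (by simp [hj])]
          simp [bitVal]
        · rw [List.filter_cons_of_pos (by simp [hj]), List.map_cons, List.sum_cons]
          rw [show bitVal true = 1 from rfl, mul_one, ← bitVal_and]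
          rfl
    rw [h1, Finset.sum_map_toList, ← Finset.univ_product_univ, Finset.sum_product, ofBits, ofBits,
      Finset.sum_mul_sum, map_sum, Finsupp.finsetSum_apply]
    refine Finset.sum_congr rfl fun a _ => ?_
    rw [map_sum, Finsupp.finsetSum_apply]
    refine Finset.sum_congr rfl fun b _ => ?_
    rw [smul_mul_smul_comm, map_smul, Finsupp.smul_apply, smul_eq_mul]

theorem length_mulAddTerms_le (c : F) (i : Fin m) : (mulAddTerms e c i).length ≤ m * m + 1 := by
  have h1 : ((Finset.univ.toList.filter
      fun j : Fin m × Fin m => fieldBits e (e j.1 * e j.2) i)).length ≤ m * m :=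
    (List.length_filter_le _ _).trans (by simp)
  have h2 :
      (if fieldBits e c i then [Term.one] else [] : List (Term (Fin m ⊕ Fin m))).length ≤ 1 := by
    split_ifs <;> simp
  rw [mulAddTerms, List.length_append, List.length_map]
  omega

/-- The polynomial with coefficients `k`. -/
def polyVal {d : ℕ} (k : Fin d → F) (x : F) : F := ∑ j, k j * x ^ (j : ℕ)

theorem polyVal_succ {d : ℕ} (k : Fin (d + 1) → F) (x : F) :
    polyVal k x = k 0 + polyVal (fun j => k j.succ) x * x := by
  rw [polyVal, Fin.sum_univ_succ, polyVal, Finset.sum_mul]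
  simp [pow_succ, mul_assoc]

/-- Lagrange interpolation. -/
theorem exists_polyVal {d : ℕ} {X : Type} (S : Finset X) (hS : S.card ≤ d) (v : X → F)
    (hv : Function.Injective v) (φ : X → F) : ∃ k : Fin d → F, ∀ x ∈ S, polyVal k (v x) = φ x := by
  classical
  let p := Lagrange.interpolate S v φ
  refine ⟨fun j => p.coeff j, fun x hx => ?_⟩
  have hdeg : p.natDegree < d := by
    have h1 : p.degree < (d : ℕ) := (Lagrange.degree_interpolate_lt φ hv.injOn).trans_le
      (by exact_mod_cast hS)
    have hd : 0 < d := (Finset.card_pos.mpr ⟨x, hx⟩).trans_le hS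
    by_cases hp : p = 0
    · rw [hp, Polynomial.natDegree_zero]; exact hd
    · exact (Polynomial.natDegree_lt_iff_degree_lt hp).mpr h1
  have h2 := Lagrange.eval_interpolate_at_node φ hv.injOn hx
  rw [Polynomial.eval_eq_sum_range' hdeg] at h2
  rw [← h2, polyVal, Fin.sum_univ_eq_sum_range fun j => p.coeff j * v x ^ j]

/-- Horner's scheme. -/
theorem computes_polyVal {d : ℕ} (k : Fin d → F) :
    Computes (A := A) (B := B) (5 * m + 2 * d * (2 * m * (m * m + 1) + 4 * m))
      fun _ (x : Bits (Fin m)) => Sum.elim (fieldBits e (polyVal k (ofBits e x))) x := by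
  induction d with
  | zero =>
    have := Computes.of_wires (A := A) (B := B) (I := Fin m)
      (Sum.elim (fun _ => .inr false) .inl : Fin m ⊕ Fin m → Fin m ⊕ Bool)
    refine (this.mono ?_).imp fun c hc => ⟨hc.1, fun f x => ?_⟩
    · simp
      omega
    · rw [hc.2]
      funext o
      rcases o with o | o
      · simp [polyVal, fieldBits]
      · rfl
  | succ d ih =>
    have h2 := Computes.of_layer (A := A) (B := B) (I := Fin m ⊕ Fin m)
      (Sum.elim (mulAddTerms e (k 0)) (fun i => [.lin (.inr i)]) : Fin m ⊕ Fin m → _)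
      (n := m * m + 1) (by
        rintro (i | i)
        · exact length_mulAddTerms_le e _ i
        · simp)
    refine (((ih fun j => k j.succ).comp h2).mono ?_).imp fun c hc => ⟨hc.1, fun f x => ?_⟩
    · simp only [Fintype.card_sum, Fintype.card_fin]
      apply le_of_eq
      ring
    · rw [hc.2]
      funext o
      rcases o with o | o
      · simp only [Sum.elim_inl]
        rw [parity_mulAddTerms, ofBits_fieldBits, polyVal_succ]
      · simp [Term.eval]

end field

/-- Functions that look random if they are evaluated at most `d` times, with small circuits: the
polynomials of degree less than `d` over a finite field. -/
theorem exists_independent_family (a b d : ℕ) :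
    ∃ (K : Type) (_ : Fintype K) (_ : Nonempty K) (F : K → BitStr a → BitStr b),
      (∀ k, Computes (A := Empty) (B := Empty) (100 * (a + b + d + 1) ^ 4) fun _ x => F k x) ∧
      ∀ g ∈ LowDeg (Fin a) (Fin b) d, 𝔼 k, g (F k) = 𝔼 f, g f := by
  classical
  -- The field is large enough to contain the arguments and the values.
  let m := a + b + 1
  obtain ⟨F, _, _, _, ⟨e⟩⟩ := exists_field m (by omega)
  let pad : BitStr a → Bits (Fin m) := fun x i => if h : (i : ℕ) < a then x ⟨i, h⟩ else false
  have hpad : Function.Injective fun x => ofBits e (pad x) := by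
    intro x y hxy
    have := congrArg (fieldBits e) hxy
    simp only [fieldBits_ofBits] at this
    funext i
    have := congrFun this ⟨i, by omega⟩
    simpa [pad] using this
  have hb : b ≤ m := by omega
  refine ⟨Fin d → F, inferInstance, inferInstance,
    fun k x i => fieldBits e (polyVal k (ofBits e (pad x))) (Fin.castLE hb i), fun k => ?_,
    fun g hg => LowDeg.expect_eq _ ?_ ?_ hg⟩
  · have h1 := Computes.of_wires (A := Empty) (B := Empty) (I := Fin a) (fun i : Fin m =>
      if h : (i : ℕ) < a then .inl ⟨i, h⟩ else .inr false)
    have h3 := Computes.of_wires (A := Empty) (B := Empty) (I := Fin m ⊕ Fin m)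
      (fun i : Fin b => .inl (.inl (Fin.castLE hb i)))
    have h := (h1.comp (computes_polyVal e k)).comp h3
    refine (h.mono ?_).imp fun c hc => ⟨hc.1, fun f x => ?_⟩
    · simp only [Fintype.card_sum, Fintype.card_fin]
      have hM : 1 ≤ a + b + d + 1 := by omega
      generalize hMdef : a + b + d + 1 = M at *
      have ha : a ≤ M := by omega
      have hb' : b ≤ M := by omega
      have hm : m ≤ M := by omega
      have hd : d ≤ M := by omega
      calc
        _ ≤ M + 2 * M + 2 * (5 * M + 2 * M * (2 * M * (M * M + 1) + 4 * M)) +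
            2 * (M + M + 2 * M) := by gcongr
        _ = 8 * M ^ 4 + 24 * M ^ 2 + 21 * M := by ring
        _ ≤ 8 * M ^ 4 + 24 * M ^ 4 + 21 * M ^ 4 := by
          gcongr
          · omega
          · exact Nat.le_self_pow (by norm_num) M
        _ ≤ 100 * M ^ 4 := by omega
    · rw [hc.2]
      funext i
      simp only [Sum.elim_inl]
      refine congrArg (fun y => fieldBits e (polyVal k (ofBits e y)) (Fin.castLE hb i)) ?_
      funext j
      simp only [pad]
      split_ifs <;> rfl
  · intro k k' x i
    rw [← fieldBits_add]
    simp [polyVal, add_mul, Finset.sum_add_distrib]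
  · intro S φ hS
    obtain ⟨k, hk⟩ := exists_polyVal S hS (fun x => ofBits e (pad x)) hpad
      fun x => ofBits e fun i => if h : (i : ℕ) < b then φ x ⟨i, h⟩ else false
    refine ⟨k, fun x hx => ?_⟩
    funext i
    rw [hk x hx, fieldBits_ofBits]
    simp

end

/-! ### Asymptotics -/

section

variable {I J O O' Z W A B C D A' B' C' D' R St : Type}

theorem PolyBounded.mono {f g : ℕ → ℕ} (hg : PolyBounded g) (h : ∀ n, f n ≤ g n) :
    PolyBounded f :=
  hg.imp fun _ hp n => (h n).trans (hp n)

theorem PolyBounded.add {f g : ℕ → ℕ} (hf : PolyBounded f) (hg : PolyBounded g) :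
    PolyBounded fun n => f n + g n := by
  obtain ⟨p, hp⟩ := hf
  obtain ⟨q, hq⟩ := hg
  exact ⟨p + q, fun n => by rw [Polynomial.eval_add]; exact add_le_add (hp n) (hq n)⟩

theorem PolyBounded.const_mul_pow {f : ℕ → ℕ} (hf : PolyBounded f) (c d : ℕ) :
    PolyBounded fun n => c * (f n + 1) ^ d := by
  obtain ⟨p, hp⟩ := hf
  refine ⟨Polynomial.C c * (p + 1) ^ d, fun n => ?_⟩
  simp only [Polynomial.eval_mul, Polynomial.eval_C, Polynomial.eval_pow, Polynomial.eval_add,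
    Polynomial.eval_one]
  have := hp n
  gcongr

theorem Negligible.add {f g : ℕ → ℝ} (hf : Negligible f) (hg : Negligible g) :
    Negligible fun n => f n + g n :=
  Asymptotics.SuperpolynomialDecay.add hf hg

theorem Negligible.polynomial_mul {f : ℕ → ℝ} (hf : Negligible f) (p : Polynomial ℕ) :
    Negligible fun n => ((p.eval n : ℕ) : ℝ) * f n := by
  have := Asymptotics.SuperpolynomialDecay.polynomial_mul hf (p.map (Nat.castRingHom ℝ))
  refine this.congr fun n => ?_
  rw [Polynomial.eval_natCast_map]
  rfl

theorem Negligible.of_le {f g : ℕ → ℝ} (hg : Negligible g) (h0 : ∀ n, 0 ≤ f n)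
    (h : ∀ n, f n ≤ g n) : Negligible f :=
  Asymptotics.SuperpolynomialDecay.trans_abs_le hg fun n => by
    rw [abs_of_nonneg (h0 n)]
    exact (h n).trans (le_abs_self _)

/-! ### Checking forgeries -/

/-- The recorded calls are those of the transcript. -/
def Records {K : Type} (rec : K → Bits (Option C)) (t : Transcript C D) : Prop :=
  ∀ m, m ∈ t.map Prod.fst ↔ ∃ k, rec k = callCode m

theorem callCode_injective : Function.Injective (callCode : Bits C → Bits (Option C)) :=
  fun _ _ h => funext fun c => congrFun h (some c)

theorem Records.nil {K : Type} : Records (D := D) (fun (_ : K) (_ : Option C) => false) [] := by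
  intro m
  simp only [List.map_nil, List.not_mem_nil, false_iff, not_exists]
  intro k h
  exact absurd (congrFun h none) (by simp [callCode])

theorem Records.update {K : Type} [DecidableEq K] {rec : K → Bits (Option C)}
    {t : Transcript C D} (h : Records rec t) {k : K} (hk : rec k = fun _ => false) (v : Bits C)
    (y : Bits D) : Records (Function.update rec k (callCode v)) (t ++ [(v, y)]) := by
  intro m
  simp only [List.map_append, List.map_cons, List.map_nil, List.mem_append, List.mem_singleton,
    h m]
  constructor
  · rintro (⟨j, hj⟩ | rfl)
    · refine ⟨j, ?_⟩
      rw [Function.update_of_ne, hj]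
      rintro rfl
      rw [hk] at hj
      exact absurd (congrFun hj none) (by simp [callCode])
    · exact ⟨k, Function.update_self _ _ _⟩
  · rintro ⟨j, hj⟩
    by_cases hjk : j = k
    · subst hjk
      rw [Function.update_self] at hj
      exact .inr (callCode_injective hj).symm
    · rw [Function.update_of_ne hjk] at hj
      exact .inl ⟨j, hj⟩

theorem respond_track [Fintype R] (step : St → Bits C → R → Option (Bits D × St))
    (t : Transcript C D) (st : St) (v : Bits C) (κ : Bits D → Transcript C D × St → ℝ) :
    respond (track step) (t, st) v κ =
      respond step st v fun y st' => κ y (t ++ [(v, y)], st') := by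
  refine Finset.expect_congr rfl fun r _ => ?_
  simp only [track]
  rcases step st v r with - | ⟨y, st'⟩ <;> rfl

section check
variable [Fintype J] [DecidableEq J] [Fintype O] [DecidableEq O] [Fintype A] [DecidableEq A]
  [Fintype B] [DecidableEq B] [Fintype C] [DecidableEq C] [Fintype D] [DecidableEq D]

/-- `Q` with its own oracle and party, followed by a check `fin` of its output, which sees the
calls of `Q`. -/
def checkAssembly (Q : QAlg J O A B C D)
    (fin : CAlg ((Fin (Q.prog.length + 1) × Option C) ⊕ (O ⊕ J)) O' A B C D) :
    Assembly J J O O' J A B C D A B C D where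
  Q := Q
  start := wires (Sum.elim .inl .inl)
  rand := queryCircuit
  sgn _ := callCircuit
  fin := fin

theorem prob_checkAssembly [Fintype R] (Q : QAlg J O A B C D)
    (fin : CAlg ((Fin (Q.prog.length + 1) × Option C) ⊕ (O ⊕ J)) O' A B C D)
    (f : Bits A → Bits B) (step : St → Bits C → R → Option (Bits D × St)) (st : St)
    (acc : St → Bits O' → Bool) (x : Bits J) (val : Transcript C D → St → Bits O → ℝ)
    (hfin : ∀ t st rec a, Records rec t →
      fin.cval f step st (Sum.elim (fun c => rec c.1 c.2) (Sum.elim a x))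
        (fun o st' => ind (acc st' o)) = val t st a) :
    (checkAssembly Q fin).circuit.prob f step st acc x =
      qexpect f (track step) (fun s w => val s.1 s.2 (w ∘ Q.out)) Q.prog ([], st)
        fun w => if w = Q.start x then 1 else 0 := by
  rw [Assembly.prob_circuit, ← qval_respond]
  refine (cval_wires (Sum.elim .inl .inl : J ⊕ J → J ⊕ Bool) f step st x _).trans ?_
  have h1 : ∀ q : Bits A, queryCircuit.eval f (Sum.elim q x) = f q :=
    fun q => eval_queryCircuit f q x
  change qval (fun q => queryCircuit.eval f (Sum.elim q x)) _ _ Q.prog _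
    (fun w => if w = Q.start x then 1 else 0) = _
  simp only [h1]
  refine qval_eq_qval (St := St × (Fin (Q.prog.length + 1) → Bits (Option C)))
    (St' := Transcript C D × St) f (Rel := fun k s s' => s.1 = s'.2 ∧ Records s.2 s'.1 ∧
    k ≤ Q.prog.length ∧ ∀ j < k, s.2 ((checkAssembly Q fin).pos j) = fun _ => false)
    ?_ ?_ ?_ Q.prog _ _ ⟨rfl, Records.nil, le_rfl, fun _ _ => rfl⟩ _
  · rintro k s s' ⟨h1, h2, h3, h4⟩
    exact ⟨h1, h2, by omega, fun j hj => h4 j (by omega)⟩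
  · rintro k ⟨s, rec⟩ ⟨t, s'⟩ v κ κ' ⟨rfl, h2, h3, h4⟩ hκ
    rw [respond_track]
    refine (cval_callCircuit f step s v x _).trans ?_
    congr 1
    funext y st'
    refine hκ _ _ _ ⟨rfl, h2.update (h4 k (by omega)) v y, by omega, fun j hj => ?_⟩
    exact (Function.update_of_ne ((checkAssembly Q fin).pos_ne hj ((Nat.le_succ k).trans h3))
      _ _).trans (h4 j (by omega))
  · rintro ⟨s, rec⟩ ⟨t, s'⟩ w ⟨rfl, h2, -, -⟩
    exact hfin t s rec _ h2

theorem calls_checkAssembly_le (Q : QAlg J O A B C D)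
    (fin : CAlg ((Fin (Q.prog.length + 1) × Option C) ⊕ (O ⊕ J)) O' A B C D)
    (hfin : fin.calls = 0) : (checkAssembly Q fin).circuit.calls ≤ Q.calls := by
  have h := (checkAssembly Q fin).calls_circuit_le (c := 1) fun k => calls_callCircuit.le
  have h1 : (checkAssembly Q fin).start.calls = 0 := calls_wires _
  have h2 : (checkAssembly Q fin).fin.calls = 0 := hfin
  have h3 : (checkAssembly Q fin).Q.calls = Q.calls := rfl
  omega

theorem size_checkAssembly_le {s : ℕ} (Q : QAlg J O A B C D)
    (fin : CAlg ((Fin (Q.prog.length + 1) × Option C) ⊕ (O ⊕ J)) O' A B C D)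
    (hQ : Q.size ≤ s) (hfin : fin.size ≤ s) (hJ : 5 * Fintype.card J ≤ s)
    (hAB : 1 + (Fintype.card A + Fintype.card J + Fintype.card B) ≤ s)
    (hCD : 1 + (Fintype.card C + Fintype.card J + Fintype.card D) ≤ s) :
    (checkAssembly Q fin).circuit.size ≤ 11 * (s + 1) ^ 2 := by
  refine (checkAssembly Q fin).size_circuit_le hQ ?_ ?_ (fun k => ?_) hfin
  · refine (size_wires_le _).trans ?_
    rw [Fintype.card_sum]
    omega
  · exact size_queryCircuit.trans_le hAB
  · exact size_callCircuit.trans_le hCD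

end check

/-- The message `m` is not among the recorded calls. -/
def freshCheck {K : Type} [Fintype K] [Fintype C] (rec : K → Bits (Option C)) (m : Bits C) :
    Bool :=
  (Finset.univ.toList : List K).all fun k =>
    !(rec k none && (Finset.univ.toList : List C).all fun c => !(xor (rec k (some c)) (m c)))

theorem Records.freshCheck_eq {K : Type} [Fintype K] [Fintype C] [DecidableEq C]
    {rec : K → Bits (Option C)} {t : Transcript C D} (h : Records rec t) (m : Bits C) :
    freshCheck rec m = decide (m ∉ t.map Prod.fst) := by
  rw [Bool.eq_iff_iff, decide_eq_true_iff, h m, freshCheck, List.all_eq_true, not_exists]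
  refine ⟨fun hk k hkm => ?_, fun hk k _ => ?_⟩
  · have := hk k (by simp)
    simp [hkm, callCode] at this
  · by_contra hcon
    refine hk k (funext fun c => ?_)
    simp only [Bool.not_eq_true', Bool.and_eq_false_iff, not_or, Bool.not_eq_false,
      List.all_eq_true, Finset.mem_toList, Finset.mem_univ, true_imp_iff] at hcon
    rcases c with - | c
    · exact hcon.1
    · have := hcon.2 c
      simpa [callCode] using this

namespace Computes

theorem of_fresh {K : Type} [Fintype K] [Fintype C] [Fintype I] [DecidableEq I] {M : ℕ}
    (rk : K → Option C → I) (mk : C → I) (hK : Fintype.card K ≤ M) (hC : Fintype.card C ≤ M)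
    (hI : Fintype.card I ≤ M) :
    Computes (100 * (M + 1) ^ 3) fun (_ : Bits A → Bits B) (x : Bits I) (_ : Unit) =>
      freshCheck (fun k c => x (rk k c)) fun c => x (mk c) := by
  have h1 : ∀ k c, Computes (A := A) (B := B) (M + 4) fun _ (x : Bits I) (_ : Unit) =>
      !(xor (x (rk k (some c))) (x (mk c))) := fun k c => by
    have := of_layer (A := A) (B := B)
      (fun _ : Unit => [Term.one, Term.lin (rk k (some c)), Term.lin (mk c)]) (n := 3) (by simp)
    refine (this.mono ?_).imp fun c hc => ⟨hc.1, fun f x => ?_⟩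
    · simp only [Fintype.card_unit]
      omega
    · rw [hc.2]
      simp [Term.eval]
  have h2 : ∀ k, Computes (A := A) (B := B) (M + 4) fun _ (x : Bits I) (_ : Unit) =>
      x (rk k none) := fun k => by
    have := of_layer (A := A) (B := B) (fun _ : Unit => [Term.lin (rk k none)]) (n := 1) (by simp)
    refine (this.mono ?_).imp fun c hc => ⟨hc.1, fun f x => ?_⟩
    · simp only [Fintype.card_unit]
      omega
    · rw [hc.2]
      simp [Term.eval]
  refine (all (fun k => ((h2 k).and (all (h1 k) Finset.univ.toList)).not)
    Finset.univ.toList).mono ?_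
  simp only [Finset.length_toList, Finset.card_univ]
  calc
    _ ≤ M * (M + 4 + (M * (M + 4 + 3 * M + 8) + (M + 2)) + 3 * M + 8 + 8 + 3 * M + 8) +
        (M + 2) := by
      gcongr
    _ = 4 * M ^ 3 + 20 * M ^ 2 + 31 * M + 2 := by ring
    _ ≤ 100 * (M + 1) ^ 3 := by nlinarith [sq_nonneg M, pow_nonneg (Nat.zero_le M) 3]

/-- A function that is computed without calls, as an algorithm that may make calls. -/
theorem exists_calg [Fintype O] [DecidableEq O] {s : ℕ}
    {g : (Bits A → Bits B) → Bits I → Bits O} (h : Computes s g) :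
    ∃ c : CAlg I O A B C D, c.size ≤ s + 6 * Fintype.card O ∧ c.calls = 0 ∧
      ∀ {R St : Type} [Fintype R] (f : Bits A → Bits B)
        (step : St → Bits C → R → Option (Bits D × St)) (st : St) (x : Bits I)
        (κ : Bits O → St → ℝ), c.cval f step st x κ = κ (g f x) st := by
  obtain ⟨c, hc, h⟩ := h
  refine ⟨c.comp (wires .inl), ?_, ?_, fun f step st x κ => ?_⟩
  · have h1 := c.size_comp_le (wires .inl : CAlg O O A B C D)
    have h2 := size_wires_le (A := A) (B := B) (C := C) (D := D) (.inl : O → O ⊕ Bool)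
    omega
  · rw [Circuit.calls_comp, calls_wires]
  · rw [Circuit.cval_comp, cval_wires, h]
    rfl

end Computes

/-! ### The forger with verification -/

section forger
variable (S : SignatureScheme) (n : ℕ)

/-- A forger, followed by the verification of its forgery, is a distinguisher for signers. -/
theorem exists_signDistinguisher (Q : S.QForger n) {s : ℕ} (hQ : Q.size ≤ s)
    (hV : (S.verify n).size ≤ s) (hin : S.inLen n ≤ s) (hout : S.outLen n ≤ s)
    (hpk : S.pkLen n ≤ s) (hmsg : S.msgLen n ≤ s) (hsig : S.sigLen n ≤ s) :
    ∃ d : S.SignDistinguisher n, d.size ≤ 10 ^ 12 * (s + 1) ^ 12 ∧ d.calls ≤ Q.calls ∧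
      ∀ {R St : Type} [Fintype R] (f : S.Oracle n)
        (step : St → S.Msg n → R → Option (S.Sig n × St)) (st : St) (pk : S.PK n),
        d.prob f step st (fun _ y => y ()) pk =
          qexpect f (track step) (fun st' w => ind (S.validForgery n f pk (st'.1.map Prod.fst)
            ((w ∘ Q.out) ∘ Sum.inl) ((w ∘ Q.out) ∘ Sum.inr))) Q.prog ([], st)
            fun w => if w = Q.start pk then 1 else 0 := by
  let I := (Fin (Q.prog.length + 1) × Option (Fin (S.msgLen n))) ⊕
    ((Fin (S.msgLen n) ⊕ Fin (S.sigLen n)) ⊕ Fin (S.pkLen n))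
  have hIcard : Fintype.card I ≤ 4 * (s + 1) ^ 2 := by
    have hlen : Q.prog.length ≤ s := by
      have := hQ
      simp only [Circuit.size] at this
      omega
    simp only [I, Fintype.card_sum, Fintype.card_prod, Fintype.card_fin, Fintype.card_option]
    calc
      _ ≤ (s + 1) * (s + 1) + (s + s + s) := by gcongr
      _ ≤ 4 * (s + 1) ^ 2 := by nlinarith
  have hlen : Q.prog.length ≤ s := by
    have := hQ
    simp only [Circuit.size] at this
    omega
  have hs4 : s + 1 ≤ 4 * (s + 1) ^ 2 := by nlinarith
  have h1 := Computes.of_wires (A := Fin (S.inLen n)) (B := Fin (S.outLen n)) (I := I)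
    (Sum.elim (fun i => .inl (.inr (.inr i))) (Sum.elim (fun i => .inl (.inr (.inl (.inl i))))
      fun i => .inl (.inr (.inl (.inr i)))) :
      Fin (S.pkLen n) ⊕ Fin (S.msgLen n) ⊕ Fin (S.sigLen n) → I ⊕ Bool)
  have h2 : Computes (s) (fun (f : S.Oracle n) x (_ : Unit) => (S.verify n).eval f x ()) :=
    ⟨S.verify n, hV, fun f x => rfl⟩
  have h3 := Computes.of_fresh (A := Fin (S.inLen n)) (B := Fin (S.outLen n)) (I := I)
    (M := 4 * (s + 1) ^ 2) (fun k c => .inl (k, c)) (fun c => .inr (.inl (.inl c)))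
    (by rw [Fintype.card_fin]; omega) (by rw [Fintype.card_fin]; omega) hIcard
  obtain ⟨fin, hsize, hcalls, hfin⟩ := ((h1.comp h2).and h3).exists_calg
    (C := Fin (S.msgLen n)) (D := Fin (S.sigLen n))
  refine ⟨(checkAssembly Q fin).circuit, ?_, calls_checkAssembly_le Q fin hcalls,
    fun f step st pk => ?_⟩
  · have ht : s + 1 ≤ (s + 1) ^ 6 := Nat.le_self_pow (by norm_num) _
    have ht2 : (s + 1) ^ 2 ≤ (s + 1) ^ 6 := Nat.pow_le_pow_right (by omega) (by norm_num)
    refine (size_checkAssembly_le (s := 30000 * (s + 1) ^ 6) Q fin ?_ (hsize.trans ?_) ?_ ?_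
      ?_).trans ?_
    · omega
    · have h5 : 100 * (4 * (s + 1) ^ 2 + 1) ^ 3 ≤ 12500 * (s + 1) ^ 6 := by
        calc
          _ ≤ 100 * (5 * (s + 1) ^ 2) ^ 3 := by gcongr; nlinarith
          _ = _ := by ring
      simp only [Fintype.card_sum, Fintype.card_fin, Fintype.card_unit] at hIcard ⊢
      omega
    · rw [Fintype.card_fin]; omega
    · simp only [Fintype.card_fin]; omega
    · simp only [Fintype.card_fin]; omega
    · calc
        _ ≤ 11 * (30000 * (s + 1) ^ 6 + (s + 1) ^ 6) ^ 2 := by gcongr; omega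
        _ = 9900660011 * (s + 1) ^ 12 := by ring
        _ ≤ 10 ^ 12 * (s + 1) ^ 12 := by gcongr; norm_num
  · refine prob_checkAssembly Q fin f step st _ pk (fun t _ a => ind (S.validForgery n f pk
      (t.map Prod.fst) (a ∘ Sum.inl) (a ∘ Sum.inr))) fun t st rec a ht => ?_
    rw [hfin]
    have hx : (fun o => Sum.elim (Sum.elim (fun c => rec c.1 c.2) (Sum.elim a pk)) id
        ((Sum.elim (fun i => .inl (.inr (.inr i))) (Sum.elim (fun i => .inl (.inr (.inl (.inl i))))
      fun i => .inl (.inr (.inl (.inr i)))) :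
      Fin (S.pkLen n) ⊕ Fin (S.msgLen n) ⊕ Fin (S.sigLen n) → I ⊕ Bool) o)) =
        Sum.elim pk (Sum.elim (a ∘ Sum.inl) (a ∘ Sum.inr)) := by
      funext o
      rcases o with o | o | o <;> rfl
    rw [hx]
    congr 1
    rw [SignatureScheme.validForgery, SignatureScheme.verifies, ← ht.freshCheck_eq]
    rfl

end forger

end

/-! ### Hardwiring keys and coins -/

section

variable {I J O O' Z W A B C D A' B' C' D' R St : Type}

theorem Assembly.val_pos (T : Assembly I J O O' Z A B C D A' B' C' D') {k : ℕ}
    (hk : k ≤ T.Q.prog.length) : (T.pos k : ℕ) = k :=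
  Nat.mod_eq_of_lt (Nat.lt_succ_of_le hk)

/-- An oracle of an algorithm can be replaced by a circuit. -/
theorem exists_replaceOracle [Fintype I] [DecidableEq I] [Fintype O] [DecidableEq O] [Fintype A]
    [DecidableEq A] [Fintype B] [DecidableEq B] [Fintype C] [DecidableEq C] [Fintype D]
    [DecidableEq D] (Q : QAlg I O A B C D) {g : Bits A → Bits B} {s : ℕ} (hQ : Q.size ≤ s)
    (hg : Computes (A := Empty) (B := Empty) s fun _ => g) (hA : Fintype.card A ≤ s)
    (hI : Fintype.card I ≤ s) (hO : Fintype.card O ≤ s) (hC : Fintype.card C ≤ s)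
    (hD : Fintype.card D ≤ s) :
    ∃ c : QAlg I O Empty Empty C D, c.size ≤ 396 * (s + 1) ^ 4 ∧
      ∀ {R St : Type} [Fintype R] (f : Bits Empty → Bits Empty)
        (step : St → Bits C → R → Option (Bits D × St)) (st : St) (acc : St → Bits O → Bool)
        (x : Bits I), c.prob f step st acc x = Q.prob g step st acc x := by
  obtain ⟨c, hc, hcg⟩ := hg
  let T : Assembly I I O O Empty A B C D Empty Empty C D :=
    { Q := Q
      start := wires (Sum.elim .inl Empty.elim)
      rand := (wires (fun a => .inl (.inl a))).comp c
      sgn := fun _ => callCircuit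
      fin := wires (fun o => .inl (.inr (.inl o))) }
  refine ⟨T.circuit, ?_, @fun R St _ f step st acc x => ?_⟩
  · have hlen : Q.prog.length + 1 ≤ s + 1 := by
      have := hQ
      simp only [Circuit.size] at this
      omega
    refine (T.size_circuit_le (s := 5 * (s + 1) ^ 2) ?_ ?_ ?_ (fun k => ?_) ?_).trans ?_
    · nlinarith
    · refine (size_wires_le _).trans ?_
      simp only [Fintype.card_sum, Fintype.card_empty]
      nlinarith
    · refine (Circuit.size_comp_le _ _).trans ((add_le_add_left (size_wires_le _) _).trans ?_)
      simp only [Fintype.card_sum, Fintype.card_empty]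
      nlinarith
    · refine size_callCircuit.trans_le ?_
      simp only [Fintype.card_empty]
      nlinarith
    · refine (size_wires_le _).trans ?_
      simp only [Fintype.card_sum, Fintype.card_empty, Fintype.card_prod, Fintype.card_option,
        Fintype.card_fin]
      have : (T.Q.prog.length + 1) * (Fintype.card C + 1) ≤ (s + 1) * (s + 1) := by
        gcongr
      nlinarith
    · calc
        _ ≤ 11 * (5 * (s + 1) ^ 2 + (s + 1) ^ 2) ^ 2 := by gcongr; nlinarith
        _ = _ := by ring
  · rw [Assembly.prob_circuit, Circuit.prob, ← qval_respond]
    refine (cval_wires (Sum.elim .inl Empty.elim : I ⊕ Empty → I ⊕ Bool) f step st x _).trans ?_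
    have h1 : ∀ (q : Bits A) (z : Bits Empty), T.rand.eval f (Sum.elim q z) = g q := fun q z => by
      refine (Circuit.eval_comp _ c f _).trans ?_
      rw [eval_wires, hcg]
      rfl
    simp only [h1]
    refine qval_eq_qval (C := C) (D := D) (St := St × (T.Pos → Bits (Option C))) (St' := St) g
      (Rel := fun _ s s' => s.1 = s') ?_ ?_ ?_ Q.prog _ _ rfl _
    · exact fun _ _ _ h => h
    · rintro k s s' v κ κ' rfl hκ
      refine (cval_callCircuit f step s.1 v _ _).trans ?_
      congr 1
      funext y st'
      exact hκ _ _ _ rfl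
    · rintro s s' w rfl
      exact cval_wires (fun o => .inl (.inr (.inl o)) :
        O → ((Fin (Q.prog.length + 1) × Option C) ⊕ (O ⊕ Empty)) ⊕ Bool) f step s.1 _ _

/-- A distinguisher for signers, as a distinguisher for oracles that signs by itself with the key
`sk`: the coins of the signer are fixed so that a weighted sum of acceptance probabilities, for
oracles `f ω`, does not decrease. -/
theorem exists_distinguisher (S : SignatureScheme) (n : ℕ) (d : S.SignDistinguisher n) {s : ℕ}
    (hd : d.size ≤ s) (hS : (S.sign n).size ≤ s) (hin : S.inLen n ≤ s) (hout : S.outLen n ≤ s)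
    (hpk : S.pkLen n ≤ s) (hmsg : S.msgLen n ≤ s) (pk : S.PK n) (sk : S.SK n) {Ω : Type}
    [Fintype Ω] (c : Ω → ℝ) (f : Ω → S.Oracle n) :
    ∃ d' : Distinguisher (S.inLen n) (S.outLen n), d'.size ≤ 396 * (s + 1) ^ 4 ∧
      ∑ ω, c ω * d.prob (f ω) (fun (_ : Unit) m ρ => some (S.signWith n (f ω) sk m ρ, ())) ()
          (fun _ y => y ()) pk ≤
        ∑ ω, c ω * acceptProb d' (f ω) := by
  obtain ⟨ρ, hρ⟩ := exists_coins c f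
    (fun ω (_ : Unit) m ρ => some (S.signWith n (f ω) sk m ρ, ()))
    (fun _ _ w => ind ((w ∘ d.out) ())) d.prog (fun _ => ())
    (fun _ w => if w = d.start pk then 1 else 0)
  let T : Assembly Empty (Fin (S.pkLen n)) Unit Unit Empty (Fin (S.inLen n)) (Fin (S.outLen n))
      (Fin (S.msgLen n)) (Fin (S.sigLen n)) (Fin (S.inLen n)) (Fin (S.outLen n)) Empty Empty :=
    { Q := d
      start := wires (Sum.elim (fun i => .inr (pk i)) Empty.elim)
      rand := queryCircuit
      sgn := fun k => (wires (Sum.elim (fun i => .inr (sk i))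
        (Sum.elim (fun i => .inl (.inl i)) fun i => .inr (ρ k i)))).comp (S.sign n)
      fin := wires (fun o => .inl (.inr (.inl o))) }
  refine ⟨T.circuit, ?_, hρ.trans_eq (Finset.sum_congr rfl fun ω _ => congrArg (c ω * ·) ?_)⟩
  · have hlen : d.prog.length + 1 ≤ s + 1 := by
      have := hd
      simp only [Circuit.size] at this
      omega
    refine (T.size_circuit_le (s := 5 * (s + 1) ^ 2) ?_ ?_ ?_ (fun k => ?_) ?_).trans ?_
    · nlinarith
    · refine (size_wires_le _).trans ?_
      simp only [Fintype.card_sum, Fintype.card_empty, Fintype.card_fin]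
      nlinarith
    · refine size_queryCircuit.trans_le ?_
      simp only [Fintype.card_empty, Fintype.card_fin]
      nlinarith
    · refine (Circuit.size_comp_le _ _).trans ((add_le_add_left (size_wires_le _) _).trans ?_)
      have := (S.sign n).card_inp_le
      have h : (S.sign n).prog.length + Fintype.card (S.sign n).W ≤ s := hS
      simp only [Fintype.card_sum, Fintype.card_empty, Fintype.card_fin] at this ⊢
      nlinarith
    · refine (size_wires_le _).trans ?_
      simp only [Fintype.card_sum, Fintype.card_empty, Fintype.card_prod, Fintype.card_option,
        Fintype.card_fin, Fintype.card_unit]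
      have : (T.Q.prog.length + 1) * (S.msgLen n + 1) ≤ (s + 1) * (s + 1) := by
        gcongr
      nlinarith
    · calc
        _ ≤ 11 * (5 * (s + 1) ^ 2 + (s + 1) ^ 2) ^ 2 := by gcongr; nlinarith
        _ = _ := by ring
  · symm
    rw [acceptProb]
    refine (Assembly.prob_circuit T (f ω) _ _ _ _).trans ?_
    refine (cval_wires (Sum.elim (fun i => .inr (pk i)) Empty.elim :
      Fin (S.pkLen n) ⊕ Empty → Empty ⊕ Bool) (f ω) _ () _ _).trans ?_
    have h1 : ∀ (q : BitStr (S.inLen n)) (z : Bits Empty),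
        T.rand.eval (f ω) (Sum.elim q z) = f ω q :=
      fun q z => eval_queryCircuit (f ω) q z
    simp only [h1]
    refine qval_eq_qval (C := Fin (S.msgLen n)) (D := Fin (S.sigLen n))
      (St := Unit × (T.Pos → Bits (Option (Fin (S.msgLen n))))) (St' := Unit) (f ω)
      (Rel := fun k _ _ => k ≤ d.prog.length) ?_ ?_ ?_ d.prog _ _ le_rfl _
    · intros; omega
    · rintro k s s' v κ κ' hk hκ
      rw [respond_some _ _ _ (S.signWith n (f ω) sk v (ρ k), ()) _ fun _ => rfl]
      refine (Circuit.cval_comp _ (S.sign n) (f ω) _ _ _ _).trans ?_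
      refine (Circuit.cval_empty (S.sign n) (f ω) _ _ _).trans ?_
      rw [eval_wires]
      refine (hκ _ _ () (by omega)).trans (congrArg (κ' · ()) ?_)
      have hk' : (T.pos k : ℕ) = k := T.val_pos ((Nat.le_succ k).trans hk)
      rw [SignatureScheme.signWith, hk']
      refine congrArg ((S.sign n).eval (f ω)) (funext fun o => ?_)
      rcases o with o | o | o <;> rfl
    · rintro s s' w -
      exact cval_wires (fun o => .inl (.inr (.inl o)) : Unit → ((Fin (d.prog.length + 1) ×
        Option (Fin (S.msgLen n))) ⊕ (Unit ⊕ Empty)) ⊕ Bool) (f ω) _ s.1 _ _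

section qexpect
variable [Fintype W] [DecidableEq W] [Fintype C] [DecidableEq C] [Fintype R] (f : Bits A → Bits B)

/-- A record of the calls that is not used does not matter. -/
theorem qexpect_track (step : St → Bits C → R → Option (Bits D × St)) (val : St → Bits W → ℝ)
    (p : List (Instr (QGate W) W A B C D)) (t : Transcript C D) (st : St) (ψ : Bits W → ℂ) :
    qexpect f (track step) (fun s => val s.2) p (t, st) ψ = qexpect f step val p st ψ := by
  rw [← qval_respond, ← qval_respond]
  refine qval_eq_qval (St := Transcript C D × St) (St' := St) f (Rel := fun _ s s' => s.2 = s')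
    ?_ ?_ ?_ p _ _ rfl ψ
  · exact fun _ _ _ h => h
  · rintro k ⟨t, s⟩ s' v κ κ' rfl hκ
    rw [respond_track]
    congr 1
    funext y st'
    exact hκ _ _ _ rfl
  · rintro s s' w rfl
    rfl

theorem qexpect_expect {ι : Type} [Fintype ι] (step : St → Bits C → R → Option (Bits D × St))
    (val : ι → St → Bits W → ℝ) (p : List (Instr (QGate W) W A B C D)) (st : St)
    (ψ : Bits W → ℂ) :
    qexpect f step (fun s w => 𝔼 i, val i s w) p st ψ = 𝔼 i, qexpect f step (val i) p st ψ := by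
  induction p generalizing st ψ with
  | nil =>
    simp only [qexpect]
    rw [Finset.expect_sum_comm]
    exact Finset.sum_congr rfl fun w _ => Finset.mul_expect _ _ _
  | cons s p ih =>
    cases s with
    | gate g => exact ih _ _
    | query i o _ => exact ih _ _
    | call i o _ =>
      simp only [qexpect]
      rw [Finset.expect_sum_comm]
      refine Finset.sum_congr rfl fun v _ => ?_
      rw [Finset.expect_comm]
      refine Finset.expect_congr rfl fun r _ => ?_
      rcases step st v r with - | ⟨y, st'⟩
      · exact (Finset.expect_const_zero _).symm
      · exact ih _ _

/-- A party that does not abort leads to a larger expected value of a nonnegative function. -/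
theorem qexpect_le_of_no_abort {step step' : St → Bits C → R → Option (Bits D × St)}
    (h : ∀ st v r, step st v r = none ∨ step st v r = step' st v r) {val : St → Bits W → ℝ}
    (hval : ∀ st w, 0 ≤ val st w) (p : List (Instr (QGate W) W A B C D)) (st : St)
    (ψ : Bits W → ℂ) : qexpect f step val p st ψ ≤ qexpect f step' val p st ψ := by
  induction p generalizing st ψ with
  | nil => exact le_rfl
  | cons s p ih =>
    cases s with
    | gate g => exact ih _ _
    | query i o _ => exact ih _ _
    | call i o _ =>
      refine Finset.sum_le_sum fun v _ => Finset.expect_le_expect fun r _ => ?_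
      rcases h st v r with hr | hr
      · rw [hr]
        rcases step' st v r with - | ⟨y, st'⟩
        · exact le_rfl
        · exact qexpect_nonneg f step' hval _ _ _
      · rw [hr]
        rcases step' st v r with - | ⟨y, st'⟩
        · exact le_rfl
        · exact ih _ _

end qexpect

/-! ### The reduction as an adversary -/

section reduction
variable {S : SignatureScheme} {P : Problem} (R : Reduction S P) (n : ℕ)

/-- Probability that FINISH wins the game of `P` with the output of the quantum forger `Q`. -/
def quantumWinProb (Q : S.QForger n) : ℝ :=
  𝔼 s, 𝔼 r, 𝔼 Oc, qexpect (R.simOracle n Oc (R.startZ n s r))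
    (R.signStep n s Oc (R.startZ n s r))
    (fun h w => 𝔼 ρ, ind (R.finishWins n s Oc (R.startZ n s r) h ((w ∘ Q.out) ∘ Sum.inl)
      ((w ∘ Q.out) ∘ Sum.inr) ρ))
    Q.prog (R.startRun n s r).2 fun w => if w = Q.start (R.startPK n s r) then 1 else 0

/-- The challenger of `P` with coins `s`, who keeps the transcript. -/
def challenger (P : Problem) (n : ℕ) (s : BitStr (P.coinLen n))
    (h : Transcript (Fin (P.qLen n)) (Fin (P.aLen n))) (v : BitStr (P.qLen n)) (_ : Unit) :
    Option (BitStr (P.aLen n) × Transcript (Fin (P.qLen n)) (Fin (P.aLen n))) :=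
  some (P.ans n s h v, h ++ [(v, P.ans n s h v)])

/-- START with fixed coins. -/
def startCircuit (r₀ : BitStr (R.startCoins n)) : CAlg (Fin (P.xLen n))
    (Fin (S.pkLen n) ⊕ Fin (R.zLen n)) (Fin (R.cInLen n)) (Fin (R.cOutLen n)) (Fin (P.qLen n))
    (Fin (P.aLen n)) :=
  ((wires (Sum.elim .inl fun i => .inr (r₀ i))).comp (R.startAlg n)).dropQueries

theorem cval_startCircuit (r₀ : BitStr (R.startCoins n)) (Oc : R.COracle n)
    (s : BitStr (P.coinLen n))
    (κ : Bits (Fin (S.pkLen n) ⊕ Fin (R.zLen n)) →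
      Transcript (Fin (P.qLen n)) (Fin (P.aLen n)) → ℝ) :
    (startCircuit R n r₀).cval Oc (challenger P n s) [] (P.inst n s) κ =
      κ (R.startRun n s r₀).1 (R.startRun n s r₀).2 := by
  refine (Circuit.cval_dropQueries _ Oc _ _ _ _).trans ((Circuit.cval_comp _ (R.startAlg n) id
    _ _ _ _).trans ((Circuit.cval_eq_run (R.startAlg n) id (P.ans n s) [] _ _).trans ?_))
  rw [eval_wires]
  have hx : (fun o => Sum.elim (P.inst n s) id ((Sum.elim .inl fun i => .inr (r₀ i) :
      Fin (P.xLen n) ⊕ Fin (R.startCoins n) → Fin (P.xLen n) ⊕ Bool) o)) =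
      Sum.elim (P.inst n s) r₀ := by
    funext o
    rcases o with o | o <;> rfl
  rw [hx]
  rfl

theorem size_startCircuit_le (r₀ : BitStr (R.startCoins n)) :
    (startCircuit R n r₀).size ≤ 5 * (R.startAlg n).size := by
  refine (Circuit.size_dropQueries_le _).trans ((Circuit.size_comp_le _ _).trans
    ((add_le_add_left (size_wires_le _) _).trans ?_))
  have := (R.startAlg n).card_inp_le
  have h : (R.startAlg n).prog.length + Fintype.card (R.startAlg n).W = (R.startAlg n).size := rfl
  simp only [Fintype.card_sum] at this ⊢
  omega

/-- SIGN with fixed coins, without the abort flag. -/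
def signCircuit (r : BitStr (R.signCoins n)) : CAlg (Fin (S.msgLen n) ⊕ Fin (R.zLen n))
    (Fin (S.sigLen n)) (Fin (R.cInLen n)) (Fin (R.cOutLen n)) (Fin (P.qLen n)) (Fin (P.aLen n)) :=
  ((wires (Sum.elim (fun i => .inl (.inl i)) (Sum.elim (fun i => .inl (.inr i))
    fun i => .inr (r i)))).comp (R.signAlg n)).reout some

/-- One signature query answered by SIGN, ignoring the abort flag. -/
def signStepNoAbort (s : BitStr (P.coinLen n)) (Oc : R.COracle n) (z : R.Z n)
    (h : Transcript (Fin (P.qLen n)) (Fin (P.aLen n))) (m : S.Msg n)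
    (r : BitStr (R.signCoins n)) :
    Option (S.Sig n × Transcript (Fin (P.qLen n)) (Fin (P.aLen n))) :=
  let y := (R.signAlg n).run Oc (P.ans n s) h (Sum.elim m (Sum.elim z r))
  some (y.1 ∘ some, y.2)

theorem cval_signCircuit (r : BitStr (R.signCoins n)) (Oc : R.COracle n)
    (s : BitStr (P.coinLen n)) (h : Transcript (Fin (P.qLen n)) (Fin (P.aLen n))) (m : S.Msg n)
    (z : R.Z n) (κ : S.Sig n → Transcript (Fin (P.qLen n)) (Fin (P.aLen n)) → ℝ) :
    (signCircuit R n r).cval Oc (challenger P n s) h (Sum.elim m z) κ =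
      respond (fun h m (_ : Unit) => signStepNoAbort R n s Oc z h m r) h m κ := by
  refine Eq.trans ?_ (respond_some (fun h m (_ : Unit) => signStepNoAbort R n s Oc z h m r) h m
    (((R.signAlg n).run Oc (P.ans n s) h (Sum.elim m (Sum.elim z r))).1 ∘ some,
      ((R.signAlg n).run Oc (P.ans n s) h (Sum.elim m (Sum.elim z r))).2) κ fun _ => rfl).symm
  change ((wires (Sum.elim (fun i => .inl (.inl i)) (Sum.elim (fun i => .inl (.inr i))
    fun i => .inr (r i)))).comp (R.signAlg n)).cval Oc (challenger P n s) h (Sum.elim m z)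
      (fun y h' => κ (y ∘ some) h') = _
  refine (Circuit.cval_comp _ (R.signAlg n) Oc _ _ _ _).trans
    ((Circuit.cval_eq_run (R.signAlg n) Oc (P.ans n s) _ _ _).trans ?_)
  rw [eval_wires]
  have hx : (fun o => Sum.elim (Sum.elim m z) id ((Sum.elim (fun i => .inl (.inl i))
      (Sum.elim (fun i => .inl (.inr i)) fun i => .inr (r i)) :
      Fin (S.msgLen n) ⊕ Fin (R.zLen n) ⊕ Fin (R.signCoins n) →
        (Fin (S.msgLen n) ⊕ Fin (R.zLen n)) ⊕ Bool) o)) = Sum.elim m (Sum.elim z r) := by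
    funext o
    rcases o with o | o | o <;> rfl
  rw [hx]

theorem size_signCircuit_le (r : BitStr (R.signCoins n)) :
    (signCircuit R n r).size ≤ 5 * (R.signAlg n).size := by
  refine (Circuit.size_comp_le _ _).trans ((add_le_add_left (size_wires_le _) _).trans ?_)
  have := (R.signAlg n).card_inp_le
  have h : (R.signAlg n).prog.length + Fintype.card (R.signAlg n).W = (R.signAlg n).size := rfl
  simp only [Fintype.card_sum] at this ⊢
  omega

/-- FINISH with fixed coins, which ignores the input bits `I`. -/
def finishCircuit [Fintype I] [DecidableEq I] (r₁ : BitStr (R.finishCoins n)) :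
    CAlg (I ⊕ ((Fin (S.msgLen n) ⊕ Fin (S.sigLen n)) ⊕ Fin (R.zLen n))) (Fin (P.yLen n))
      (Fin (R.cInLen n)) (Fin (R.cOutLen n)) (Fin (P.qLen n)) (Fin (P.aLen n)) :=
  (wires (Sum.elim (fun i => .inl (.inr (.inl (.inl i))))
    (Sum.elim (fun i => .inl (.inr (.inl (.inr i)))) (Sum.elim (fun i => .inl (.inr (.inr i)))
    fun i => .inr (r₁ i))))).comp (R.finishAlg n)

theorem cval_finishCircuit [Fintype I] [DecidableEq I] (r₁ : BitStr (R.finishCoins n))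
    (Oc : R.COracle n) (s : BitStr (P.coinLen n))
    (h : Transcript (Fin (P.qLen n)) (Fin (P.aLen n))) (x : Bits I)
    (y : Bits (Fin (S.msgLen n) ⊕ Fin (S.sigLen n))) (z : R.Z n) :
    (finishCircuit R n r₁).cval Oc (challenger P n s) h (Sum.elim x (Sum.elim y z))
        (fun o h' => ind (P.win n s h' o)) =
      ind (R.finishWins n s Oc z h (y ∘ Sum.inl) (y ∘ Sum.inr) r₁) := by
  refine (Circuit.cval_comp _ (R.finishAlg n) Oc _ _ _ _).trans
    ((Circuit.cval_eq_run (R.finishAlg n) Oc (P.ans n s) _ _ _).trans ?_)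
  rw [eval_wires]
  have hx : (fun o => Sum.elim (Sum.elim x (Sum.elim y z)) id
      ((Sum.elim (fun i => .inl (.inr (.inl (.inl i))))
      (Sum.elim (fun i => .inl (.inr (.inl (.inr i)))) (Sum.elim (fun i => .inl (.inr (.inr i)))
      fun i => .inr (r₁ i))) :
      Fin (S.msgLen n) ⊕ Fin (S.sigLen n) ⊕ Fin (R.zLen n) ⊕ Fin (R.finishCoins n) →
        (I ⊕ ((Fin (S.msgLen n) ⊕ Fin (S.sigLen n)) ⊕ Fin (R.zLen n))) ⊕ Bool) o)) =
      Sum.elim (y ∘ Sum.inl) (Sum.elim (y ∘ Sum.inr) (Sum.elim z r₁)) := by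
    funext o
    rcases o with o | o | o | o <;> rfl
  rw [hx]
  rfl

theorem size_finishCircuit_le [Fintype I] [DecidableEq I] (r₁ : BitStr (R.finishCoins n)) :
    (finishCircuit R n r₁ : CAlg (I ⊕ _) _ _ _ _ _).size ≤
      Fintype.card I + 5 * (R.finishAlg n).size := by
  refine (Circuit.size_comp_le _ _).trans ((add_le_add_left (size_wires_le _) _).trans ?_)
  have := (R.finishAlg n).card_inp_le
  have h : (R.finishAlg n).prog.length + Fintype.card (R.finishAlg n).W =
    (R.finishAlg n).size := rfl
  simp only [Fintype.card_sum] at this ⊢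
  omega

/-- The forger with the algorithms of the reduction, with fixed coins. -/
def reductionAssembly (Q : S.QForger n) (r₀ : BitStr (R.startCoins n))
    (r₁ : BitStr (R.finishCoins n)) (ρ : ℕ → BitStr (R.signCoins n)) :
    Assembly (Fin (P.xLen n)) (Fin (S.pkLen n)) (Fin (S.msgLen n) ⊕ Fin (S.sigLen n))
      (Fin (P.yLen n)) (Fin (R.zLen n)) (Fin (S.inLen n)) (Fin (S.outLen n)) (Fin (S.msgLen n))
      (Fin (S.sigLen n)) (Fin (R.cInLen n)) (Fin (R.cOutLen n)) (Fin (P.qLen n))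
      (Fin (P.aLen n)) where
  Q := Q
  start := startCircuit R n r₀
  rand := R.randAlg n
  sgn k := signCircuit R n (ρ k)
  fin := finishCircuit R n r₁

theorem prob_reductionAssembly (Q : S.QForger n) (r₀ : BitStr (R.startCoins n))
    (r₁ : BitStr (R.finishCoins n)) (ρ : ℕ → BitStr (R.signCoins n)) (s : BitStr (P.coinLen n))
    (Oc : R.COracle n) :
    (reductionAssembly R n Q r₀ r₁ ρ).circuit.prob Oc (challenger P n s) [] (P.win n s)
        (P.inst n s) =
      qval (R.simOracle n Oc (R.startZ n s r₀))
        (fun k => respond fun h m (_ : Unit) =>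
          signStepNoAbort R n s Oc (R.startZ n s r₀) h m (ρ k))
        (fun h w => ind (R.finishWins n s Oc (R.startZ n s r₀) h ((w ∘ Q.out) ∘ Sum.inl)
          ((w ∘ Q.out) ∘ Sum.inr) r₁))
        Q.prog (R.startRun n s r₀).2 fun w => if w = Q.start (R.startPK n s r₀) then 1 else 0 := by
  rw [Assembly.prob_circuit]
  refine (cval_startCircuit R n r₀ Oc s _).trans ?_
  change qval (R.simOracle n Oc (R.startZ n s r₀)) _ _ Q.prog _ _ = _
  refine qval_eq_qval (C := Fin (S.msgLen n)) (D := Fin (S.sigLen n))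
    (St := Transcript (Fin (P.qLen n)) (Fin (P.aLen n)) ×
      (Fin (Q.prog.length + 1) → Bits (Option (Fin (S.msgLen n)))))
    (St' := Transcript (Fin (P.qLen n)) (Fin (P.aLen n))) _
    (Rel := fun k s s' => k ≤ Q.prog.length ∧ s.1 = s') ?_ ?_ ?_ Q.prog _ _ ⟨le_rfl, rfl⟩ _
  · rintro k s s' ⟨h1, h2⟩
    exact ⟨by omega, h2⟩
  · rintro k s' _ v κ κ' ⟨hk, rfl⟩ hκ
    refine (cval_signCircuit R n _ Oc s s'.1 v _ _).trans ?_
    have hk' : ((reductionAssembly R n Q r₀ r₁ ρ).pos k : ℕ) = k :=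
      (reductionAssembly R n Q r₀ r₁ ρ).val_pos ((Nat.le_succ k).trans hk)
    rw [hk']
    congr 1
    funext y st'
    exact hκ _ _ _ ⟨by omega, rfl⟩
  · rintro s' _ w ⟨-, rfl⟩
    exact cval_finishCircuit R n r₁ Oc s s'.1 _ _ _

/-- Probability that FINISH wins, with fixed coins, and if the abort flag is ignored. -/
def winProbNoAbort (Q : S.QForger n) (s : BitStr (P.coinLen n)) (r : BitStr (R.startCoins n))
    (Oc : R.COracle n) (r₁ : BitStr (R.finishCoins n)) : ℝ :=
  qexpect (R.simOracle n Oc (R.startZ n s r)) (signStepNoAbort R n s Oc (R.startZ n s r))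
    (fun h w => ind (R.finishWins n s Oc (R.startZ n s r) h ((w ∘ Q.out) ∘ Sum.inl)
      ((w ∘ Q.out) ∘ Sum.inr) r₁))
    Q.prog (R.startRun n s r).2 fun w => if w = Q.start (R.startPK n s r) then 1 else 0

theorem quantumWinProb_le (Q : S.QForger n) :
    quantumWinProb R n Q ≤ 𝔼 s, 𝔼 r, 𝔼 Oc, 𝔼 r₁, winProbNoAbort R n Q s r Oc r₁ := by
  refine Finset.expect_le_expect fun s _ => Finset.expect_le_expect fun r _ =>
    Finset.expect_le_expect fun Oc _ => ?_
  rw [qexpect_expect]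
  refine Finset.expect_le_expect fun r₁ _ => qexpect_le_of_no_abort _ (fun h m ρ => ?_)
    (fun _ _ => ind_nonneg _) _ _ _
  simp only [Reduction.signStep, signStepNoAbort]
  split_ifs
  · exact .inl rfl
  · exact .inr rfl

/-- Two of the coins of an average are fixed at the best values. -/
theorem exists_fixed_coins {E F G H : Type} [Fintype E] [Fintype F] [Nonempty F] [Fintype G]
    [Fintype H] [Nonempty H] (X : E → F → G → H → ℝ) :
    ∃ r₀ r₁, 𝔼 s, 𝔼 r, 𝔼 c, 𝔼 r', X s r c r' ≤ 𝔼 s, 𝔼 c, X s r₀ c r₁ := by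
  obtain ⟨r₀, hr⟩ := Finite.exists_max fun r : F × H => 𝔼 s, 𝔼 c, X s r.1 c r.2
  refine ⟨r₀.1, r₀.2, ?_⟩
  rw [Finset.expect_comm]
  refine Finset.expect_le Finset.univ_nonempty fun r _ => ?_
  rw [Finset.expect_congr rfl fun s _ => Finset.expect_comm _ _ _, Finset.expect_comm]
  exact Finset.expect_le Finset.univ_nonempty fun r' _ => hr (r, r')

/-- A quantum adversary for `P`, still with the random oracle of the reduction, that is at least as
successful as the reduction. -/
theorem exists_adversary_with_oracle (Q : S.QForger n) {s : ℕ} (hQ : Q.size ≤ s)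
    (h1 : (R.startAlg n).size ≤ s) (h2 : (R.randAlg n).size ≤ s) (h3 : (R.signAlg n).size ≤ s)
    (h4 : (R.finishAlg n).size ≤ s) :
    ∃ B : QAlg (Fin (P.xLen n)) (Fin (P.yLen n)) (Fin (R.cInLen n)) (Fin (R.cOutLen n))
        (Fin (P.qLen n)) (Fin (P.aLen n)), B.size ≤ 539 * (s + 1) ^ 4 ∧
      quantumWinProb R n Q ≤ 𝔼 s, 𝔼 Oc : R.COracle n,
        B.prob Oc (challenger P n s) [] (P.win n s) (P.inst n s) := by
  obtain ⟨r₀, r₁, hr⟩ := exists_fixed_coins (winProbNoAbort R n Q)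
  have hmax := (quantumWinProb_le R n Q).trans hr
  obtain ⟨ρ, hρ⟩ := exists_coins (Ω := BitStr (P.coinLen n) × R.COracle n)
    (fun _ => ((Fintype.card (BitStr (P.coinLen n)) : ℝ))⁻¹ * (Fintype.card (R.COracle n) : ℝ)⁻¹)
    (fun ω => R.simOracle n ω.2 (R.startZ n ω.1 r₀))
    (fun ω => signStepNoAbort R n ω.1 ω.2 (R.startZ n ω.1 r₀))
    (fun ω h w => ind (R.finishWins n ω.1 ω.2 (R.startZ n ω.1 r₀) h ((w ∘ Q.out) ∘ Sum.inl)
        ((w ∘ Q.out) ∘ Sum.inr) r₁)) Q.prog (fun ω => (R.startRun n ω.1 r₀).2)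
    (fun ω w => if w = Q.start (R.startPK n ω.1 r₀) then 1 else 0)
  have hexp : ∀ Y : BitStr (P.coinLen n) → R.COracle n → ℝ, 𝔼 s, 𝔼 Oc, Y s Oc =
      ∑ ω : BitStr (P.coinLen n) × R.COracle n,
        ((Fintype.card (BitStr (P.coinLen n)) : ℝ))⁻¹ * (Fintype.card (R.COracle n) : ℝ)⁻¹ *
          Y ω.1 ω.2 := by
    intro Y
    rw [← Finset.univ_product_univ, Finset.sum_product]
    simp only [Finset.expect_eq_sum_div_card, Finset.card_univ, div_eq_inv_mul, Finset.mul_sum,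
      mul_assoc]
  refine ⟨(reductionAssembly R n Q r₀ r₁ ρ).circuit, ?_, hmax.trans ?_⟩
  · have h5 := (R.signAlg n).card_inp_le
    have h6 : (R.signAlg n).prog.length + Fintype.card (R.signAlg n).W = (R.signAlg n).size := rfl
    have h7 : Q.prog.length + Fintype.card Q.W = Q.size := rfl
    have h8 : (Q.prog.length + 1) * (S.msgLen n + 1) ≤ (s + 1) * (s + 1) := by
      simp only [Fintype.card_sum, Fintype.card_fin] at h5
      gcongr <;> omega
    have h9 : s + 1 ≤ (s + 1) ^ 2 := Nat.le_self_pow (by norm_num) _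
    refine ((reductionAssembly R n Q r₀ r₁ ρ).size_circuit_le (s := 6 * (s + 1) ^ 2)
      ?_ ?_ ?_ (fun k => ?_) ?_).trans ?_
    · exact hQ.trans (by omega)
    · exact (size_startCircuit_le R n r₀).trans (by omega)
    · exact h2.trans (by omega)
    · exact (size_signCircuit_le R n (ρ k)).trans (by omega)
    · refine (size_finishCircuit_le R n r₁).trans ?_
      simp only [Fintype.card_prod, Fintype.card_option, Fintype.card_fin]
      change (Q.prog.length + 1) * (S.msgLen n + 1) + _ ≤ _
      rw [← sq] at h8
      omega
    · calc
        _ ≤ 11 * (7 * (s + 1) ^ 2) ^ 2 := by gcongr; omega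
        _ = _ := by ring
  · rw [hexp, hexp]
    refine hρ.trans_eq (Finset.sum_congr rfl fun ω _ => ?_)
    rw [prob_reductionAssembly]

end reduction

end

/-! ### Replacing the private random oracle -/

section

variable {S : SignatureScheme} {P : Problem} (R : Reduction S P) (n : ℕ)

theorem exists_fixed_key {E K : Type} [Fintype E] [Fintype K] [Nonempty K] (X : E → K → ℝ) :
    ∃ k, 𝔼 s, 𝔼 k, X s k ≤ 𝔼 s, X s k := by
  obtain ⟨k, hk⟩ := Finite.exists_max fun k => 𝔼 s, X s k
  refine ⟨k, ?_⟩
  rw [Finset.expect_comm]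
  exact Finset.expect_le Finset.univ_nonempty fun k _ => hk k

/-- A quantum adversary for `P` that is at least as successful as the reduction. The private random
oracle of the reduction is replaced by a polynomial of large degree over a finite field. -/
theorem exists_adversary (Q : S.QForger n) {s : ℕ} (hQ : Q.size ≤ s)
    (h1 : (R.startAlg n).size ≤ s) (h2 : (R.randAlg n).size ≤ s) (h3 : (R.signAlg n).size ≤ s)
    (h4 : (R.finishAlg n).size ≤ s) (hin : R.cInLen n ≤ s) (hout : R.cOutLen n ≤ s)
    (hx : P.xLen n ≤ s) (hy : P.yLen n ≤ s) (hq : P.qLen n ≤ s) (ha : P.aLen n ≤ s) :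
    ∃ B : P.Adversary n, B.size ≤ 396 * (25600 * (539 * (s + 1) ^ 4 + 1) ^ 4 + 1) ^ 4 ∧
      quantumWinProb R n Q ≤ P.winProb n B := by
  obtain ⟨B, hB, hwin⟩ := exists_adversary_with_oracle R n Q hQ h1 h2 h3 h4
  obtain ⟨K, _, _, F, hF, hdeg⟩ :=
    exists_independent_family (R.cInLen n) (R.cOutLen n) (2 * B.size)
  have heq : ∀ s, 𝔼 Oc : R.COracle n, B.prob Oc (challenger P n s) [] (P.win n s) (P.inst n s) =
      𝔼 k, B.prob (F k) (challenger P n s) [] (P.win n s) (P.inst n s) := by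
    intro s
    have hmem := LowDeg.qexpect (A := Fin (R.cInLen n)) (B := Fin (R.cOutLen n)) (challenger P n s)
      (fun st' w => ind (P.win n s st' (w ∘ B.out))) B.prog (d := 0) []
      (ψ := fun _ w => if w = B.start (P.inst n s) then 1 else 0) fun w => LowDeg.const _
    have hle : 2 * (0 + B.prog.countP Instr.isQuery) ≤ 2 * B.size := by
      have := List.countP_le_length (p := Instr.isQuery) (l := B.prog)
      simp only [Circuit.size]
      omega
    have := hdeg _ (LowDeg.mono hle hmem)
    apply Complex.ofReal_injective
    simp only [Finset.expect_eq_sum_div_card, Complex.ofReal_div, Complex.ofReal_sum,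
      Complex.ofReal_natCast] at this ⊢
    exact this.symm
  obtain ⟨k, hk⟩ := exists_fixed_key fun s k =>
    B.prob (F k) (challenger P n s) [] (P.win n s) (P.inst n s)
  have hpow : s + 1 ≤ (s + 1) ^ 4 := Nat.le_self_pow (by norm_num) _
  have hlt : 539 * (s + 1) ^ 4 ≤ 25600 * (539 * (s + 1) ^ 4 + 1) ^ 4 :=
    calc
      _ ≤ 539 * (s + 1) ^ 4 + 1 := by omega
      _ ≤ (539 * (s + 1) ^ 4 + 1) ^ 4 := Nat.le_self_pow (by norm_num) _
      _ ≤ _ := by omega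
  obtain ⟨c, hc, hcp⟩ := exists_replaceOracle B (s := 25600 * (539 * (s + 1) ^ 4 + 1) ^ 4)
    (by omega) ((hF k).mono (by
      calc
        _ ≤ 100 * (4 * (539 * (s + 1) ^ 4 + 1)) ^ 4 := by gcongr; omega
        _ = _ := by ring))
    (by rw [Fintype.card_fin]; omega) (by rw [Fintype.card_fin]; omega)
    (by rw [Fintype.card_fin]; omega) (by rw [Fintype.card_fin]; omega)
    (by rw [Fintype.card_fin]; omega)
  refine ⟨c, hc, hwin.trans ?_⟩
  calc
    _ = 𝔼 s, 𝔼 k, B.prob (F k) (challenger P n s) [] (P.win n s) (P.inst n s) :=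
      Finset.expect_congr rfl fun s _ => heq s
    _ ≤ 𝔼 s, B.prob (F k) (challenger P n s) [] (P.win n s) (P.inst n s) := hk
    _ = P.winProb n c := Finset.expect_congr rfl fun s _ => (hcp id _ _ _ _).symm

/-! ### From classical to quantum forgers -/

theorem play_sub {M Sg St R : Type} [Fintype R] (next : List (M × Sg) → Option M)
    (step : St → M → R → Option (Sg × St)) (val val' : List (M × Sg) → St → ℝ) (c : ℝ) (k : ℕ)
    (t : List (M × Sg)) (st : St) :
    play next step (fun t st => val t st - c * val' t st) k t st =
      play next step val k t st - c * play next step val' k t st := by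
  induction k generalizing t st with
  | zero => rfl
  | succ k ih =>
    simp only [play]
    rcases next t with - | m
    · rfl
    · simp only
      rw [Finset.mul_expect, ← Finset.expect_sub_distrib]
      refine Finset.expect_congr rfl fun r _ => ?_
      rcases step st m r with - | ⟨y, st'⟩
      · simp
      · exact ih _ _

/-- A sum over the fibres of a map. -/
theorem sum_ite_comp {Ω Y : Type} [Fintype Ω] [Fintype Y] [DecidableEq Y] (y : Ω → Y)
    (X : Y → Ω → ℝ) : ∑ z, ∑ ω, (if y ω = z then 1 else 0) * X z ω = ∑ ω, X (y ω) ω := by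
  rw [Finset.sum_comm]
  refine Finset.sum_congr rfl fun ω _ => ?_
  rw [Finset.sum_eq_single (y ω)] <;> simp +contextual [eq_comm]

/-- If FINISH turns the forgeries of classical forgers into solutions of `P`, then it does so for
quantum forgers: these are not better than classical ones that see the whole oracle. -/
theorem expect_validForgery_le (Q : S.QForger n) {q : ℕ} (hq : Q.calls ≤ q) {p ε : ℝ}
    (h : ∀ (next : S.PK n → S.Oracle n → S.History n → Option (S.Msg n))
      (out : S.PK n → S.Oracle n → S.History n → S.Msg n × S.Sig n),
      R.simGame n q next (fun _ Oc pk z t _ =>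
          let f := R.simOracle n Oc z
          ind (S.validForgery n f pk (t.map Prod.fst) (out pk f t).1 (out pk f t).2)) ≤
        p * R.simGame n q next (fun s Oc pk z t h =>
          let f := R.simOracle n Oc z
          𝔼 r, ind (R.finishWins n s Oc z h (out pk f t).1 (out pk f t).2 r)) + ε) :
    𝔼 s, 𝔼 r, 𝔼 Oc, qexpect (R.simOracle n Oc (R.startZ n s r))
        (track (R.signStep n s Oc (R.startZ n s r)))
        (fun st w => ind (S.validForgery n (R.simOracle n Oc (R.startZ n s r)) (R.startPK n s r)
          (st.1.map Prod.fst) ((w ∘ Q.out) ∘ Sum.inl) ((w ∘ Q.out) ∘ Sum.inr)))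
        Q.prog ([], (R.startRun n s r).2)
        (fun w => if w = Q.start (R.startPK n s r) then 1 else 0) ≤
      p * quantumWinProb R n Q + ε := by
  let Ω := BitStr (P.coinLen n) × BitStr (R.startCoins n) × R.COracle n
  let pk : Ω → S.PK n := fun ω => R.startPK n ω.1 ω.2.1
  let O : Ω → S.Oracle n := fun ω => R.simOracle n ω.2.2 (R.startZ n ω.1 ω.2.1)
  let step := fun ω : Ω => R.signStep n ω.1 ω.2.2 (R.startZ n ω.1 ω.2.1)
  let h0 := fun ω : Ω => (R.startRun n ω.1 ω.2.1).2
  let V1 : Ω → S.History n → S.Msg n × S.Sig n → ℝ := fun ω t y =>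
    ind (S.validForgery n (O ω) (pk ω) (t.map Prod.fst) y.1 y.2)
  let V2 : Ω → Transcript (Fin (P.qLen n)) (Fin (P.aLen n)) → S.Msg n × S.Sig n → ℝ := fun ω h y =>
    𝔼 r, ind (R.finishWins n ω.1 ω.2.2 (R.startZ n ω.1 ω.2.1) h y.1 y.2 r)
  let res : Bits Q.W → S.Msg n × S.Sig n := fun w => ((w ∘ Q.out) ∘ Sum.inl, (w ∘ Q.out) ∘ Sum.inr)
  -- The forger sees the pair `y` of a public key and an oracle; the runs that lead to other pairs
  -- have weight `0`. A strategy that depends on `y` is what `h` applies to.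
  have key := fun y : S.PK n × S.Oracle n => exists_strategy
    (fun ω => if (pk ω, O ω) = y then (1 : ℝ) else 0) y.2 step
    (fun ω t h w => V1 ω t (res w) - p * V2 ω h (res w)) Q.prog hq [] h0
    (fun w => if w = Q.start y.1 then 1 else 0)
  choose next out hno using key
  have hsum := Finset.sum_le_sum fun y (_ : y ∈ Finset.univ) => hno y
  simp only [nsq_basis, one_mul] at hsum
  rw [sum_ite_comp (fun ω => (pk ω, O ω)) fun y ω => qexpect y.2 (track (step ω))
      (fun s w => V1 ω s.1 (res w) - p * V2 ω s.2 (res w)) Q.prog ([], h0 ω)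
      fun w => if w = Q.start y.1 then 1 else 0,
    sum_ite_comp (fun ω => (pk ω, O ω)) fun y ω => play (next y) (step ω)
      (fun t h => V1 ω t (res (out y t)) - p * V2 ω h (res (out y t))) q [] (h0 ω)] at hsum
  simp only [play_sub, qexpect_sub] at hsum
  have hexp : ∀ Y : Ω → ℝ, 𝔼 s, 𝔼 r, 𝔼 Oc, Y (s, r, Oc) = (Fintype.card Ω : ℝ)⁻¹ * ∑ ω, Y ω := by
    intro Y
    simp only [Ω, Finset.expect_eq_sum_div_card, Fintype.sum_prod_type, Fintype.card_prod,
      Finset.card_univ, Nat.cast_mul, div_eq_inv_mul, Finset.mul_sum, mul_inv, mul_assoc]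
  have hcard : (0 : ℝ) ≤ (Fintype.card Ω : ℝ)⁻¹ := by positivity
  have hmul := mul_le_mul_of_nonneg_left hsum hcard
  simp only [Finset.sum_sub_distrib, ← Finset.mul_sum, mul_sub, mul_left_comm _ p] at hmul
  simp only [← hexp] at hmul
  have h' := h (fun pk f => next (pk, f)) fun pk f t => res (out (pk, f) t)
  have h1 : quantumWinProb R n Q = 𝔼 s, 𝔼 r, 𝔼 Oc, (fun ω : Ω => qexpect (O ω) (track (step ω))
      (fun s w => V2 ω s.2 (res w)) Q.prog ([], h0 ω)
      fun w => if w = Q.start (pk ω) then 1 else 0) (s, r, Oc) := by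
    refine Finset.expect_congr rfl fun s _ => Finset.expect_congr rfl fun r _ =>
      Finset.expect_congr rfl fun Oc _ => ?_
    exact (qexpect_track _ _ (fun h w => V2 (s, r, Oc) h (res w)) _ _ _ _).symm
  have hfin : ∀ a b c d : ℝ, a - p * b ≤ c - p * d → c ≤ p * d + ε → a ≤ p * b + ε := by
    intros; linarith
  rw [h1]
  exact hfin _ _ _ _ hmul h'

end

/-! ### Changing the distribution of the public key -/

section


/-- To draw `g`, one may draw `z g` first, and then `g` conditioned on it. -/
theorem expect_fibre {G Y : Type} [Fintype G] [DecidableEq Y] (z : G → Y) (F : G → ℝ) :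
    𝔼 g, F g = 𝔼 g, 𝔼 g' with z g' = z g, F g' := by
  rw [Finset.expect_eq_sum_div_card, Finset.expect_eq_sum_div_card]
  congr 1
  have h1 : ∀ g, 𝔼 g' with z g' = z g, F g' = ∑ g', if z g' = z g then
      F g' / (Finset.univ.filter fun g'' => z g'' = z g').card else 0 := by
    intro g
    rw [Finset.expect_eq_sum_div_card, Finset.sum_div, Finset.sum_filter]
    refine Finset.sum_congr rfl fun g' _ => ?_
    split_ifs with h
    · rw [h]
    · rfl
  simp only [h1]
  rw [Finset.sum_comm]
  refine Finset.sum_congr rfl fun g' _ => ?_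
  rw [← Finset.sum_filter, Finset.sum_const, nsmul_eq_mul]
  have h2 : (Finset.univ.filter fun g => z g' = z g) =
      Finset.univ.filter fun g'' => z g'' = z g' := by
    ext g
    simp [eq_comm]
  rw [h2, mul_div_cancel₀]
  exact_mod_cast (Finset.card_pos.mpr ⟨g', by simp⟩).ne'

/-- Public keys `z g` are replaced by the keys `y s r` computed from an instance `i s`, if the
instance `j g` determines `z g`, and is almost distributed as `i s`. -/
theorem expect_le_add_dist {G E R X Y : Type} [Fintype G] [Fintype E] [Fintype R] [Nonempty R]
    [Fintype X] [DecidableEq X] (i : E → X) (j : G → X) (y : E → R → Y) (z : G → Y)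
    (h : ∀ g s r, i s = j g → y s r = z g) {Ψ : Y → ℝ} (h0 : ∀ a, 0 ≤ Ψ a) (h1 : ∀ a, Ψ a ≤ 1) :
    𝔼 g, Ψ (z g) ≤ 𝔼 s, 𝔼 r, Ψ (y s r) +
      ∑ x, |(𝔼 s, ind (decide (i s = x))) - 𝔼 g, ind (decide (j g = x))| := by
  have split : ∀ {H : Type} [Fintype H] (k : H → X) (F : H → ℝ),
      𝔼 g, F g = ∑ x, 𝔼 g, ind (decide (k g = x)) * F g := by
    intro H _ k F
    rw [← Finset.expect_sum_comm]
    refine Finset.expect_congr rfl fun g _ => ?_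
    rw [Finset.sum_eq_single (k g)]
    · simp [ind]
    · intro x _ hx
      simp [ind, hx.symm]
    · simp
  rw [split j, split i, ← Finset.sum_add_distrib]
  refine Finset.sum_le_sum fun x _ => ?_
  have hs0 : 0 ≤ 𝔼 s, ind (decide (i s = x)) * 𝔼 r, Ψ (y s r) :=
    Finset.expect_nonneg fun s _ => mul_nonneg (ind_nonneg _) (Finset.expect_nonneg fun r _ => h0 _)
  by_cases hg : ∃ g, j g = x
  · obtain ⟨g₀, hg₀⟩ := hg
    by_cases hs : ∃ s, i s = x
    · obtain ⟨s₀, hs₀⟩ := hs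
      obtain ⟨r₀⟩ := (inferInstance : Nonempty R)
      -- All keys `z g` with the instance `x` agree, since `y s₀ r₀` is determined.
      have hz : ∀ g, ind (decide (j g = x)) * Ψ (z g) = ind (decide (j g = x)) * Ψ (z g₀) := by
        intro g
        by_cases hgx : j g = x
        · rw [← h g s₀ r₀ (hs₀.trans hgx.symm), ← h g₀ s₀ r₀ (hs₀.trans hg₀.symm)]
        · simp [ind, hgx]
      have hy : ∀ s, ind (decide (i s = x)) * 𝔼 r, Ψ (y s r) =
          ind (decide (i s = x)) * Ψ (z g₀) := by
        intro s
        by_cases hsx : i s = x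
        · have : ∀ r, Ψ (y s r) = Ψ (z g₀) := fun r => by rw [h g₀ s r (hsx.trans hg₀.symm)]
          simp only [this]
          rw [Finset.expect_const Finset.univ_nonempty]
        · simp [ind, hsx]
      simp only [hz, hy]
      rw [← Finset.expect_mul, ← Finset.expect_mul]
      have := neg_abs_le ((𝔼 s, ind (decide (i s = x))) - 𝔼 g, ind (decide (j g = x)))
      have := mul_le_of_le_one_right
        (abs_nonneg ((𝔼 s, ind (decide (i s = x))) - 𝔼 g, ind (decide (j g = x)))) (h1 (z g₀))
      nlinarith [h0 (z g₀), h1 (z g₀)]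
    · push Not at hs
      have hi : 𝔼 s, ind (decide (i s = x)) = 0 := by
        simp [hs, ind]
      rw [hi, zero_sub, abs_neg]
      have h2 : 𝔼 g, ind (decide (j g = x)) * Ψ (z g) ≤ 𝔼 g, ind (decide (j g = x)) :=
        Finset.expect_le_expect fun g _ => mul_le_of_le_one_right (ind_nonneg _) (h1 _)
      have := le_abs_self (𝔼 g, ind (decide (j g = x)))
      linarith
  · push Not at hg
    have : 𝔼 g, ind (decide (j g = x)) * Ψ (z g) = 0 := by
      simp [hg, ind]
    rw [this]
    exact add_nonneg hs0 (abs_nonneg _)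

section games
variable {S : SignatureScheme} {P : Problem} (R : Reduction S P) (n : ℕ)

/-- Probability that the distinguisher accepts with correct signatures, for keys from the coins
`g`. -/
def correctProb (d : S.SignDistinguisher n) (f : S.Oracle n) (g : BitStr (S.genCoins n)) : ℝ :=
  d.prob f (fun (_ : Unit) m ρ => some (S.signWith n f (S.sk n g) m ρ, ())) () (fun _ y => y ())
    (S.pk n g)

/-- From the game of the scheme to the game with START and RAND, but correct signatures. -/
theorem expect_correctProb_le (hI : ∀ g s r, P.inst n s = (R.instAlg n).eval id (S.pk n g) →
      R.startPK n s r = S.pk n g) (d : S.SignDistinguisher n) {δ : ℝ} (hδ : 0 ≤ δ)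
    (hR : ∀ s r g, 𝔼 f, correctProb n d f g -
      𝔼 Oc : R.COracle n, correctProb n d (R.simOracle n Oc (R.startZ n s r)) g ≤ δ) :
    𝔼 f, 𝔼 g, correctProb n d f g ≤ R.honestProb n d + δ +
      ∑ x : BitStr (P.xLen n), |(𝔼 s, ind (decide (P.inst n s = x)))
        - 𝔼 g, ind (decide ((R.instAlg n).eval id (S.pk n g) = x))| := by
  have h0 : ∀ f g, 0 ≤ correctProb n d f g := fun f g => Circuit.prob_nonneg _ _ _ _ _ _
  have h1 : ∀ f g, correctProb n d f g ≤ 1 := fun f g => Circuit.prob_le_one _ _ _ _ _ _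
  let Ψ : S.PK n → ℝ := fun pk => 𝔼 g with S.pk n g = pk, 𝔼 f, correctProb n d f g
  have hΨ0 : ∀ pk, 0 ≤ Ψ pk := fun pk => Finset.expect_nonneg fun g _ =>
    Finset.expect_nonneg fun f _ => h0 f g
  have hexp_le : ∀ {ι : Type} (s : Finset ι) (F : ι → ℝ) (c : ℝ), 0 ≤ c → (∀ i ∈ s, F i ≤ c) →
      𝔼 i ∈ s, F i ≤ c := by
    intro ι s F c hc hF
    rcases s.eq_empty_or_nonempty with rfl | hs
    · simpa using hc
    · exact Finset.expect_le hs hF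
  have hΨ1 : ∀ pk, Ψ pk ≤ 1 := fun pk => hexp_le _ _ _ zero_le_one fun g _ =>
    hexp_le _ _ _ zero_le_one fun f _ => h1 f g
  have hmain := expect_le_add_dist (P.inst n) (fun g => (R.instAlg n).eval id (S.pk n g))
    (R.startPK n) (S.pk n) hI hΨ0 hΨ1
  have hbound : 𝔼 s, 𝔼 r, Ψ (R.startPK n s r) ≤ R.honestProb n d + δ := by
    have : ∀ s r, Ψ (R.startPK n s r) ≤ (𝔼 g with S.pk n g = R.startPK n s r, 𝔼 Oc : R.COracle n,
        d.prob (R.simOracle n Oc (R.startZ n s r)) (fun (_ : Unit) m ρ =>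
          some (S.signWith n (R.simOracle n Oc (R.startZ n s r)) (S.sk n g) m ρ, ())) ()
          (fun _ y => y ()) (R.startPK n s r)) + δ := by
      intro s r
      rw [← sub_le_iff_le_add', ← Finset.expect_sub_distrib]
      refine hexp_le _ _ _ hδ fun g hg => ?_
      rw [← (Finset.mem_filter.mp hg).2]
      exact hR s r g
    refine (Finset.expect_le_expect fun s _ => Finset.expect_le_expect fun r _ => this s r).trans ?_
    simp only [Finset.expect_add_distrib]
    rw [Finset.expect_const Finset.univ_nonempty, Finset.expect_const Finset.univ_nonempty]
    rfl
  rw [Finset.expect_comm, expect_fibre (S.pk n)]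
  linarith

end games

/-- The forger succeeds exactly if the verification that follows it accepts. -/
theorem forgeProb_eq {S : SignatureScheme} {n : ℕ} (Q : S.QForger n) (d : S.SignDistinguisher n)
    (hd : ∀ {R St : Type} [Fintype R] (f : S.Oracle n)
      (step : St → S.Msg n → R → Option (S.Sig n × St)) (st : St) (pk : S.PK n),
      d.prob f step st (fun _ y => y ()) pk =
        qexpect f (track step) (fun st' w => ind (S.validForgery n f pk (st'.1.map Prod.fst)
          ((w ∘ Q.out) ∘ Sum.inl) ((w ∘ Q.out) ∘ Sum.inr))) Q.prog ([], st)
          fun w => if w = Q.start pk then 1 else 0) :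
    S.forgeProb n Q = 𝔼 f, 𝔼 g, correctProb n d f g := by
  refine Finset.expect_congr rfl fun f _ => Finset.expect_congr rfl fun g _ => ?_
  rw [correctProb, hd, Circuit.prob, ← qval_respond, ← qval_respond]
  symm
  refine qval_eq_qval (St := Transcript (Fin (S.msgLen n)) (Fin (S.sigLen n)) × Unit)
    (St' := List (S.Msg n)) f (Rel := fun _ s s' => s.1.map Prod.fst = s') ?_ ?_ ?_ Q.prog _ _ rfl _
  · exact fun _ _ _ h => h
  · rintro k ⟨t, s⟩ s' v κ κ' rfl hκ
    rw [respond_track]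
    refine Finset.expect_congr rfl fun r _ => hκ _ _ _ ?_
    simp
  · rintro s s' w rfl
    rfl

end

/-! ### Unforgeability -/

section


section games
variable {S : SignatureScheme} {P : Problem} (R : Reduction S P) (n : ℕ)

/-- The simulated random oracle can only be told apart in a signature game as well as by a
distinguisher without signatures: the secret key and the coins of the signer can be hardwired. -/
theorem exists_rand_distinguisher (d : S.SignDistinguisher n) {s : ℕ} (hd : d.size ≤ s)
    (hS : (S.sign n).size ≤ s) (hin : S.inLen n ≤ s) (hout : S.outLen n ≤ s)
    (hpk : S.pkLen n ≤ s) (hmsg : S.msgLen n ≤ s) :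
    ∃ (s₀ : BitStr (P.coinLen n)) (r₀ : BitStr (R.startCoins n))
      (d' : Distinguisher (S.inLen n) (S.outLen n)), d'.size ≤ 396 * (s + 1) ^ 4 ∧
      ∀ s r g, 𝔼 f, correctProb n d f g -
          𝔼 Oc : R.COracle n, correctProb n d (R.simOracle n Oc (R.startZ n s r)) g ≤
        |(𝔼 Oc : R.COracle n, acceptProb d' (R.simOracle n Oc (R.startZ n s₀ r₀)))
          - 𝔼 f : S.Oracle n, acceptProb d' f| := by
  obtain ⟨⟨s₀, r₀, g₀⟩, hmax⟩ := Finite.exists_max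
    fun ω : BitStr (P.coinLen n) × BitStr (R.startCoins n) × BitStr (S.genCoins n) =>
      𝔼 f, correctProb n d f ω.2.2 -
        𝔼 Oc : R.COracle n, correctProb n d (R.simOracle n Oc (R.startZ n ω.1 ω.2.1)) ω.2.2
  -- The weights are those of the difference of the averages over the two oracles.
  obtain ⟨d', hd', hle⟩ := exists_distinguisher S n d hd hS hin hout hpk hmsg (S.pk n g₀)
    (S.sk n g₀) (Ω := S.Oracle n ⊕ R.COracle n)
    (Sum.elim (fun _ => (Fintype.card (S.Oracle n) : ℝ)⁻¹)
      fun _ => -(Fintype.card (R.COracle n) : ℝ)⁻¹)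
    (Sum.elim id fun Oc => R.simOracle n Oc (R.startZ n s₀ r₀))
  have hexp : ∀ Y : S.Oracle n → ℝ, ∑ ω : S.Oracle n ⊕ R.COracle n,
      Sum.elim (fun _ => (Fintype.card (S.Oracle n) : ℝ)⁻¹)
        (fun _ => -(Fintype.card (R.COracle n) : ℝ)⁻¹) ω *
        Y (Sum.elim id (fun Oc => R.simOracle n Oc (R.startZ n s₀ r₀)) ω) =
      𝔼 f, Y f - 𝔼 Oc, Y (R.simOracle n Oc (R.startZ n s₀ r₀)) := by
    intro Y
    simp only [Fintype.sum_sum_type, Sum.elim_inl, Sum.elim_inr, Finset.expect_eq_sum_div_card,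
      Finset.card_univ, ← Finset.mul_sum, div_eq_inv_mul, id]
    ring
  refine ⟨s₀, r₀, d', hd', fun s r g => (hmax (s, r, g)).trans ?_⟩
  rw [hexp fun f => acceptProb d' f, hexp fun f => d.prob f (fun (_ : Unit) m ρ =>
    some (S.signWith n f (S.sk n g₀) m ρ, ())) () (fun _ y => y ()) (S.pk n g₀)] at hle
  rw [abs_sub_comm]
  exact hle.trans (le_abs_self _)

end games

/-- The success probability of a forger is bounded by the winning probability of an adversary for
`P`, up to polynomial factors and negligible summands. -/
theorem quantumUnforgeable_of_historyFreeReduction (S : SignatureScheme) (P : Problem)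
    (hred : HasHistoryFreeReduction S P) (hhard : P.QuantumHard) : S.QuantumUnforgeable := by
  intro A hA
  obtain ⟨q, hq⟩ := hA
  obtain ⟨R, ⟨hI, hdist⟩, hR, ⟨p, hSign⟩, p', ε', hε', hFin⟩ := hred q
  obtain ⟨-, hSpk, hSmsg, hSsig, hSin, hSout⟩ := S.polyLen
  obtain ⟨-, hSsign, hSver⟩ := S.efficient
  obtain ⟨hPx, hPq, hPa, hPy⟩ := P.polyLen
  obtain ⟨-, hRin, hRout⟩ := R.polyLen
  obtain ⟨hRstart, hRrand, hRsign, hRfin, -⟩ := R.efficient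
  -- A common bound for all lengths and sizes.
  have hA' : PolyBounded fun n => (A n).size := ⟨q, hq⟩
  obtain ⟨M, hM, hMn⟩ : ∃ M : ℕ → ℕ, PolyBounded M ∧ ∀ n, M n =
      (A n).size + S.pkLen n + S.msgLen n + S.sigLen n +
      (S.inLen n + S.outLen n + (S.sign n).size + (S.verify n).size +
      (P.xLen n + P.qLen n + (P.aLen n + P.yLen n) +
      (R.cInLen n + R.cOutLen n + ((R.startAlg n).size + (R.randAlg n).size) +
      ((R.signAlg n).size + (R.finishAlg n).size)))) :=
    ⟨_, (((hA'.add hSpk).add hSmsg).add hSsig).add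
    ((((hSin.add hSout).add hSsign).add hSver).add (((hPx.add hPq).add (hPa.add hPy)).add
      (((hRin.add hRout).add (hRstart.add hRrand)).add (hRsign.add hRfin)))), fun _ => rfl⟩
  have hd := fun n => exists_signDistinguisher S n (A n) (s := M n) (by rw [hMn]; omega)
    (by rw [hMn]; omega) (by rw [hMn]; omega) (by rw [hMn]; omega) (by rw [hMn]; omega)
    (by rw [hMn]; omega) (by rw [hMn]; omega)
  choose d hdsize hdcalls hdprob using hd
  obtain ⟨N, hN, hNn⟩ : ∃ N : ℕ → ℕ, PolyBounded N ∧
      ∀ n, N n = 10 ^ 12 * (M n + 1) ^ 12 + M n :=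
    ⟨_, (hM.const_mul_pow (10 ^ 12) 12).add hM, fun _ => rfl⟩
  have hd' := fun n => exists_rand_distinguisher R n (d n) (s := N n)
    ((hdsize n).trans (by rw [hNn]; omega)) (by rw [hNn, hMn]; omega) (by rw [hNn, hMn]; omega)
    (by rw [hNn, hMn]; omega) (by rw [hNn, hMn]; omega) (by rw [hNn, hMn]; omega)
  choose s₀ r₀ d' hd'size hd'le using hd'
  have hδ := hR s₀ r₀ d' ((hN.const_mul_pow 396 4).mono hd'size)
  obtain ⟨ε, hε, hSign⟩ := hSign d ((hM.const_mul_pow (10 ^ 12) 12).mono hdsize)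
    fun n => (hdcalls n).trans (List.countP_le_length.trans ((Nat.le_add_right _ _).trans (hq n)))
  have hB := fun n => exists_adversary R n (A n) (s := M n) (by rw [hMn]; omega)
    (by rw [hMn]; omega) (by rw [hMn]; omega) (by rw [hMn]; omega) (by rw [hMn]; omega)
    (by rw [hMn]; omega) (by rw [hMn]; omega) (by rw [hMn]; omega) (by rw [hMn]; omega)
    (by rw [hMn]; omega) (by rw [hMn]; omega)
  choose B hBsize hBwin using hB
  have hwin := hhard B ((((hM.const_mul_pow 539 4).const_mul_pow 25600 4).const_mul_pow 396 4).mono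
    hBsize)
  have hsim : ∀ n, R.simProb n (d n) ≤ ((p'.eval n : ℕ) : ℝ) * P.winProb n (B n) + ε' n := by
    intro n
    have h1 := expect_validForgery_le R n (A n) (q := q.eval n)
      (List.countP_le_length.trans ((Nat.le_add_right _ _).trans (hq n))) (hFin n)
    have h2 : ((p'.eval n : ℕ) : ℝ) * quantumWinProb R n (A n) ≤
        ((p'.eval n : ℕ) : ℝ) * P.winProb n (B n) :=
      mul_le_mul_of_nonneg_left (hBwin n) (Nat.cast_nonneg _)
    refine le_trans (le_of_eq ?_) (h1.trans (add_le_add_left h2 _))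
    exact Finset.expect_congr rfl fun s _ => Finset.expect_congr rfl fun r _ =>
      Finset.expect_congr rfl fun Oc _ => hdprob n _ _ _ _
  have hneg := ((((hwin.polynomial_mul p').add hε').polynomial_mul p).add hε).add (hδ.add hdist)
  refine hneg.of_le (fun n => ?_) fun n => ?_
  · exact Finset.expect_nonneg fun f _ => Finset.expect_nonneg fun g _ =>
      Circuit.prob_nonneg _ _ _ _ _ _
  · have h1 := expect_correctProb_le R n (hI n) (d n) (abs_nonneg _) (hd'le n)
    rw [forgeProb_eq (A n) (d n) (hdprob n)]
    have h2 := mul_le_mul_of_nonneg_left (hsim n) (Nat.cast_nonneg (α := ℝ) (p.eval n))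
    have h3 := hSign n
    linarith

end

end

end QROM


theorem theorem1 (S : QROM.SignatureScheme) (P : QROM.Problem)
    (hred : QROM.HasHistoryFreeReduction S P)
    (hhard : P.QuantumHard)
    (hprf : QROM.QuantumPRFExists) :
    S.QuantumUnforgeable :=
  QROM.quantumUnforgeable_of_historyFreeReduction S P hred hhard
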